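/- Let $p\in\{2,3\}$ and let $\Omega\subset\mathbb R^p$ be a bounded open polygonal (polyhedral) domain, that is, a connected open set which is the interior of a finite union of polytopes. Let $\partial\Omega=\Gamma^D\cup\Gamma^N$ with $\Gamma^D\cap\Gamma^N=\emptyset$, $\Gamma^D$ measurable and $\mathrm m(\Gamma^D)>0$, where $\mathrm m$ denotes the Lebesgue measure and also the $(p-1)$-dimensional Hausdorff measure. Consider $$\mathrm{div}(-\nabla v+\mathbf U v)+bv=f\ \text{ in }\Omega,\qquad (-\nabla v+\mathbf U v)\cdot\mathbf n=0\ \text{ on }\Gamma^N,\qquad v=v^D\ \text{ on }\Gamma^D,$$ with $\mathbf U\in C(\overline\Omega)^p$, $b\in L^\infty(\Omega)$, $b\ge 0$ a.e., $f\in L^\infty(\Omega)$ and $v^D\in L^\infty(\Gamma^D)$. An admissible mesh consists of a finite set $\mathcal T$ of nonempty open convex polytopes $K\subset\Omega$ (the cells), a finite set $\mathcal E$ of pairwise disjoint edges (a relatively open subset $\sigma\subset\overline\Omega$ of a hyperplane, with $\mathrm m(\sigma)>0$ and $\mathrm m(\overline\sigma\setminus\sigma)=0$), subsets $\mathcal E_K\subset\mathcal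 E$ with $\mathcal E=\bigcup_K\mathcal E_K$, and points $x_K\in\overline K$, such that: $\overline{\bigcup_K K}=\overline\Omega$; $\partial K=\bigcup_{\sigma\in\mathcal E_K}\overline\sigma$; for $K\ne L$, either $\mathrm m(\overline K\cap\overline L)=0$ or $\overline K\cap\overline L=\overline\sigma$ for some $\sigma\in\mathcal E$, written $\sigma=K|L$; every edge is either interior ($\sigma=K|L\subset\Omega$, and then $\sigma$ is an edge of exactly the cells $K$ and $L$) or exterior ($\sigma\subset\partial\Omega$, and then $\sigma$ is an edge of exactly one cell); if $\sigma=K|L$ then $x_K\neq x_L$ and $x_L-x_K$ is orthogonal to $\sigma$; if $\sigma\in\mathcal E_K$ is exterior, then $x_K\notin\overline\sigma$ and the orthogonal projection of $x_K$ on the hyperplane of $\sigma$ lies in $\overline\sigma$. We assume that every exterior edge is contained in $\Gamma^D$ or in $\Gamma^N$. Put $d_\sigma=|x_K-x_L|$ if $\sigma=K|L$, $d_\sigma=\mathrm d(x_K,\sigma)$ if $\sigma\in\mathcal E_K$ is exterior, and $\tau_\sigma=\mathrm m(\sigma)/d_\sigma$. The mesh is regular with parameter $\xi>0$ if, for all $K\in\mathcal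 T$ and $\sigma\in\mathcal E_K$, the distance from $x_K$ to the hyperplane containing $\sigma$ (which is $\mathrm d(x_K,\sigma)$ when $x_K$ projects orthogonally into $\overline\sigma$) is at least $\xi\, d_\sigma$. Let $f_K$, $b_K$ be the mean values of $f$, $b$ over $K$, let $U_{K,\sigma}$ be the mean value over $\sigma$ of $\mathbf U\cdot\mathbf n_{K,\sigma}$, where $\mathbf n_{K,\sigma}$ is the unit normal to $\sigma$ outward to $K$, and let $v^D_\sigma$ be the mean value of $v^D$ over $\sigma\subset\Gamma^D$. Let $B:\mathbb R\to\mathbb R$ be Lipschitz continuous with $B(0)=1$, $B(s)>0$ and $B(s)-B(-s)=-s$ for all $s$. The $B$-scheme is the linear system for $(v_K)_{K\in\mathcal T}$ $$\sum_{\sigma\in\mathcal E_K}\mathcal F_{K,\sigma}+\mathrm m(K)b_Kv_K=\mathrm m(K)f_K\qquad\forall K\in\mathcal T,$$ where $\mathcal F_{K,\sigma}=0$ if $\sigma\subset\Gamma^N$ and otherwise $\mathcal F_{K,\sigma}=\tau_\sigma\bigl(B(-U_{K,\sigma}d_\sigma)v_K-B(U_{K,\sigma}d_\sigma)v_{K,\sigma}\bigr)$,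 with $v_{K,\sigma}=v_L$ if $\sigma=K|L$ and $v_{K,\sigma}=v^D_\sigma$ if $\sigma\subset\Gamma^D$. Theorem. The scheme has exactly one solution $(v_K)_{K\in\mathcal T}$, and there are constants $\overline M,\underline M\ge 0$ such that $$-\underline M\le v_K\le\overline M\qquad\forall K\in\mathcal T,$$ where $\overline M$ depends only on $\Omega$ (with $p$ and the boundary decomposition $\Gamma^D,\Gamma^N$), $\xi$, $B$, $\|\mathbf U\|_{L^\infty}$, $\|f^+\|_{L^\infty}$ and $\|(v^D)^+\|_{L^\infty}$, and $\underline M$ depends only on $\Omega$ (in the same sense), $\xi$, $B$, $\|\mathbf U\|_{L^\infty}$, $\|f^-\|_{L^\infty}$ and $\|(v^D)^-\|_{L^\infty}$. -/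

import Mathlib

open MeasureTheory
open scoped NNReal ENNReal

noncomputable section

/-- The Euclidean space `ℝ^p`. -/
abbrev Euc (p : ℕ) : Type := EuclideanSpace ℝ (Fin p)

/-- The `(p-1)`-dimensional Hausdorff measure on `ℝ^p`, normalised so that it is the usual
length (`p = 2`) or surface area (`p = 3`). -/
def surf (p : ℕ) : Measure (Euc p) := μHE[p - 1]

/-- Bounded open polygonal (polyhedral) domains: connected interiors of finite unions of
polytopes. -/
def IsPolygonalDomain {p : ℕ} (Ω : Set (Euc p)) : Prop :=
  (∃ S : Finset (Finset (Euc p)),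
    Ω = interior (⋃ s ∈ S, convexHull ℝ (s : Set (Euc p)))) ∧ IsConnected Ω

/-- Open convex polygons (polyhedra). -/
def IsOpenPolytope {p : ℕ} (K : Set (Euc p)) : Prop :=
  (∃ s : Finset (Euc p), K = interior (convexHull ℝ (s : Set (Euc p)))) ∧ K.Nonempty

/-- Edges (faces): relatively open pieces of a hyperplane with positive `(p-1)`-dimensional
measure whose relative boundary is negligible. -/
def IsEdge {p : ℕ} (σ : Set (Euc p)) : Prop :=
  (∃ H : AffineSubspace ℝ (Euc p), Module.finrank ℝ H.direction + 1 = p ∧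
    ∃ O : Set (Euc p), IsOpen O ∧ σ = O ∩ (H : Set (Euc p))) ∧
  0 < surf p σ ∧ surf p (closure σ \ σ) = 0

/-- The vector `w` is orthogonal to the set `σ`. -/
def OrthTo {p : ℕ} (w : Euc p) (σ : Set (Euc p)) : Prop :=
  ∀ a ∈ σ, ∀ b ∈ σ, inner ℝ w (a - b) = 0

/-- Admissible finite volume meshes (for two-point flux approximations) of `Ω`. -/
structure AdmissibleMesh {p : ℕ} (Ω : Set (Euc p)) where
  /-- the control volumes -/
  cells : Finset (Set (Euc p))
  /-- the edges (faces) -/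
  edges : Finset (Set (Euc p))
  /-- the edges of a control volume -/
  cellEdges : Set (Euc p) → Finset (Set (Euc p))
  /-- the points `x_K` -/
  point : Set (Euc p) → Euc p
  cell_polytope : ∀ K ∈ cells, IsOpenPolytope K ∧ K ⊆ Ω
  edge_isEdge : ∀ σ ∈ edges, IsEdge σ ∧ σ ⊆ closure Ω
  edge_disjoint : ∀ σ ∈ edges, ∀ σ' ∈ edges, σ ≠ σ' → Disjoint σ σ'
  closure_cells : closure (⋃ K ∈ cells, K) = closure Ω
  mem_edges_iff : ∀ σ, σ ∈ edges ↔ ∃ K ∈ cells, σ ∈ cellEdges K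
  frontier_cell : ∀ K ∈ cells, frontier K = ⋃ σ ∈ cellEdges K, closure σ
  inter_cells : ∀ K ∈ cells, ∀ L ∈ cells, K ≠ L →
    surf p (closure K ∩ closure L) = 0 ∨ ∃ σ ∈ edges, closure K ∩ closure L = closure σ
  /-- Every edge is either interior, `σ = K|L`, or exterior. -/
  interior_or_exterior : ∀ σ ∈ edges,
    (σ ⊆ Ω ∧ ∃ K ∈ cells, ∃ L ∈ cells, K ≠ L ∧ closure K ∩ closure L = closure σ ∧
      ∀ J ∈ cells, σ ∈ cellEdges J ↔ J = K ∨ J = L) ∨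
    (σ ⊆ frontier Ω ∧ ∃ K ∈ cells, ∀ J ∈ cells, σ ∈ cellEdges J ↔ J = K)
  point_mem : ∀ K ∈ cells, point K ∈ closure K
  interior_orth : ∀ K ∈ cells, ∀ L ∈ cells, K ≠ L → ∀ σ ∈ edges,
    closure K ∩ closure L = closure σ →
      point K ≠ point L ∧ OrthTo (point L - point K) σ
  /-- The orthogonal projection of `x_K` on an exterior edge exists in that edge, and the
  distance from `x_K` to this edge does not vanish. -/
  exterior_orth : ∀ K ∈ cells, ∀ σ ∈ cellEdges K, σ ⊆ frontier Ω →
    point K ∉ closure σ ∧ ∃ y ∈ closure σ, OrthTo (y - point K) σ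

namespace AdmissibleMesh

variable {p : ℕ} {Ω : Set (Euc p)} (M : AdmissibleMesh Ω)

/-- Every exterior edge lies in the Dirichlet part or in the Neumann part of the boundary. -/
def SplitsBoundary (ΓD ΓN : Set (Euc p)) : Prop :=
  ∀ σ ∈ M.edges, σ ⊆ frontier Ω → σ ⊆ ΓD ∨ σ ⊆ ΓN

/-- The cell `L` on the other side of an interior edge `σ = K|L` of `K`. -/
def across (K σ : Set (Euc p)) : Set (Euc p) :=
  Classical.epsilon fun L => L ∈ M.cells ∧ L ≠ K ∧ closure K ∩ closure L = closure σ

open Classical in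
/-- The distance `d_σ`, for an edge `σ` of `K`; for an interior edge `σ = K|L` it takes the same
value seen from `K` and from `L`. -/
def edgeDist (K σ : Set (Euc p)) : ℝ :=
  if σ ⊆ frontier Ω then Metric.infDist (M.point K) σ
  else dist (M.point K) (M.point (M.across K σ))

/-- The transmissibility `τ_σ = m(σ) / d_σ`. -/
def transmissibility (K σ : Set (Euc p)) : ℝ :=
  (surf p).real σ / M.edgeDist K σ

/-- The regularity condition with parameter `ξ`. The distance from `x_K` to an edge is the distance
to the hyperplane spanned by it, that is, the height of the cone with apex `x_K` and base `σ`
(this is the distance to `σ` as soon as `x_K` projects orthogonally into the closure of `σ`). -/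
def IsRegular (ξ : ℝ) : Prop :=
  ∀ K ∈ M.cells, ∀ σ ∈ M.cellEdges K,
    ξ * M.edgeDist K σ ≤ Metric.infDist (M.point K) (affineSpan ℝ σ : Set (Euc p))

end AdmissibleMesh

/-- `n` is the unit normal to the edge `σ` of the convex cell `K`, outward to `K`: a unit vector
such that `K` lies in the half-space `⟪z - a, n⟫ ≤ 0` for every `a ∈ σ`. -/
def IsOutwardNormal {p : ℕ} (K σ : Set (Euc p)) (n : Euc p) : Prop :=
  ‖n‖ = 1 ∧ OrthTo n σ ∧ ∀ a ∈ σ, ∀ z ∈ K, inner ℝ (z - a) n ≤ 0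

/-- The outward unit normal `n_{K,σ}`. -/
def outwardNormal {p : ℕ} (K σ : Set (Euc p)) : Euc p :=
  Classical.epsilon (IsOutwardNormal K σ)

/-- `U_{K,σ}`, the mean value over `σ` of the outward normal component of `U`. -/
def meanNormalVelocity {p : ℕ} (U : Euc p → Euc p) (K σ : Set (Euc p)) : ℝ :=
  ⨍ x in σ, inner ℝ (U x) (outwardNormal K σ) ∂(surf p)

/-- The admissible functions `B`. -/
def IsBFunction (B : ℝ → ℝ) : Prop :=
  (∃ C : ℝ≥0, LipschitzWith C B) ∧ B 0 = 1 ∧ (∀ s, 0 < B s) ∧ ∀ s, B s - B (-s) = -s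

namespace AdmissibleMesh

variable {p : ℕ} {Ω : Set (Euc p)} (M : AdmissibleMesh Ω)

open Classical in
/-- `v_{K,σ}`: the mean of the boundary datum on a Dirichlet edge, and the value in the
neighbouring cell on an interior edge. -/
def outerValue (ΓD : Set (Euc p)) (vD : Euc p → ℝ) (v : Set (Euc p) → ℝ)
    (K σ : Set (Euc p)) : ℝ :=
  if σ ⊆ ΓD then ⨍ x in σ, vD x ∂(surf p) else v (M.across K σ)

open Classical in
/-- The numerical flux `F_{K,σ}`. -/
def flux (ΓD ΓN : Set (Euc p)) (B : ℝ → ℝ) (U : Euc p → Euc p) (vD : Euc p → ℝ)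
    (v : Set (Euc p) → ℝ) (K σ : Set (Euc p)) : ℝ :=
  if σ ⊆ ΓN then 0
  else M.transmissibility K σ *
    (B (-(meanNormalVelocity U K σ * M.edgeDist K σ)) * v K
      - B (meanNormalVelocity U K σ * M.edgeDist K σ) * M.outerValue ΓD vD v K σ)

/-- `v = (v_K)` solves the `B`-scheme. Only the values of `v` at the cells matter. -/
def IsSolution (ΓD ΓN : Set (Euc p)) (B : ℝ → ℝ) (U : Euc p → Euc p) (b f vD : Euc p → ℝ)
    (v : Set (Euc p) → ℝ) : Prop :=
  ∀ K ∈ M.cells,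
    ∑ σ ∈ M.cellEdges K, M.flux ΓD ΓN B U vD v K σ
      + volume.real K * (⨍ x in K, b x) * v K = volume.real K * ⨍ x in K, f x

end AdmissibleMesh

/-- The `L^∞` norm with respect to the measure `μ`. -/
def linftyNorm {α F : Type*} [MeasurableSpace α] [NormedAddCommGroup F] (μ : Measure α)
    (g : α → F) : ℝ :=
  (eLpNorm g ⊤ μ).toReal

end

/-!
Everything rests on one a priori estimate (`AdmissibleMesh.exists_upper_bound`): any solution
satisfies `v K ≤ Λ (1 + F + G)`, where `F` and `G` bound the positive parts of the data and `Λ`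
does not depend on the mesh. Applied to `v` and `-v` it gives both bounds of the theorem. Applied
to all multiples of a solution of the homogeneous problem it gives uniqueness, and existence
follows because the scheme is a square linear system.

The equation is not coercive, so the estimate combines a logarithmic estimate with a De Giorgi
iteration. Testing the scheme with `Φ ∘ v`, where `Φ` is nondecreasing and vanishes below a level
`k` above the boundary data, and writing `B (-s) - B s = s` to isolate the convection term, bounds
the discrete energy of `G ∘ v` for a companion function `G`; by Cauchy-Schwarz and mesh regularity
(the cones over the edges of a cell are disjoint, so `∑ m(σ) d_σ ≤ c m(K)`) the total variation of
`G ∘ v` is at most `c H m({v > k})` (`AdmissibleMesh.variation_le`). Truncations between `k` and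
`h` only see values of `v` up to `h`, whence `H = h`; with `Φ = 1 / k - 1 / v` and
`G = log (v / k)` one has `H = 1`.

The total variation is the integral of the perimeters of superlevel sets
(`AdmissibleMesh.mul_le_variation`), and perimeters are bounded from below by an isoperimetric
inequality relative to `Ω ∪ ΓD` for unions `X` of cells, uniform in the mesh
(`AdmissibleMesh.isoperimetric`): `m(X) ≤ C P(X)` and `m(X) ^ (p - 1) ≤ C P(X) ^ p`. The first one
and the logarithm make `m({v > M})` as small as needed for `M` a large multiple of `1 + F + G`; the
second one and truncations give superlinear decay of `m({v > h})` in `h`, so that `{v > 2 M}` is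
empty (`nonpos_of_superlinear_decay`).

The isoperimetric inequalities come from counting segments. A segment that joins a point of `X` to
a point outside `X`, or to `ΓD`, crosses a boundary edge of `X`, or meets the negligible relative
boundaries of the edges (`AdmissibleMesh.exists_boundaryEdge_of_segment`); and the points that a
given direction `w` joins to an edge `σ` have volume at most `‖w‖ m(σ)` (`volume_sweep_le`). Pairs
of points of a convex set give the relative isoperimetric inequality there, pairs at distance `r`
give the scale-invariant one for small families, segments starting on a Dirichlet edge control `X`
next to that edge, and chains of balls carry this control through the connected set `Ω`. As a
decomposition of `Ω` into convex sets, and to find a flat piece of `ΓD`, the cells and edges of one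
fixed reference mesh are used; if there is no admissible mesh at all, there is nothing to prove.
-/

/-! ### Slices, sweeps and cones over pieces of hyperplanes -/

/-- The `p`-dimensional volume is the integral of the areas of the slices by the hyperplanes
orthogonal to a unit vector `n`. -/
theorem volume_eq_lintegral_slices {p : ℕ} (a : Euc p) {n : Euc p} (hn : ‖n‖ = 1)
    {T : Set (Euc p)} (hT : MeasurableSet T) :
    volume T = ∫⁻ s : ℝ, surf p (T ∩ {z | inner ℝ (z - a) n = s}) := by
  have hn0 : n ≠ 0 := by
    intro h
    simp [h] at hn
  have key := EuclideanGeometry.euclideanHausdorffMeasure_eq_lintegral a hn0 hT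
  have hne : ‖n‖ₑ = 1 := by
    rw [← ofReal_norm, hn, ENNReal.ofReal_one]
  rw [hne, one_mul, InnerProductSpace.euclideanHausdorffMeasure_eq_volume] at key
  have hfin : Module.finrank ℝ (Euc p) = p := by simp
  rw [key]
  refine lintegral_congr fun s => ?_
  unfold surf
  rw [hfin]
  congr 2
  ext z
  have hnn : inner ℝ n n = (1 : ℝ) := by
    rw [real_inner_self_eq_norm_sq, hn]
    norm_num
  simp only [SetLike.mem_coe, AffineSubspace.mem_mk', Submodule.mem_orthogonal_singleton_iff_inner_right,
    vsub_eq_sub, vadd_eq_add, Set.mem_ofPred_eq]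
  rw [show z - (s • n + a) = (z - a) - s • n by abel, inner_sub_right, inner_smul_right, hnn,
    real_inner_comm, mul_one, sub_eq_zero]

theorem surf_image_add_right {p : ℕ} (S : Set (Euc p)) (w : Euc p) :
    surf p ((fun z => z + w) '' S) = surf p S :=
  (isometry_add_right w).euclideanHausdorffMeasure_image S

theorem surf_image_homothety {p : ℕ} (S : Set (Euc p)) (x : Euc p) {t : ℝ} (ht : 0 < t) :
    surf p ((fun y => x + t • (y - x)) '' S) = ENNReal.ofReal (t ^ (p - 1)) * surf p S := by
  have h := euclideanHausdorffMeasure_homothety_image (p - 1) x ht.ne' S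
  have h2 : (AffineMap.homothety x t : Euc p → Euc p) = fun y => x + t • (y - x) := by
    ext y : 1
    simp [AffineMap.homothety_apply, add_comm]
  rw [h2] at h
  unfold surf
  rw [h, ENNReal.smul_def, smul_eq_mul]
  congr 1
  rw [ENNReal.coe_pow, ENNReal.ofReal_pow ht.le]
  congr 1
  exact (Real.enorm_of_nonneg ht.le)

/-- The set swept out by `S` when it is translated along the vector `w`. -/
def sweep {p : ℕ} (S : Set (Euc p)) (w : Euc p) : Set (Euc p) :=
  {z | ∃ x ∈ S, ∃ t ∈ Set.Icc (0 : ℝ) 1, z = x + t • w}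

theorem volume_hyperplane {p : ℕ} (a : Euc p) {n : Euc p} (hn : ‖n‖ = 1) :
    volume {z : Euc p | inner ℝ (z - a) n = 0} = 0 := by
  have hT : MeasurableSet {z : Euc p | inner ℝ (z - a) n = 0} := by
    apply IsClosed.measurableSet
    exact isClosed_eq (by fun_prop) continuous_const
  rw [volume_eq_lintegral_slices a hn hT]
  have : (fun s : ℝ => surf p ({z : Euc p | inner ℝ (z - a) n = 0} ∩ {z | inner ℝ (z - a) n = s}))
      =ᵐ[volume] fun _ => 0 := by
    have h0 : ∀ᵐ s : ℝ, s ≠ 0 := by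
      simp [ae_iff]
    filter_upwards [h0] with s hs
    have : ({z : Euc p | inner ℝ (z - a) n = 0} ∩ {z | inner ℝ (z - a) n = s}) = ∅ := by
      ext z
      simp only [Set.mem_inter_iff, Set.mem_ofPred_eq, Set.mem_empty_iff_false, iff_false, not_and]
      intro h1 h2
      exact hs (h2.symm.trans h1)
    rw [this, measure_empty]
  rw [lintegral_congr_ae this]
  simp

/-- Translating a piece `S` of a hyperplane along `w` sweeps out at most `‖w‖` times its area. -/
theorem volume_sweep_le {p : ℕ} {S : Set (Euc p)} (hS : MeasurableSet S) {a n : Euc p}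
    (hn : ‖n‖ = 1) (hSH : ∀ z ∈ S, inner ℝ (z - a) n = 0) (w : Euc p) :
    volume (sweep S w) ≤ ENNReal.ofReal ‖w‖ * surf p S := by
  set w₀ : ℝ := inner ℝ w n with hw₀
  by_cases h0 : w₀ = 0
  · have hsub : sweep S w ⊆ {z : Euc p | inner ℝ (z - a) n = 0} := by
      rintro z ⟨x, hx, t, -, rfl⟩
      have := hSH x hx
      simp only [Set.mem_ofPred_eq]
      rw [show x + t • w - a = (x - a) + t • w by abel, inner_add_left, inner_smul_left, this,
        ← hw₀, h0]
      simp
    rw [measure_mono_null hsub (volume_hyperplane a hn)]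
    exact zero_le
  set τ : Euc p → ℝ := fun z => inner ℝ (z - a) n / w₀ with hτ
  have hτc : Continuous τ := by
    rw [hτ]
    fun_prop
  have hτS : ∀ x ∈ S, ∀ t : ℝ, τ (x + t • w) = t := by
    intro x hx t
    simp only [hτ]
    rw [show x + t • w - a = (x - a) + t • w by abel, inner_add_left, inner_smul_left, hSH x hx,
      ← hw₀]
    simp [h0]
  have hT : sweep S w = τ ⁻¹' (Set.Icc 0 1) ∩ (fun z => z - τ z • w) ⁻¹' S := by
    ext z
    constructor
    · rintro ⟨x, hx, t, ht, rfl⟩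
      refine ⟨?_, ?_⟩
      · rw [Set.mem_preimage, hτS x hx]
        exact ht
      · rw [Set.mem_preimage, hτS x hx]
        simpa using hx
    · rintro ⟨h1, h2⟩
      exact ⟨_, h2, τ z, h1, by simp⟩
  have hTm : MeasurableSet (sweep S w) := by
    rw [hT]
    refine (hτc.measurable measurableSet_Icc).inter ?_
    exact (show Continuous (fun z => z - τ z • w) by fun_prop).measurable hS
  rw [volume_eq_lintegral_slices a hn hTm]
  have hbound : ∀ s : ℝ, surf p (sweep S w ∩ {z | inner ℝ (z - a) n = s}) ≤
      (Set.uIcc 0 w₀).indicator (fun _ => surf p S) s := by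
    intro s
    by_cases hs : s ∈ Set.uIcc 0 w₀
    · rw [Set.indicator_of_mem hs, ← surf_image_add_right S ((s / w₀) • w)]
      refine measure_mono ?_
      rintro z ⟨⟨x, hx, t, ht, rfl⟩, hz⟩
      have h1 := hτS x hx t
      have hz' : inner ℝ (x + t • w - a) n = s := hz
      simp only [hτ, hz'] at h1
      exact ⟨x, hx, by simp [h1]⟩
    · rw [Set.indicator_of_notMem hs]
      have : sweep S w ∩ {z | inner ℝ (z - a) n = s} = ∅ := by
        rw [Set.eq_empty_iff_forall_notMem]
        rintro z ⟨⟨x, hx, t, ht, rfl⟩, hz⟩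
        have h1 := hτS x hx t
        have hz' : inner ℝ (x + t • w - a) n = s := hz
        simp only [hτ, hz'] at h1
        apply hs
        have hs' : s = t * w₀ := by
          rw [← h1]
          field_simp
        rw [hs', Set.mem_uIcc]
        rcases le_total 0 w₀ with h | h
        · left
          exact ⟨mul_nonneg ht.1 h, mul_le_of_le_one_left h ht.2⟩
        · right
          exact ⟨le_mul_of_le_one_left h ht.2, mul_nonpos_of_nonneg_of_nonpos ht.1 h⟩
      rw [this, measure_empty]
  calc ∫⁻ s : ℝ, surf p (sweep S w ∩ {z | inner ℝ (z - a) n = s})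
      ≤ ∫⁻ s : ℝ, (Set.uIcc 0 w₀).indicator (fun _ => surf p S) s := lintegral_mono hbound
    _ = surf p S * volume (Set.uIcc 0 w₀) := by
        rw [lintegral_indicator measurableSet_uIcc, setLIntegral_const]
    _ ≤ ENNReal.ofReal ‖w‖ * surf p S := by
        rw [mul_comm, Real.volume_interval, sub_zero]
        gcongr
        rw [hw₀]
        calc |inner ℝ w n| ≤ ‖w‖ * ‖n‖ := abs_real_inner_le_norm w n
          _ = ‖w‖ := by rw [hn, mul_one]

/-- The open cone with apex `x` and base `S`. -/
def coneOver {p : ℕ} (x : Euc p) (S : Set (Euc p)) : Set (Euc p) :=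
  {z | ∃ y ∈ S, ∃ t ∈ Set.Ioo (0 : ℝ) 1, z = x + t • (y - x)}

theorem measurableSet_coneOver {p : ℕ} {S : Set (Euc p)} (hS : MeasurableSet S) {a n x : Euc p}
    (hSH : ∀ z ∈ S, inner ℝ (z - a) n = 0) (hd : 0 < -inner ℝ (x - a) n) :
    MeasurableSet (coneOver x S) := by
  set d : ℝ := -inner ℝ (x - a) n with hd'
  set τ : Euc p → ℝ := fun z => 1 + inner ℝ (z - a) n / d with hτ
  have hτc : Continuous τ := by
    rw [hτ]
    fun_prop
  have hτS : ∀ y ∈ S, ∀ t : ℝ, τ (x + t • (y - x)) = t := by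
    intro y hy t
    have h1 : inner ℝ (x - a) n = -d := by rw [hd', neg_neg]
    simp only [hτ]
    rw [show x + t • (y - x) - a = (1 - t) • (x - a) + t • (y - a) by module, inner_add_left,
      inner_smul_left, inner_smul_left, hSH y hy, h1]
    simp
    field_simp
    ring
  have hT : coneOver x S = τ ⁻¹' (Set.Ioo 0 1) ∩ (fun z => x + (τ z)⁻¹ • (z - x)) ⁻¹' S := by
    ext z
    constructor
    · rintro ⟨y, hy, t, ht, rfl⟩
      refine ⟨?_, ?_⟩
      · rw [Set.mem_preimage, hτS y hy]
        exact ht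
      · rw [Set.mem_preimage, hτS y hy]
        simpa [smul_smul, inv_mul_cancel₀ ht.1.ne'] using hy
    · rintro ⟨h1, h2⟩
      refine ⟨_, h2, τ z, h1, ?_⟩
      simp [smul_smul, mul_inv_cancel₀ (ne_of_gt h1.1)]
  rw [hT]
  refine (hτc.measurable measurableSet_Ioo).inter ?_
  have hm : Measurable (fun z => x + (τ z)⁻¹ • (z - x)) :=
    measurable_const.add (hτc.measurable.inv.smul (measurable_id.sub_const x))
  exact hm hS

/-- The volume of a cone is bounded from below by height times area of the base, up to a constant
(the optimal constant `p` is not needed; only the half of the cone next to its base is used). -/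
theorem height_mul_surf_le_volume_coneOver {p : ℕ} {S : Set (Euc p)} (hS : MeasurableSet S)
    {a n x : Euc p} (hn : ‖n‖ = 1) (hSH : ∀ z ∈ S, inner ℝ (z - a) n = 0)
    (hd : 0 < -inner ℝ (x - a) n) :
    ENNReal.ofReal (-inner ℝ (x - a) n) * surf p S ≤ 2 ^ p * volume (coneOver x S) := by
  set d : ℝ := -inner ℝ (x - a) n with hd'
  have h1 : inner ℝ (x - a) n = -d := by rw [hd', neg_neg]
  have hbound : ∀ s : ℝ, (Set.Ioo (-(d / 2)) 0).indicator
      (fun _ => ENNReal.ofReal ((1 / 2) ^ (p - 1)) * surf p S) s ≤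
      surf p (coneOver x S ∩ {z | inner ℝ (z - a) n = s}) := by
    intro s
    by_cases hs : s ∈ Set.Ioo (-(d / 2)) 0
    · have ht1 : (1 : ℝ) / 2 ≤ 1 + s / d := by
        have : -(1 / 2) ≤ s / d := by
          rw [le_div_iff₀ hd]
          linarith [hs.1]
        linarith
      have ht2 : 1 + s / d < 1 := by
        have : s / d < 0 := div_neg_of_neg_of_pos hs.2 hd
        linarith
      rw [Set.indicator_of_mem hs]
      calc ENNReal.ofReal ((1 / 2) ^ (p - 1)) * surf p S
          ≤ ENNReal.ofReal ((1 + s / d) ^ (p - 1)) * surf p S := by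
            gcongr
        _ = surf p ((fun y => x + (1 + s / d) • (y - x)) '' S) :=
            (surf_image_homothety S x (by linarith)).symm
        _ ≤ _ := by
            refine measure_mono ?_
            rintro z ⟨y, hy, rfl⟩
            refine ⟨⟨y, hy, 1 + s / d, ⟨by linarith, ht2⟩, rfl⟩, ?_⟩
            simp only [Set.mem_ofPred_eq]
            rw [show x + (1 + s / d) • (y - x) - a = (-(s / d)) • (x - a) + (1 + s / d) • (y - a) by
              module, inner_add_left, inner_smul_left, inner_smul_left, hSH y hy, h1]
            simp
            field_simp
    · rw [Set.indicator_of_notMem hs]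
      exact zero_le
  have hvol : ENNReal.ofReal ((1 / 2) ^ (p - 1)) * surf p S * ENNReal.ofReal (d / 2) ≤
      volume (coneOver x S) := by
    rw [volume_eq_lintegral_slices a hn (measurableSet_coneOver hS hSH hd)]
    refine le_trans (le_of_eq ?_) (lintegral_mono hbound)
    rw [lintegral_indicator measurableSet_Ioo, setLIntegral_const, Real.volume_Ioo]
    congr 2
    ring
  have hp : (2 : ℝ≥0∞) ^ p = ENNReal.ofReal (2 ^ p) := by
    rw [ENNReal.ofReal_pow (by norm_num)]
    simp
  calc ENNReal.ofReal d * surf p S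
      ≤ ENNReal.ofReal (2 ^ p * ((1 / 2) ^ (p - 1) * (d / 2))) * surf p S := by
        gcongr
        have h2 : (1 : ℝ) ≤ 2 ^ p * ((1 / 2) ^ (p - 1) * (1 / 2)) := by
          rcases p with _ | q
          · exact absurd hd (by simp [hd', Subsingleton.elim n 0])
          · rw [Nat.add_sub_cancel, ← pow_succ, ← mul_pow]
            norm_num
        calc d = 1 * d := (one_mul d).symm
          _ ≤ 2 ^ p * ((1 / 2) ^ (p - 1) * (1 / 2)) * d := by gcongr
          _ = _ := by ring
    _ = 2 ^ p * (ENNReal.ofReal ((1 / 2) ^ (p - 1)) * surf p S * ENNReal.ofReal (d / 2)) := by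
        rw [ENNReal.ofReal_mul (by positivity), ENNReal.ofReal_mul (by positivity), hp]
        ring
    _ ≤ 2 ^ p * volume (coneOver x S) := by gcongr

theorem coneOver_subset_closedBall {p : ℕ} {S : Set (Euc p)} {x : Euc p} {r : ℝ}
    (hS : S ⊆ Metric.closedBall x r) : coneOver x S ⊆ Metric.closedBall x r := by
  rintro z ⟨y, hy, t, ht, rfl⟩
  have h := hS hy
  rw [mem_closedBall_iff_norm] at h ⊢
  rw [add_sub_cancel_left, norm_smul, Real.norm_of_nonneg ht.1.le]
  exact (mul_le_of_le_one_left (norm_nonneg _) ht.2.le).trans h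

theorem surf_lt_top_of_isBounded {p : ℕ} {S : Set (Euc p)} (hS : MeasurableSet S) {a n : Euc p}
    (hn : ‖n‖ = 1) (hSH : ∀ z ∈ S, inner ℝ (z - a) n = 0) (hb : Bornology.IsBounded S) :
    surf p S < ⊤ := by
  have hx : -inner ℝ ((a - n) - a) n = (1 : ℝ) := by
    rw [sub_sub_cancel_left, inner_neg_left, real_inner_self_eq_norm_sq, hn]
    norm_num
  obtain ⟨r, hr⟩ := hb.subset_closedBall (a - n)
  have h := height_mul_surf_le_volume_coneOver (x := a - n) hS hn hSH (by rw [hx]; norm_num)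
  rw [hx, ENNReal.ofReal_one, one_mul] at h
  refine lt_of_le_of_lt h (ENNReal.mul_lt_top (by simp) ?_)
  exact lt_of_le_of_lt (measure_mono (coneOver_subset_closedBall hr)) measure_closedBall_lt_top

/-! ### Flat pieces in the frontier of a convex set -/

/-- `σ` is a relatively open piece of a hyperplane with unit normal `n`. -/
def IsFlatPiece {p : ℕ} (σ : Set (Euc p)) (n : Euc p) : Prop :=
  ‖n‖ = 1 ∧ ∃ O : Set (Euc p), IsOpen O ∧ ∀ a ∈ σ, ∀ z, z ∈ σ ↔ z ∈ O ∧ inner ℝ (z - a) n = 0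

theorem IsEdge.nonempty {p : ℕ} {σ : Set (Euc p)} (h : IsEdge σ) : σ.Nonempty :=
  nonempty_of_measure_ne_zero h.2.1.ne'

theorem IsEdge.exists_isFlatPiece {p : ℕ} {σ : Set (Euc p)} (h : IsEdge σ) :
    ∃ n, IsFlatPiece σ n := by
  obtain ⟨⟨H, hH, O, hO, rfl⟩, -⟩ := h
  have hsum := H.direction.finrank_add_finrank_orthogonal
  have hfin : Module.finrank ℝ (Euc p) = p := by simp
  have h1 : Module.finrank ℝ H.directionᗮ = 1 := by omega
  have hne : H.directionᗮ ≠ ⊥ := by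
    intro hbot
    rw [hbot, finrank_bot] at h1
    exact zero_ne_one h1
  obtain ⟨v, hv, hv0⟩ := Submodule.exists_mem_ne_zero_of_ne_bot hne
  have hspan : (ℝ ∙ v) = H.directionᗮ := by
    refine Submodule.eq_of_le_of_finrank_le ((Submodule.span_singleton_le_iff_mem _ _).2 hv) ?_
    rw [h1, finrank_span_singleton hv0]
  have hdir : H.direction = (ℝ ∙ v)ᗮ := by
    rw [hspan, Submodule.orthogonal_orthogonal]
  have hvn : ‖v‖ ≠ 0 := norm_ne_zero_iff.2 hv0
  refine ⟨(‖v‖⁻¹ : ℝ) • v, ?_, O, hO, ?_⟩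
  · rw [norm_smul, norm_inv, norm_norm, inv_mul_cancel₀ hvn]
  · intro a ha z
    rw [Set.mem_inter_iff, SetLike.mem_coe,
      ← AffineSubspace.vsub_right_mem_direction_iff_mem ha.2 z, hdir,
      Submodule.mem_orthogonal_singleton_iff_inner_left, vsub_eq_sub, inner_smul_right]
    simp [hvn]

theorem tendsto_add_smul_nhdsGT {p : ℕ} (a v : Euc p) :
    Filter.Tendsto (fun ε : ℝ => a + ε • v) (nhdsWithin 0 (Set.Ioi 0)) (nhds a) := by
  have h0 := (show Continuous (fun ε : ℝ => a + ε • v) by fun_prop).tendsto 0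
  simp only [zero_smul, add_zero] at h0
  exact h0.mono_left nhdsWithin_le_nhds

namespace IsFlatPiece

variable {p : ℕ} {σ K L : Set (Euc p)} {n m a : Euc p}

theorem neg (h : IsFlatPiece σ n) : IsFlatPiece σ (-n) := by
  obtain ⟨h1, O, hO, h2⟩ := h
  exact ⟨by rwa [norm_neg], O, hO, fun a ha z => by simpa [inner_neg_right] using h2 a ha z⟩

theorem inner_eq_zero (h : IsFlatPiece σ n) (ha : a ∈ σ) {z : Euc p} (hz : z ∈ σ) :
    inner ℝ (z - a) n = 0 := by
  obtain ⟨-, O, -, h2⟩ := h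
  exact ((h2 a ha z).1 hz).2

theorem orthTo (h : IsFlatPiece σ n) : OrthTo n σ := fun a ha b hb => by
  rw [real_inner_comm]
  exact h.inner_eq_zero hb ha

theorem inner_eq_zero_of_mem_closure (h : IsFlatPiece σ n) (ha : a ∈ σ) {z : Euc p}
    (hz : z ∈ closure σ) : inner ℝ (z - a) n = 0 := by
  have hc : IsClosed {z : Euc p | inner ℝ (z - a) n = 0} :=
    isClosed_eq (by fun_prop) continuous_const
  exact closure_minimal (fun z hz => h.inner_eq_zero ha hz) hc hz

theorem measurableSet (h : IsFlatPiece σ n) : MeasurableSet σ := by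
  rcases σ.eq_empty_or_nonempty with rfl | ⟨a, ha⟩
  · exact MeasurableSet.empty
  obtain ⟨-, O, hO, h2⟩ := h
  have : σ = O ∩ {z | inner ℝ (z - a) n = 0} := by
    ext z
    exact h2 a ha z
  rw [this]
  exact hO.measurableSet.inter (isClosed_eq (by fun_prop) continuous_const).measurableSet

/-- Points of the hyperplane near a point of a flat piece belong to the piece. -/
theorem eventually_mem (h : IsFlatPiece σ n) (ha : a ∈ σ) :
    ∀ᶠ z in nhds a, inner ℝ (z - a) n = 0 → z ∈ σ := by
  obtain ⟨-, O, hO, h2⟩ := h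
  filter_upwards [hO.mem_nhds ((h2 a ha a).1 ha).1] with z hz hz'
  exact (h2 a ha z).2 ⟨hz, hz'⟩

theorem eventually_add_smul_mem (h : IsFlatPiece σ n) (ha : a ∈ σ) {v : Euc p}
    (hv : inner ℝ v n = 0) : ∃ ε : ℝ, 0 < ε ∧ a + ε • v ∈ σ := by
  have hlim := tendsto_add_smul_nhdsGT a v
  have hev := (hlim.eventually (h.eventually_mem ha)).and self_mem_nhdsWithin
  obtain ⟨ε, h1, h2⟩ := hev.exists
  refine ⟨ε, h2, h1 ?_⟩
  rw [add_sub_cancel_left, inner_smul_left, hv, mul_zero]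

/-- A vector orthogonal to a flat piece is a multiple of its normal. -/
theorem eq_smul_of_orthTo (h : IsFlatPiece σ n) (ha : a ∈ σ) (hm : OrthTo m σ) :
    m = (inner ℝ m n : ℝ) • n := by
  set v : Euc p := m - (inner ℝ m n : ℝ) • n with hv
  have hnn : inner ℝ n n = (1 : ℝ) := by
    rw [real_inner_self_eq_norm_sq, h.1]
    norm_num
  have hvn : inner ℝ v n = 0 := by
    rw [hv, inner_sub_left, inner_smul_left, hnn]
    simp
  obtain ⟨ε, hε, hmem⟩ := h.eventually_add_smul_mem ha hvn
  have h1 := hm _ hmem a ha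
  rw [add_sub_cancel_left, inner_smul_right] at h1
  have h2 : inner ℝ m v = 0 := by
    rcases mul_eq_zero.1 h1 with h | h
    · exact absurd h hε.ne'
    · exact h
  have h3 : inner ℝ v v = (0 : ℝ) := by
    conv_lhs => rw [hv, inner_sub_left]
    rw [← hv, h2, inner_smul_left, real_inner_comm v n, hvn]
    simp
  exact sub_eq_zero.1 (inner_self_eq_zero.1 h3)

theorem infDist_affineSpan_le (h : IsFlatPiece σ n) (ha : a ∈ σ) (x : Euc p) :
    Metric.infDist x (affineSpan ℝ σ : Set (Euc p)) ≤ |inner ℝ (x - a) n| := by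
  set c : ℝ := inner ℝ (x - a) n with hc
  set v : Euc p := x - a - c • n with hv
  have hnn : inner ℝ n n = (1 : ℝ) := by
    rw [real_inner_self_eq_norm_sq, h.1]
    norm_num
  have hvn : inner ℝ v n = 0 := by
    rw [hv, inner_sub_left, inner_smul_left, hnn]
    simp [hc]
  obtain ⟨ε, hε, hmem⟩ := h.eventually_add_smul_mem ha hvn
  have hmem' : a + v ∈ (affineSpan ℝ σ : Set (Euc p)) := by
    have := AffineMap.lineMap_mem ε⁻¹ (subset_affineSpan ℝ σ ha) (subset_affineSpan ℝ σ hmem)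
    rw [AffineMap.lineMap_apply] at this
    simpa [smul_smul, inv_mul_cancel₀ hε.ne', add_comm] using this
  refine (Metric.infDist_le_dist_of_mem hmem').trans (le_of_eq ?_)
  rw [dist_eq_norm, show x - (a + v) = c • n by rw [hv]; abel, norm_smul, h.1, mul_one,
    Real.norm_eq_abs]

/-- An open convex set whose closure contains a flat piece contains a one-sided neighbourhood of
each point of this piece. -/
theorem eventually_mem_convex (h : IsFlatPiece σ n) (ha : a ∈ σ) (hK : Convex ℝ K)
    (hKo : IsOpen K) (hσK : σ ⊆ closure K) {z₀ : Euc p} (hz₀ : z₀ ∈ K)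
    (hneg : inner ℝ (z₀ - a) n < 0) :
    ∀ᶠ y in nhds a, inner ℝ (y - a) n < 0 → y ∈ K := by
  set d : ℝ := -inner ℝ (z₀ - a) n with hd
  have hd0 : 0 < d := by rw [hd]; linarith
  -- `b y` is the intersection of the hyperplane with the ray from `z₀` through `y`.
  set s : Euc p → ℝ := fun y => (inner ℝ (y - a) n + d) / d with hs
  set b : Euc p → Euc p := fun y => z₀ + (s y)⁻¹ • (y - z₀) with hb
  have hsc : Continuous s := by
    rw [hs]
    fun_prop
  have hsa : s a = 1 := by
    simp [hs, hd0.ne']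
  have hba : b a = a := by
    simp [hb, hsa]
  have hbc : ContinuousAt b a := by
    have : ContinuousAt (fun y => (s y)⁻¹) a := hsc.continuousAt.inv₀ (by rw [hsa]; norm_num)
    exact continuousAt_const.add (this.smul (by fun_prop))
  have h1 : ∀ᶠ y in nhds a, inner ℝ (b y - a) n = 0 → b y ∈ σ := by
    have := h.eventually_mem ha
    rw [← hba] at this
    have h2 := hbc.eventually this
    simpa [hba] using h2
  have h2 : ∀ᶠ y in nhds a, 0 < s y :=
    hsc.continuousAt.eventually (lt_mem_nhds (by rw [hsa]; norm_num))
  filter_upwards [h1, h2] with y hy1 hy2 hy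
  have hs1 : s y < 1 := by
    simp only [hs]
    rw [div_lt_one hd0]
    linarith
  have hinner : inner ℝ (b y - a) n = 0 := by
    have e1 : inner ℝ (y - a) n = s y * d - d := by
      simp only [hs]
      field_simp
      ring
    have e0 : inner ℝ (z₀ - a) n = -d := by rw [hd, neg_neg]
    simp only [hb]
    rw [show z₀ + (s y)⁻¹ • (y - z₀) - a = (1 - (s y)⁻¹) • (z₀ - a) + (s y)⁻¹ • (y - a) by module,
      inner_add_left, inner_smul_left, inner_smul_left, e0, e1]
    simp
    field_simp
    ring
  have hbK : b y ∈ closure K := hσK (hy1 hinner)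
  have hseg := hK.openSegment_interior_closure_subset_interior
    (by rwa [hKo.interior_eq]) hbK
  rw [hKo.interior_eq] at hseg
  apply hseg
  refine ⟨1 - s y, s y, by linarith, hy2, by ring, ?_⟩
  simp only [hb]
  rw [smul_add, smul_smul, mul_inv_cancel₀ hy2.ne']
  module

/-- An open convex set with a flat piece in its frontier lies strictly on one side of it. -/
theorem inner_neg_of_mem (h : IsFlatPiece σ n) (ha : a ∈ σ) (hK : Convex ℝ K)
    (hKo : IsOpen K) (hσK : σ ⊆ frontier K) {z₀ : Euc p} (hz₀ : z₀ ∈ K)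
    (hneg : inner ℝ (z₀ - a) n < 0) {z : Euc p} (hz : z ∈ K) : inner ℝ (z - a) n < 0 := by
  have haK : a ∉ K := by
    have := hσK ha
    rw [hKo.frontier_eq] at this
    exact this.2
  -- A point of `K` strictly on the other side would put `a` between two points of `K`.
  have key : ∀ z₁ ∈ K, ¬ 0 < inner ℝ (z₁ - a) n := by
    intro z₁ hz₁ hpos
    have hlim := tendsto_add_smul_nhdsGT a (-(z₁ - a))
    have hev := (hlim.eventually (h.eventually_mem_convex ha hK hKo
      (hσK.trans frontier_subset_closure) hz₀ hneg)).and self_mem_nhdsWithin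
    obtain ⟨ε, h1, h2⟩ := hev.exists
    have hε : 0 < ε := h2
    rw [smul_neg, ← sub_eq_add_neg] at h1
    have hy : a - ε • (z₁ - a) ∈ K := by
      apply h1
      rw [sub_sub_cancel_left, inner_neg_left, inner_smul_left]
      simpa using mul_pos hε hpos
    apply haK
    have := hK hy hz₁ (a := 1 / (1 + ε)) (b := ε / (1 + ε)) (by positivity) (by positivity)
      (by field_simp)
    have e : (1 / (1 + ε)) • (a - ε • (z₁ - a)) + (ε / (1 + ε)) • z₁ = a := by
      have h3 : (1 : ℝ) = 1 / (1 + ε) + ε / (1 + ε) := by field_simp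
      calc (1 / (1 + ε)) • (a - ε • (z₁ - a)) + (ε / (1 + ε)) • z₁
          = (1 / (1 + ε) + ε / (1 + ε)) • a := by
            rw [div_eq_mul_inv ε, mul_comm ε]
            module
        _ = a := by rw [← h3, one_smul]
    rwa [e] at this
  by_contra hcon
  push Not at hcon
  have hlim := tendsto_add_smul_nhdsGT z n
  obtain ⟨ε, h1, h2⟩ := ((hlim.eventually (hKo.mem_nhds hz)).and self_mem_nhdsWithin).exists
  have hε : 0 < ε := h2
  refine key _ h1 ?_
  rw [show z + ε • n - a = (z - a) + ε • n by abel, inner_add_left, inner_smul_left,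
    real_inner_self_eq_norm_sq, h.1]
  simp
  linarith

/-- One of the two unit normals of a flat piece of the frontier points strictly outwards. -/
theorem exists_strict_normal (h : IsFlatPiece σ n) (hne : σ.Nonempty) (hK : Convex ℝ K)
    (hKo : IsOpen K) (hKne : K.Nonempty) (hσK : σ ⊆ frontier K) :
    ∃ m, IsFlatPiece σ m ∧ ∀ a ∈ σ, ∀ z ∈ K, inner ℝ (z - a) m < 0 := by
  obtain ⟨a, ha⟩ := hne
  have hmain : ∀ m, IsFlatPiece σ m → (∃ z ∈ K, inner ℝ (z - a) m < 0) →
      ∀ b ∈ σ, ∀ z ∈ K, inner ℝ (z - b) m < 0 := by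
    rintro m hm ⟨z₀, hz₀, hneg⟩ b hb z hz
    have h1 := hm.inner_neg_of_mem ha hK hKo hσK hz₀ hneg hz
    have h2 := hm.inner_eq_zero hb ha
    rw [show z - b = (z - a) + (a - b) by abel, inner_add_left, h2, add_zero]
    exact h1
  obtain ⟨z, hz⟩ := hKne
  have hlim := tendsto_add_smul_nhdsGT z n
  obtain ⟨ε, h1, h2⟩ := ((hlim.eventually (hKo.mem_nhds hz)).and self_mem_nhdsWithin).exists
  have hε : 0 < ε := h2
  rcases lt_or_ge (inner ℝ (z - a) n) 0 with hlt | hge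
  · exact ⟨n, h, hmain n h ⟨z, hz, hlt⟩⟩
  · refine ⟨-n, h.neg, hmain _ h.neg ⟨_, h1, ?_⟩⟩
    rw [show z + ε • n - a = (z - a) + ε • n by abel, inner_neg_right, inner_add_left,
      inner_smul_left, real_inner_self_eq_norm_sq, h.1]
    simp
    linarith

theorem outwardNormal_eq (h : IsFlatPiece σ n) (hne : σ.Nonempty) (hKne : K.Nonempty)
    (hneg : ∀ a ∈ σ, ∀ z ∈ K, inner ℝ (z - a) n < 0) : outwardNormal K σ = n := by
  have hex : IsOutwardNormal K σ n := ⟨h.1, h.orthTo, fun a ha z hz => (hneg a ha z hz).le⟩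
  obtain ⟨h1, h2, h3⟩ : IsOutwardNormal K σ (outwardNormal K σ) := Classical.epsilon_spec ⟨n, hex⟩
  obtain ⟨a, ha⟩ := hne
  obtain ⟨z, hz⟩ := hKne
  have h4 := h.eq_smul_of_orthTo ha h2
  set c : ℝ := inner ℝ (outwardNormal K σ) n with hc
  have h5 := h3 a ha z hz
  have h6 := hneg a ha z hz
  rw [h4, inner_smul_right] at h5
  have hc0 : 0 ≤ c := by
    by_contra hcon
    push Not at hcon
    nlinarith
  have h7 : ‖outwardNormal K σ‖ = |c| := by
    conv_lhs => rw [h4]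
    rw [norm_smul, h.1, mul_one, Real.norm_eq_abs]
  rw [h1, abs_of_nonneg hc0] at h7
  rw [h4, ← h7, one_smul]

/-- Two disjoint open convex sets with a common flat piece in their closures lie on different
sides of this piece. -/
theorem inner_pos_of_disjoint (h : IsFlatPiece σ n) (hK : Convex ℝ K)
    (hKo : IsOpen K) (hKne : K.Nonempty)
    (hneg : ∀ a ∈ σ, ∀ z ∈ K, inner ℝ (z - a) n < 0) (hσK : σ ⊆ closure K)
    (hL : Convex ℝ L) (hLo : IsOpen L) (hσL : σ ⊆ closure L) (hKL : Disjoint K L)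
    {b : Euc p} (hb : b ∈ σ) {z : Euc p} (hz : z ∈ L) : 0 ≤ inner ℝ (z - b) n := by
  obtain ⟨z₀, hz₀⟩ := hKne
  by_contra hcon
  push Not at hcon
  have hev := h.eventually_mem_convex hb hK hKo hσK hz₀ (hneg b hb z₀ hz₀)
  have hlim := tendsto_add_smul_nhdsGT b (z - b)
  have hlt : ∀ᶠ ε : ℝ in nhdsWithin 0 (Set.Ioi 0), ε < 1 :=
    nhdsWithin_le_nhds (gt_mem_nhds one_pos)
  obtain ⟨ε, ⟨h1, h2⟩, h3⟩ := (((hlim.eventually hev).and self_mem_nhdsWithin).and hlt).exists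
  have hε : 0 < ε := h2
  have hyK : b + ε • (z - b) ∈ K := by
    apply h1
    rw [add_sub_cancel_left, inner_smul_left]
    simpa using mul_neg_of_pos_of_neg hε hcon
  have hseg := hL.openSegment_interior_closure_subset_interior
    (by rwa [hLo.interior_eq]) (hσL hb)
  rw [hLo.interior_eq] at hseg
  have hyL : b + ε • (z - b) ∈ L := by
    apply hseg
    exact ⟨ε, 1 - ε, hε, by linarith, by ring, by module⟩
  exact Set.disjoint_left.1 hKL hyK hyL

end IsFlatPiece

/-! ### Cells and edges -/

theorem IsPolygonalDomain.isOpen {p : ℕ} {Ω : Set (Euc p)} (h : IsPolygonalDomain Ω) :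
    IsOpen Ω := by
  obtain ⟨⟨S, rfl⟩, -⟩ := h
  exact isOpen_interior

theorem IsPolygonalDomain.isBounded {p : ℕ} {Ω : Set (Euc p)} (h : IsPolygonalDomain Ω) :
    Bornology.IsBounded Ω := by
  obtain ⟨⟨S, rfl⟩, -⟩ := h
  refine Bornology.IsBounded.subset ?_ interior_subset
  rw [Bornology.isBounded_biUnion_finset]
  exact fun s _ => isBounded_convexHull.2 s.finite_toSet.isBounded

/-- Two disjoint open convex sets with a common flat piece in their frontiers have opposite
strict outward normals on it. -/
theorem IsFlatPiece.normal_eq_neg {p : ℕ} {σ K L : Set (Euc p)} {n m : Euc p}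
    (hn : IsFlatPiece σ n) (hm : IsFlatPiece σ m) (hne : σ.Nonempty)
    (hK : Convex ℝ K) (hKo : IsOpen K) (hKne : K.Nonempty) (hσK : σ ⊆ closure K)
    (hL : Convex ℝ L) (hLo : IsOpen L) (hLne : L.Nonempty) (hσL : σ ⊆ closure L)
    (hKL : Disjoint K L) (hnK : ∀ a ∈ σ, ∀ z ∈ K, inner ℝ (z - a) n < 0)
    (hmL : ∀ a ∈ σ, ∀ z ∈ L, inner ℝ (z - a) m < 0) : m = -n := by
  obtain ⟨a, ha⟩ := hne
  obtain ⟨z, hz⟩ := hLne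
  have h1 := hn.inner_pos_of_disjoint hK hKo hKne hnK hσK hL hLo hσL hKL ha hz
  have h2 := hmL a ha z hz
  have h3 := hn.eq_smul_of_orthTo ha hm.orthTo
  set c : ℝ := inner ℝ m n with hc
  have h4 : |c| = 1 := by
    have := hm.1
    rw [h3, norm_smul, hn.1, mul_one, Real.norm_eq_abs] at this
    exact this
  rw [h3, inner_smul_right] at h2
  have hc0 : c < 0 := by
    by_contra hcon
    push Not at hcon
    nlinarith
  rw [abs_of_neg hc0] at h4
  rw [h3, show c = -1 by linarith, neg_one_smul]

namespace AdmissibleMesh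

variable {p : ℕ} {Ω : Set (Euc p)} {M : AdmissibleMesh Ω} {K L σ : Set (Euc p)}

theorem cell_convex (hK : K ∈ M.cells) : Convex ℝ K := by
  obtain ⟨⟨⟨s, rfl⟩, -⟩, -⟩ := M.cell_polytope K hK
  exact (convex_convexHull ℝ _).interior

theorem cell_isOpen (hK : K ∈ M.cells) : IsOpen K := by
  obtain ⟨⟨⟨s, rfl⟩, -⟩, -⟩ := M.cell_polytope K hK
  exact isOpen_interior

theorem cell_isBounded (hK : K ∈ M.cells) : Bornology.IsBounded K := by
  obtain ⟨⟨⟨s, rfl⟩, -⟩, -⟩ := M.cell_polytope K hK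
  exact (isBounded_convexHull.2 s.finite_toSet.isBounded).subset interior_subset

theorem cell_nonempty (hK : K ∈ M.cells) : K.Nonempty := (M.cell_polytope K hK).1.2

theorem cell_subset (hK : K ∈ M.cells) : K ⊆ Ω := (M.cell_polytope K hK).2

theorem volume_cell_lt_top (hK : K ∈ M.cells) : volume K < ⊤ :=
  (cell_isBounded hK).measure_lt_top

theorem volume_cell_pos (hK : K ∈ M.cells) : 0 < volume.real K :=
  ENNReal.toReal_pos ((cell_isOpen hK).measure_pos volume (cell_nonempty hK)).ne'
    (volume_cell_lt_top hK).ne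

theorem mem_edges (hK : K ∈ M.cells) (hσ : σ ∈ M.cellEdges K) : σ ∈ M.edges :=
  (M.mem_edges_iff σ).2 ⟨K, hK, hσ⟩

theorem edge_nonempty (hσ : σ ∈ M.edges) : σ.Nonempty := (M.edge_isEdge σ hσ).1.nonempty

theorem edge_subset_frontier (hK : K ∈ M.cells) (hσ : σ ∈ M.cellEdges K) : σ ⊆ frontier K := by
  rw [M.frontier_cell K hK]
  exact subset_closure.trans (Set.subset_biUnion_of_mem (u := fun σ => closure σ) hσ)

theorem surf_edge_lt_top (hK : K ∈ M.cells) (hσ : σ ∈ M.cellEdges K) : surf p σ < ⊤ := by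
  have hE := mem_edges hK hσ
  obtain ⟨n, hn⟩ := (M.edge_isEdge σ hE).1.exists_isFlatPiece
  obtain ⟨a, ha⟩ := edge_nonempty hE
  exact surf_lt_top_of_isBounded hn.measurableSet hn.1 (fun z hz => hn.inner_eq_zero ha hz)
    ((cell_isBounded hK).closure.subset ((edge_subset_frontier hK hσ).trans
      frontier_subset_closure))

theorem surf_edge_pos (hK : K ∈ M.cells) (hσ : σ ∈ M.cellEdges K) : 0 < (surf p).real σ :=
  ENNReal.toReal_pos (M.edge_isEdge σ (mem_edges hK hσ)).1.2.1.ne' (surf_edge_lt_top hK hσ).ne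

theorem exists_edge_normal (hK : K ∈ M.cells) (hσ : σ ∈ M.cellEdges K) :
    ∃ n, IsFlatPiece σ n ∧ ∀ a ∈ σ, ∀ z ∈ K, inner ℝ (z - a) n < 0 := by
  have hE := mem_edges hK hσ
  obtain ⟨n, hn⟩ := (M.edge_isEdge σ hE).1.exists_isFlatPiece
  exact hn.exists_strict_normal (edge_nonempty hE) (cell_convex hK) (cell_isOpen hK)
    (cell_nonempty hK) (edge_subset_frontier hK hσ)

theorem cells_disjoint (hK : K ∈ M.cells) (hL : L ∈ M.cells) (hKL : K ≠ L) : Disjoint K L := by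
  by_contra hcon
  rw [Set.not_disjoint_iff_nonempty_inter] at hcon
  have hpos : 0 < volume (K ∩ L) :=
    ((cell_isOpen hK).inter (cell_isOpen hL)).measure_pos volume hcon
  refine hpos.ne' ?_
  have hsub : K ∩ L ⊆ closure K ∩ closure L := Set.inter_subset_inter subset_closure subset_closure
  rcases M.inter_cells K hK L hL hKL with h | ⟨σ, hσ, h⟩
  · rcases Nat.eq_zero_or_pos p with rfl | hp
    · obtain ⟨z, hzK, hzL⟩ := hcon
      refine absurd (Set.ext fun y => ?_) hKL
      rw [Subsingleton.elim y z]
      exact ⟨fun _ => hzL, fun _ => hzK⟩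
    · have hfin : Module.finrank ℝ (Euc p) = p := by simp
      rw [← InnerProductSpace.euclideanHausdorffMeasure_eq_volume, hfin]
      refine (Measure.euclideanHausdorffMeasure_zero_or_top (Nat.sub_one_lt_of_lt hp)
        (K ∩ L)).resolve_right ?_
      rw [show (μHE[p - 1] : Measure (Euc p)) (K ∩ L) = 0 from measure_mono_null hsub h]
      exact ENNReal.zero_ne_top
  · obtain ⟨n, hn⟩ := (M.edge_isEdge σ hσ).1.exists_isFlatPiece
    obtain ⟨a, ha⟩ := edge_nonempty hσ
    refine measure_mono_null ?_ (volume_hyperplane a hn.1)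
    intro z hz
    exact hn.inner_eq_zero_of_mem_closure ha (h ▸ hsub hz)

theorem disjoint_closure_cell (hK : K ∈ M.cells) (hL : L ∈ M.cells) (hKL : K ≠ L) :
    Disjoint (closure K) L :=
  (cells_disjoint hK hL hKL).closure_left (cell_isOpen hL)

theorem closure_eq_iUnion_closure_cells : closure Ω = ⋃ K ∈ M.cells, closure K := by
  rw [← M.closure_cells, Finset.closure_biUnion]

theorem not_subset_frontier_of_mem (hΩ : IsOpen Ω) {y : Euc p} (hy : y ∈ Ω) (hyσ : y ∈ σ) :
    ¬ σ ⊆ frontier Ω := fun h => by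
  have := h hyσ
  rw [hΩ.frontier_eq] at this
  exact this.2 hy

/-- The neighbour across an interior edge is well defined, and the relation is symmetric. -/
theorem across_spec (hK : K ∈ M.cells) (hσ : σ ∈ M.cellEdges K) (hint : ¬ σ ⊆ frontier Ω) :
    M.across K σ ∈ M.cells ∧ M.across K σ ≠ K ∧ σ ∈ M.cellEdges (M.across K σ) ∧
      closure K ∩ closure (M.across K σ) = closure σ ∧ M.across (M.across K σ) σ = K ∧
      ∀ J ∈ M.cells, σ ∈ M.cellEdges J → J = K ∨ J = M.across K σ := by
  have hE := mem_edges hK hσ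
  rcases M.interior_or_exterior σ hE with ⟨hσΩ, K₁, hK₁, L₁, hL₁, hne, hcl, hiff⟩ | ⟨h, -⟩
  swap
  · exact absurd h hint
  have huniq : ∀ K L J : Set (Euc p), K ∈ M.cells → L ∈ M.cells → J ∈ M.cells →
      σ ∈ M.cellEdges K → σ ∈ M.cellEdges L → K ≠ L → J ≠ K →
      closure K ∩ closure J = closure σ → J = L := by
    intro K L J hK hL hJ hσK hσL hKL hJK hclJ
    by_contra hJL
    obtain ⟨n, hn, hnK⟩ := exists_edge_normal hK hσK
    obtain ⟨m, hm, hmL⟩ := exists_edge_normal hL hσL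
    have hσJc : σ ⊆ closure J := fun y hy => (hclJ ▸ subset_closure hy : y ∈ closure K ∩ closure J).2
    have hσJ : σ ⊆ frontier J := by
      intro y hy
      rw [(cell_isOpen hJ).frontier_eq]
      refine ⟨hσJc hy, fun hyJ => ?_⟩
      exact Set.disjoint_left.1 (disjoint_closure_cell hK hJ (Ne.symm hJK))
        (frontier_subset_closure (edge_subset_frontier hK hσK hy)) hyJ
    obtain ⟨q, hq, hqJ⟩ := hn.exists_strict_normal (edge_nonempty hE) (cell_convex hJ)
      (cell_isOpen hJ) (cell_nonempty hJ) hσJ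
    have hσKc : σ ⊆ closure K := (edge_subset_frontier hK hσK).trans frontier_subset_closure
    have hσLc : σ ⊆ closure L := (edge_subset_frontier hL hσL).trans frontier_subset_closure
    have h1 := hn.normal_eq_neg hm (edge_nonempty hE) (cell_convex hK) (cell_isOpen hK)
      (cell_nonempty hK) hσKc (cell_convex hL) (cell_isOpen hL) (cell_nonempty hL) hσLc
      (cells_disjoint hK hL hKL) hnK hmL
    have h2 := hn.normal_eq_neg hq (edge_nonempty hE) (cell_convex hK) (cell_isOpen hK)
      (cell_nonempty hK) hσKc (cell_convex hJ) (cell_isOpen hJ) (cell_nonempty hJ) hσJc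
      (cells_disjoint hK hJ (Ne.symm hJK)) hnK hqJ
    have h3 := hm.normal_eq_neg hq (edge_nonempty hE) (cell_convex hL) (cell_isOpen hL)
      (cell_nonempty hL) hσLc (cell_convex hJ) (cell_isOpen hJ) (cell_nonempty hJ) hσJc
      (cells_disjoint hL hJ (Ne.symm hJL)) hmL hqJ
    have h4 : n = 0 := by
      rw [h1, neg_neg] at h3
      rw [h3] at h2
      have h5 : (2 : ℝ) • n = 0 := by
        rw [two_smul]
        nth_rewrite 1 [h2]
        exact neg_add_cancel n
      simpa using h5
    have := hn.1
    rw [h4, norm_zero] at this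
    exact zero_ne_one this
  have hacross : ∀ K L : Set (Euc p), K ∈ M.cells → L ∈ M.cells → σ ∈ M.cellEdges K →
      σ ∈ M.cellEdges L → K ≠ L → closure K ∩ closure L = closure σ → M.across K σ = L := by
    intro K L hK hL hσK hσL hKL hcl
    have hspec : M.across K σ ∈ M.cells ∧ M.across K σ ≠ K ∧
        closure K ∩ closure (M.across K σ) = closure σ :=
      Classical.epsilon_spec (p := fun L => L ∈ M.cells ∧ L ≠ K ∧ closure K ∩ closure L = closure σ)
        ⟨L, hL, hKL.symm, hcl⟩
    exact huniq K L _ hK hL hspec.1 hσK hσL hKL hspec.2.1 hspec.2.2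
  have hσK₁ : σ ∈ M.cellEdges K₁ := (hiff K₁ hK₁).2 (Or.inl rfl)
  have hσL₁ : σ ∈ M.cellEdges L₁ := (hiff L₁ hL₁).2 (Or.inr rfl)
  have hcl' : closure L₁ ∩ closure K₁ = closure σ := by rwa [Set.inter_comm]
  have e1 := hacross K₁ L₁ hK₁ hL₁ hσK₁ hσL₁ hne hcl
  have e2 := hacross L₁ K₁ hL₁ hK₁ hσL₁ hσK₁ hne.symm hcl'
  rcases (hiff K hK).1 hσ with rfl | rfl
  · rw [e1, e2]
    exact ⟨hL₁, hne.symm, hσL₁, hcl, rfl, fun J hJ h => (hiff J hJ).1 h⟩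
  · rw [e2, e1]
    exact ⟨hK₁, hne, hσK₁, hcl', rfl, fun J hJ h => ((hiff J hJ).1 h).symm⟩

theorem outwardNormal_spec (hK : K ∈ M.cells) (hσ : σ ∈ M.cellEdges K) :
    IsFlatPiece σ (outwardNormal K σ) ∧
      ∀ a ∈ σ, ∀ z ∈ K, inner ℝ (z - a) (outwardNormal K σ) < 0 := by
  obtain ⟨n, hn, hnK⟩ := exists_edge_normal hK hσ
  rw [hn.outwardNormal_eq (edge_nonempty (mem_edges hK hσ)) (cell_nonempty hK) hnK]
  exact ⟨hn, hnK⟩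

theorem outwardNormal_across (hK : K ∈ M.cells) (hσ : σ ∈ M.cellEdges K)
    (hint : ¬ σ ⊆ frontier Ω) : outwardNormal (M.across K σ) σ = -outwardNormal K σ := by
  obtain ⟨hL, hne, hσL, -⟩ := across_spec hK hσ hint
  obtain ⟨hn, hnK⟩ := outwardNormal_spec hK hσ
  obtain ⟨hm, hmL⟩ := outwardNormal_spec hL hσL
  exact hn.normal_eq_neg hm (edge_nonempty (mem_edges hK hσ)) (cell_convex hK) (cell_isOpen hK)
    (cell_nonempty hK) ((edge_subset_frontier hK hσ).trans frontier_subset_closure)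
    (cell_convex hL) (cell_isOpen hL) (cell_nonempty hL)
    ((edge_subset_frontier hL hσL).trans frontier_subset_closure)
    (cells_disjoint hK hL hne.symm) hnK hmL

theorem meanNormalVelocity_across (U : Euc p → Euc p) (hK : K ∈ M.cells)
    (hσ : σ ∈ M.cellEdges K) (hint : ¬ σ ⊆ frontier Ω) :
    meanNormalVelocity U (M.across K σ) σ = -meanNormalVelocity U K σ := by
  unfold meanNormalVelocity
  rw [outwardNormal_across hK hσ hint]
  simp only [inner_neg_right, average_eq, integral_neg, smul_neg]

theorem edgeDist_across (hK : K ∈ M.cells) (hσ : σ ∈ M.cellEdges K) (hint : ¬ σ ⊆ frontier Ω) :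
    M.edgeDist (M.across K σ) σ = M.edgeDist K σ := by
  obtain ⟨-, -, -, -, h, -⟩ := across_spec hK hσ hint
  rw [edgeDist, edgeDist, if_neg hint, if_neg hint, h, dist_comm]

theorem edgeDist_pos (hK : K ∈ M.cells) (hσ : σ ∈ M.cellEdges K) : 0 < M.edgeDist K σ := by
  have hE := mem_edges hK hσ
  rw [edgeDist]
  split_ifs with h
  · rw [← Metric.infDist_closure]
    exact (isClosed_closure.notMem_iff_infDist_pos (edge_nonempty hE).closure).1
      (M.exterior_orth K hK σ hσ h).1
  · obtain ⟨hL, hne, hσL, hcl, -⟩ := across_spec hK hσ h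
    exact dist_pos.2 (M.interior_orth K hK _ hL hne.symm σ hE hcl).1

theorem point_mem_closure (hK : K ∈ M.cells) : M.point K ∈ closure Ω :=
  closure_mono (cell_subset hK) (M.point_mem K hK)

theorem edgeDist_le_diam (hb : Bornology.IsBounded Ω) (hK : K ∈ M.cells)
    (hσ : σ ∈ M.cellEdges K) : M.edgeDist K σ ≤ Metric.diam (closure Ω) := by
  have hE := mem_edges hK hσ
  rw [edgeDist]
  split_ifs with h
  · obtain ⟨a, ha⟩ := edge_nonempty hE
    exact (Metric.infDist_le_dist_of_mem ha).trans (Metric.dist_le_diam_of_mem hb.closure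
      (point_mem_closure hK) ((M.edge_isEdge σ hE).2 ha))
  · obtain ⟨hL, -⟩ := across_spec hK hσ h
    exact Metric.dist_le_diam_of_mem hb.closure (point_mem_closure hK) (point_mem_closure hL)

theorem transmissibility_across (hK : K ∈ M.cells) (hσ : σ ∈ M.cellEdges K)
    (hint : ¬ σ ⊆ frontier Ω) :
    M.transmissibility (M.across K σ) σ = M.transmissibility K σ := by
  rw [transmissibility, transmissibility, edgeDist_across hK hσ hint]

theorem transmissibility_pos (hK : K ∈ M.cells) (hσ : σ ∈ M.cellEdges K) :
    0 < M.transmissibility K σ :=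
  div_pos (surf_edge_pos hK hσ) (edgeDist_pos hK hσ)

end AdmissibleMesh

/-! ### Crossing the boundary of a family of cells -/

theorem coneOver_mono_closure {p : ℕ} {K σ : Set (Euc p)} (hK : Convex ℝ K) {x : Euc p}
    (hx : x ∈ closure K) (hσ : σ ⊆ closure K) : coneOver x σ ⊆ closure K := by
  rintro z ⟨y, hy, t, ht, rfl⟩
  exact hK.closure.add_smul_sub_mem hx (hσ hy) ⟨ht.1.le, ht.2.le⟩

/-- Along a ray from a point strictly below a supporting hyperplane, no point of the closed
half-space lies beyond the hyperplane. -/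
theorem param_le_of_ray {p : ℕ} {a n x y y' : Euc p} {t t' : ℝ} (ht' : 0 < t')
    (hd : 0 < -inner ℝ (x - a) n) (hy : inner ℝ (y - a) n = 0) (hy' : inner ℝ (y' - a) n ≤ 0)
    (h : x + t • (y - x) = x + t' • (y' - x)) : t ≤ t' := by
  have h1 : t • (y - x) = t' • (y' - x) := add_left_cancel h
  have h2 := congrArg (fun v : Euc p => inner ℝ v n) h1
  simp only [inner_smul_left] at h2
  rw [show y - x = (y - a) - (x - a) by abel, show y' - x = (y' - a) - (x - a) by abel,
    inner_sub_left (y - a), inner_sub_left (y' - a), hy] at h2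
  simp only [conj_trivial] at h2
  nlinarith

namespace AdmissibleMesh

variable {p : ℕ} {Ω : Set (Euc p)} {M : AdmissibleMesh Ω} {K L σ : Set (Euc p)}

/-- The cones with apex `x_K` over the edges of `K` are disjoint and contained in the closure
of `K`. -/
theorem sum_surf_mul_infDist_le (hK : K ∈ M.cells) :
    ∑ σ ∈ M.cellEdges K, (surf p).real σ *
      Metric.infDist (M.point K) (affineSpan ℝ σ : Set (Euc p)) ≤ 2 ^ p * volume.real K := by
  classical
  set x := M.point K with hx
  have hdata : ∀ σ ∈ M.cellEdges K, ∃ n a : Euc p, IsFlatPiece σ n ∧ a ∈ σ ∧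
      (∀ z ∈ closure K, inner ℝ (z - a) n ≤ 0) := by
    intro σ hσ
    obtain ⟨n, hn, hneg⟩ := exists_edge_normal hK hσ
    obtain ⟨a, ha⟩ := edge_nonempty (mem_edges hK hσ)
    refine ⟨n, a, hn, ha, fun z hz => ?_⟩
    have hc : IsClosed {z : Euc p | inner ℝ (z - a) n ≤ 0} :=
      isClosed_le (by fun_prop) continuous_const
    exact closure_minimal (fun z hz => (hneg a ha z hz).le) hc hz
  choose! n a hn ha hle using hdata
  have hσK : ∀ σ ∈ M.cellEdges K, σ ⊆ closure K := fun σ hσ =>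
    (edge_subset_frontier hK hσ).trans frontier_subset_closure
  have hflat : ∀ σ ∈ M.cellEdges K, ∀ z ∈ σ, inner ℝ (z - a σ) (n σ) = 0 := fun σ hσ z hz =>
    (hn σ hσ).inner_eq_zero (ha σ hσ) hz
  set d : Set (Euc p) → ℝ := fun σ => -inner ℝ (x - a σ) (n σ) with hd
  set C : Set (Euc p) → Set (Euc p) := fun σ => if 0 < d σ then coneOver x σ else ∅ with hC
  have hd0 : ∀ σ ∈ M.cellEdges K, 0 ≤ d σ := fun σ hσ => by
    have := hle σ hσ x (M.point_mem K hK)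
    simp only [hd]
    linarith
  have hCm : ∀ σ ∈ M.cellEdges K, MeasurableSet (C σ) := by
    intro σ hσ
    simp only [hC]
    split_ifs with h
    · exact measurableSet_coneOver (hn σ hσ).measurableSet (hflat σ hσ) h
    · exact MeasurableSet.empty
  have hCsub : ∀ σ ∈ M.cellEdges K, C σ ⊆ closure K := by
    intro σ hσ
    simp only [hC]
    split_ifs with h
    · exact coneOver_mono_closure (cell_convex hK) (M.point_mem K hK) (hσK σ hσ)
    · exact Set.empty_subset _
  have hCdisj : (M.cellEdges K : Set (Set (Euc p))).PairwiseDisjoint C := by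
    intro σ hσ σ' hσ' hne
    rw [Function.onFun, Set.disjoint_left]
    intro z hz hz'
    simp only [hC] at hz hz'
    split_ifs at hz with h
    · split_ifs at hz' with h'
      · obtain ⟨y, hy, t, ht, rfl⟩ := hz
        obtain ⟨y', hy', t', ht', heq⟩ := hz'
        have h1 := param_le_of_ray ht'.1 h (hflat σ hσ y hy) (hle σ hσ y' (hσK σ' hσ' hy')) heq
        have h2 := param_le_of_ray ht.1 h' (hflat σ' hσ' y' hy')
          (hle σ' hσ' y (hσK σ hσ hy)) heq.symm
        have h3 : t = t' := le_antisymm h1 h2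
        subst h3
        have h4 : y = y' := sub_left_injective (smul_right_injective _ ht.1.ne'
          (add_left_cancel heq))
        subst h4
        exact Set.disjoint_left.1 (M.edge_disjoint σ (mem_edges hK hσ) σ' (mem_edges hK hσ') hne)
          hy hy'
      · exact hz'
    · exact hz
  have hterm : ∀ σ ∈ M.cellEdges K,
      ENNReal.ofReal (d σ) * surf p σ ≤ 2 ^ p * volume (C σ) := by
    intro σ hσ
    simp only [hC]
    split_ifs with h
    · exact height_mul_surf_le_volume_coneOver (hn σ hσ).measurableSet (hn σ hσ).1 (hflat σ hσ) h
    · rw [ENNReal.ofReal_of_nonpos (not_lt.1 h), zero_mul]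
      exact zero_le
  have hvol : volume (closure K) = volume K := by
    refine le_antisymm ?_ (measure_mono subset_closure)
    rw [closure_eq_self_union_frontier]
    refine (measure_union_le _ _).trans ?_
    rw [(cell_convex hK).addHaar_frontier volume, add_zero]
  have hsum : ∑ σ ∈ M.cellEdges K, ENNReal.ofReal (d σ) * surf p σ ≤ 2 ^ p * volume K := by
    calc ∑ σ ∈ M.cellEdges K, ENNReal.ofReal (d σ) * surf p σ
        ≤ ∑ σ ∈ M.cellEdges K, 2 ^ p * volume (C σ) := Finset.sum_le_sum hterm
      _ = 2 ^ p * volume (⋃ σ ∈ M.cellEdges K, C σ) := by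
          rw [← Finset.mul_sum, measure_biUnion_finset hCdisj hCm]
      _ ≤ 2 ^ p * volume K := by
          rw [← hvol]
          gcongr
          exact Set.iUnion₂_subset hCsub
  have hfin : (2 : ℝ≥0∞) ^ p * volume K ≠ ⊤ :=
    ENNReal.mul_ne_top (by simp) (volume_cell_lt_top hK).ne
  have hreal := ENNReal.toReal_mono hfin hsum
  rw [ENNReal.toReal_sum fun σ hσ => ENNReal.mul_ne_top ENNReal.ofReal_ne_top
    (surf_edge_lt_top hK hσ).ne, ENNReal.toReal_mul, ENNReal.toReal_pow] at hreal
  refine le_trans (Finset.sum_le_sum fun σ hσ => ?_) hreal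
  rw [ENNReal.toReal_mul, ENNReal.toReal_ofReal (hd0 σ hσ), mul_comm]
  refine mul_le_mul_of_nonneg_right ?_ ENNReal.toReal_nonneg
  refine ((hn σ hσ).infDist_affineSpan_le (ha σ hσ) x).trans (le_of_eq ?_)
  rw [abs_of_nonpos (hle σ hσ x (M.point_mem K hK))]

/-- The volume of the diamond cells is controlled by the volume of the mesh cells. -/
theorem sum_surf_mul_edgeDist_le {ξ : ℝ} (hξ : 0 < ξ) (hreg : M.IsRegular ξ) (hK : K ∈ M.cells) :
    ∑ σ ∈ M.cellEdges K, (surf p).real σ * M.edgeDist K σ ≤ 2 ^ p / ξ * volume.real K := by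
  have h := sum_surf_mul_infDist_le hK
  rw [div_mul_eq_mul_div, le_div_iff₀ hξ, Finset.sum_mul]
  refine le_trans (Finset.sum_le_sum fun σ hσ => ?_) h
  rw [mul_assoc, mul_comm (M.edgeDist K σ)]
  exact mul_le_mul_of_nonneg_left (hreg K hK σ hσ) measureReal_nonneg

variable (M) in
/-- The union of the relative boundaries of the edges. -/
def skeleton : Set (Euc p) := ⋃ σ ∈ M.edges, closure σ \ σ

variable (M) in
/-- The union of the cells of a family `A`. -/
def region (_M : AdmissibleMesh Ω) (A : Finset (Set (Euc p))) : Set (Euc p) := ⋃ K ∈ A, K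

open Classical in
variable (M) in
/-- The edges of `K` that belong to the boundary of the family of cells `A`, relative to
`Ω ∪ ΓD`: the Dirichlet edges, and the interior edges whose other side is not in `A`. -/
noncomputable def boundaryEdges (ΓD : Set (Euc p)) (A : Finset (Set (Euc p))) (K : Set (Euc p)) :
    Finset (Set (Euc p)) :=
  (M.cellEdges K).filter fun σ => σ ⊆ ΓD ∨ (¬ σ ⊆ frontier Ω ∧ M.across K σ ∉ A)

variable (M) in
/-- The area of the boundary, relative to `Ω ∪ ΓD`, of a family of cells. -/
noncomputable def perimeter (ΓD : Set (Euc p)) (A : Finset (Set (Euc p))) : ℝ :=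
  ∑ K ∈ A, ∑ σ ∈ M.boundaryEdges ΓD A K, (surf p).real σ

theorem perimeter_nonneg (ΓD : Set (Euc p)) (A : Finset (Set (Euc p))) :
    0 ≤ M.perimeter ΓD A :=
  Finset.sum_nonneg fun _ _ => Finset.sum_nonneg fun _ _ => measureReal_nonneg

theorem exists_edge_mem (hK : K ∈ M.cells) {y : Euc p} (hy : y ∈ closure K) (hyK : y ∉ K)
    (hZ : y ∉ M.skeleton) : ∃ σ ∈ M.cellEdges K, y ∈ σ := by
  have hfr : y ∈ frontier K := by
    rw [(cell_isOpen hK).frontier_eq]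
    exact ⟨hy, hyK⟩
  rw [M.frontier_cell K hK] at hfr
  simp only [Set.mem_iUnion] at hfr
  obtain ⟨σ, hσ, hyσ⟩ := hfr
  refine ⟨σ, hσ, ?_⟩
  by_contra hcon
  exact hZ (Set.mem_biUnion (mem_edges hK hσ) ⟨hyσ, hcon⟩)

/-- A segment that enters a family `A` of cells, from another cell or from the Dirichlet boundary,
crosses a boundary edge of `A`, unless it meets the skeleton. -/
theorem exists_boundaryEdge_of_segment (hΩ : IsOpen Ω) {ΓD ΓN : Set (Euc p)}
    (hΓ : ΓD ∪ ΓN = frontier Ω) (hdisj : Disjoint ΓD ΓN) (hsplit : M.SplitsBoundary ΓD ΓN)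
    {A : Finset (Set (Euc p))} (hA : A ⊆ M.cells) {x z : Euc p}
    (hz : ∃ K ∈ A, z ∈ closure K) (hseg : ∀ y ∈ segment ℝ x z, y = x ∨ y ∈ Ω)
    (hx : x ∈ ΓD ∨ x ∈ Ω ∧ ∃ L ∈ M.cells, L ∉ A ∧ x ∈ closure L)
    (hZ : ∀ y ∈ segment ℝ x z, y ∉ M.skeleton) :
    ∃ y ∈ segment ℝ x z, ∃ K ∈ A, ∃ σ ∈ M.boundaryEdges ΓD A K, y ∈ σ := by
  classical
  -- An interior point that belongs to the closures of a cell of `A` and of another cell.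
  have key : ∀ y ∈ segment ℝ x z, y ∈ Ω → ∀ K ∈ A, y ∈ closure K → ∀ L ∈ M.cells, L ∉ A →
      y ∈ closure L → ∃ y ∈ segment ℝ x z, ∃ K ∈ A, ∃ σ ∈ M.boundaryEdges ΓD A K, y ∈ σ := by
    intro y hy hyΩ K hKA hyK L hL hLA hyL
    have hK := hA hKA
    have hKL : K ≠ L := fun h => hLA (h ▸ hKA)
    obtain ⟨σ, hσ, hyσ⟩ := exists_edge_mem hK hyK
      (fun h => Set.disjoint_left.1 (disjoint_closure_cell hL hK hKL.symm) hyL h) (hZ y hy)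
    obtain ⟨σ', hσ', hyσ'⟩ := exists_edge_mem hL hyL
      (fun h => Set.disjoint_left.1 (disjoint_closure_cell hK hL hKL) hyK h) (hZ y hy)
    have hσσ' : σ = σ' := by
      by_contra hne
      exact Set.disjoint_left.1 (M.edge_disjoint σ (mem_edges hK hσ) σ' (mem_edges hL hσ') hne)
        hyσ hyσ'
    subst hσσ'
    have hint := not_subset_frontier_of_mem hΩ hyΩ hyσ
    refine ⟨y, hy, K, hKA, σ, ?_, hyσ⟩
    rw [boundaryEdges, Finset.mem_filter]
    refine ⟨hσ, Or.inr ⟨hint, ?_⟩⟩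
    obtain ⟨-, -, -, -, -, hJ⟩ := across_spec hK hσ hint
    rcases hJ L hL hσ' with h | h
    · exact absurd h.symm hKL
    · rwa [← h]
  set C₁ : Set (Euc p) := ⋃ K ∈ A, closure K with hC₁
  set C₂ : Set (Euc p) := ⋃ L ∈ M.cells \ A, closure L with hC₂
  have hC₁c : IsClosed C₁ := isClosed_biUnion_finset fun _ _ => isClosed_closure
  have hC₂c : IsClosed C₂ := isClosed_biUnion_finset fun _ _ => isClosed_closure
  have hxcl : x ∈ closure Ω := by
    rcases hx with h | ⟨h, -⟩
    · exact frontier_subset_closure (hΓ ▸ Or.inl h)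
    · exact subset_closure h
  have hcover : segment ℝ x z ⊆ C₁ ∪ C₂ := by
    intro y hy
    have hycl : y ∈ closure Ω := by
      rcases hseg y hy with rfl | h
      · exact hxcl
      · exact subset_closure h
    rw [closure_eq_iUnion_closure_cells (M := M)] at hycl
    simp only [Set.mem_iUnion] at hycl
    obtain ⟨K, hK, hyK⟩ := hycl
    by_cases hKA : K ∈ A
    · exact Or.inl (Set.mem_biUnion hKA hyK)
    · exact Or.inr (Set.mem_biUnion (Finset.mem_sdiff.2 ⟨hK, hKA⟩) hyK)
  have hz1 : (segment ℝ x z ∩ C₁).Nonempty := by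
    obtain ⟨K, hK, hzK⟩ := hz
    exact ⟨z, right_mem_segment ℝ x z, Set.mem_biUnion hK hzK⟩
  have hconn := isPreconnected_closed_iff.1 (convex_segment (𝕜 := ℝ) x z).isPreconnected C₁ C₂ hC₁c
    hC₂c hcover hz1
  have hmeet : x ∈ C₂ → (x ∈ Ω ∨ x ∉ C₁) →
      ∃ y ∈ segment ℝ x z, ∃ K ∈ A, ∃ σ ∈ M.boundaryEdges ΓD A K, y ∈ σ := by
    intro hxC₂ hx'
    obtain ⟨y, hy, hy1, hy2⟩ := hconn ⟨x, left_mem_segment ℝ x z, hxC₂⟩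
    have hyΩ : y ∈ Ω := by
      rcases hseg y hy with rfl | h
      · exact hx'.resolve_right fun h => h hy1
      · exact h
    simp only [hC₁, hC₂, Set.mem_iUnion] at hy1 hy2
    obtain ⟨K, hK, hyK⟩ := hy1
    obtain ⟨L, hL, hyL⟩ := hy2
    rw [Finset.mem_sdiff] at hL
    exact key y hy hyΩ K hK hyK L hL.1 hL.2 hyL
  rcases hx with hxD | ⟨hxΩ, L, hL, hLA, hxL⟩
  · by_cases hxC₁ : x ∈ C₁
    · have hxfr : x ∈ frontier Ω := hΓ ▸ Or.inl hxD
      have hxΩ : x ∉ Ω := by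
        rw [hΩ.frontier_eq] at hxfr
        exact hxfr.2
      simp only [hC₁, Set.mem_iUnion] at hxC₁
      obtain ⟨K, hKA, hxK⟩ := hxC₁
      have hK := hA hKA
      obtain ⟨σ, hσ, hxσ⟩ := exists_edge_mem hK hxK (fun h => hxΩ (cell_subset hK h))
        (hZ x (left_mem_segment ℝ x z))
      have hE := mem_edges hK hσ
      have hσfr : σ ⊆ frontier Ω := by
        rcases M.interior_or_exterior σ hE with ⟨h, -⟩ | ⟨h, -⟩
        · exact absurd (h hxσ) hxΩ
        · exact h
      have hσD : σ ⊆ ΓD := by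
        rcases hsplit σ hE hσfr with h | h
        · exact h
        · exact absurd (h hxσ) (Set.disjoint_left.1 hdisj hxD)
      refine ⟨x, left_mem_segment ℝ x z, K, hKA, σ, ?_, hxσ⟩
      rw [boundaryEdges, Finset.mem_filter]
      exact ⟨hσ, Or.inl hσD⟩
    · exact hmeet ((hcover (left_mem_segment ℝ x z)).resolve_left hxC₁) (Or.inr hxC₁)
  · exact hmeet (Set.mem_biUnion (Finset.mem_sdiff.2 ⟨hL, hLA⟩) hxL) (Or.inl hxΩ)

variable (M) in
/-- The points reached from the boundary edges of `A`, or from the skeleton, by a translation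
along a part of `w`. -/
def shadow (ΓD : Set (Euc p)) (A : Finset (Set (Euc p))) (w : Euc p) : Set (Euc p) :=
  sweep M.skeleton w ∪ ⋃ K ∈ A, ⋃ σ ∈ M.boundaryEdges ΓD A K, sweep σ w

theorem volume_sweep_skeleton (w : Euc p) : volume (sweep M.skeleton w) = 0 := by
  have hsub : sweep M.skeleton w ⊆ ⋃ σ ∈ M.edges, sweep (closure σ \ σ) w := by
    rintro z ⟨x, hx, t, ht, rfl⟩
    simp only [skeleton, Set.mem_iUnion] at hx ⊢
    obtain ⟨σ, hσ, hx⟩ := hx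
    exact ⟨σ, hσ, x, hx, t, ht, rfl⟩
  refine measure_mono_null hsub ((measure_biUnion_null_iff M.edges.countable_toSet).2 ?_)
  intro σ hσ
  obtain ⟨n, hn⟩ := (M.edge_isEdge σ hσ).1.exists_isFlatPiece
  obtain ⟨a, ha⟩ := edge_nonempty hσ
  have h := volume_sweep_le (isClosed_closure.measurableSet.diff hn.measurableSet) hn.1
    (fun z hz => hn.inner_eq_zero_of_mem_closure ha hz.1) w
  rw [(M.edge_isEdge σ hσ).1.2.2, mul_zero] at h
  exact le_antisymm h zero_le

theorem volume_shadow_le (ΓD : Set (Euc p)) {A : Finset (Set (Euc p))} (hA : A ⊆ M.cells)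
    (w : Euc p) : volume (M.shadow ΓD A w) ≤ ENNReal.ofReal (‖w‖ * M.perimeter ΓD A) := by
  have hnn : ∀ K ∈ A, 0 ≤ ∑ σ ∈ M.boundaryEdges ΓD A K, (surf p).real σ := fun _ _ =>
    Finset.sum_nonneg fun _ _ => measureReal_nonneg
  calc volume (M.shadow ΓD A w)
      ≤ volume (sweep M.skeleton w) +
          volume (⋃ K ∈ A, ⋃ σ ∈ M.boundaryEdges ΓD A K, sweep σ w) := measure_union_le _ _
    _ = volume (⋃ K ∈ A, ⋃ σ ∈ M.boundaryEdges ΓD A K, sweep σ w) := by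
        rw [volume_sweep_skeleton, zero_add]
    _ ≤ ∑ K ∈ A, ∑ σ ∈ M.boundaryEdges ΓD A K, volume (sweep σ w) :=
        (measure_biUnion_finset_le _ _).trans
          (Finset.sum_le_sum fun K _ => measure_biUnion_finset_le _ _)
    _ ≤ ∑ K ∈ A, ∑ σ ∈ M.boundaryEdges ΓD A K,
          ENNReal.ofReal ‖w‖ * ENNReal.ofReal ((surf p).real σ) := by
        refine Finset.sum_le_sum fun K hK => Finset.sum_le_sum fun σ hσ => ?_
        classical
        rw [boundaryEdges, Finset.mem_filter] at hσ
        have hE := mem_edges (hA hK) hσ.1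
        obtain ⟨n, hn⟩ := (M.edge_isEdge σ hE).1.exists_isFlatPiece
        obtain ⟨a, ha⟩ := edge_nonempty hE
        rw [measureReal_def, ENNReal.ofReal_toReal (surf_edge_lt_top (hA hK) hσ.1).ne]
        exact volume_sweep_le hn.measurableSet hn.1 (fun z hz => hn.inner_eq_zero ha hz) w
    _ = ENNReal.ofReal (‖w‖ * M.perimeter ΓD A) := by
        rw [ENNReal.ofReal_mul (norm_nonneg _), perimeter, ENNReal.ofReal_sum_of_nonneg hnn,
          Finset.mul_sum]
        refine Finset.sum_congr rfl fun K _ => ?_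
        rw [ENNReal.ofReal_sum_of_nonneg fun _ _ => measureReal_nonneg, Finset.mul_sum]

/-- Points of `A` that are joined to the outside of `A`, or to the Dirichlet boundary, by a
segment with direction `w` lie in the shadow of the boundary of `A`. -/
theorem mem_shadow (hΩ : IsOpen Ω) {ΓD ΓN : Set (Euc p)}
    (hΓ : ΓD ∪ ΓN = frontier Ω) (hdisj : Disjoint ΓD ΓN) (hsplit : M.SplitsBoundary ΓD ΓN)
    {A : Finset (Set (Euc p))} (hA : A ⊆ M.cells) {x z w : Euc p} {t : ℝ}
    (ht : t ∈ Set.Icc (0 : ℝ) 1) (hzx : z = x + t • w)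
    (hz : z ∈ M.region A) (hseg : ∀ y ∈ segment ℝ x z, y = x ∨ y ∈ Ω)
    (hx : x ∈ ΓD ∨ x ∈ Ω ∧ ∃ L ∈ M.cells, L ∉ A ∧ x ∈ closure L) :
    z ∈ M.shadow ΓD A w := by
  have hmove : ∀ y ∈ segment ℝ x z, ∃ s ∈ Set.Icc (0 : ℝ) 1, z = y + s • w := by
    rintro y ⟨α, β, hα, hβ, hαβ, rfl⟩
    refine ⟨α * t, ⟨mul_nonneg hα ht.1, ?_⟩, ?_⟩
    · have : α ≤ 1 := by linarith
      nlinarith [ht.1, ht.2]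
    · have hβ' : β = 1 - α := by linarith
      rw [hzx, hβ', mul_smul]
      module
  by_cases hZ : ∀ y ∈ segment ℝ x z, y ∉ M.skeleton
  · have hz' : ∃ K ∈ A, z ∈ closure K := by
      simp only [region, Set.mem_iUnion] at hz
      obtain ⟨K, hK, hzK⟩ := hz
      exact ⟨K, hK, subset_closure hzK⟩
    obtain ⟨y, hy, K, hK, σ, hσ, hyσ⟩ :=
      exists_boundaryEdge_of_segment hΩ hΓ hdisj hsplit hA hz' hseg hx hZ
    obtain ⟨s, hs, hzs⟩ := hmove y hy
    exact Or.inr (Set.mem_biUnion hK (Set.mem_biUnion hσ ⟨y, hyσ, s, hs, hzs⟩))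
  · push Not at hZ
    obtain ⟨y, hy, hyZ⟩ := hZ
    obtain ⟨s, hs, hzs⟩ := hmove y hy
    exact Or.inl ⟨y, hyZ, s, hs, hzs⟩

end AdmissibleMesh

/-! ### Relative isoperimetric inequalities in convex sets -/

namespace AdmissibleMesh

variable {p : ℕ} {Ω : Set (Euc p)} {M : AdmissibleMesh Ω} {K L σ : Set (Euc p)}

theorem region_isOpen {A : Finset (Set (Euc p))} (hA : A ⊆ M.cells) : IsOpen (M.region A) :=
  isOpen_biUnion fun _ hK => cell_isOpen (hA hK)

theorem region_subset {A : Finset (Set (Euc p))} (hA : A ⊆ M.cells) : M.region A ⊆ Ω :=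
  Set.iUnion₂_subset fun _ hK => cell_subset (hA hK)

theorem volume_diff_region_cells : volume (Ω \ M.region M.cells) = 0 := by
  have hsub : Ω \ M.region M.cells ⊆ ⋃ K ∈ M.cells, frontier K := by
    rintro x ⟨hx, hx'⟩
    have := subset_closure hx
    rw [closure_eq_iUnion_closure_cells (M := M)] at this
    simp only [Set.mem_iUnion] at this ⊢
    obtain ⟨K, hK, hxK⟩ := this
    refine ⟨K, hK, ?_⟩
    rw [(cell_isOpen hK).frontier_eq]
    exact ⟨hxK, fun h => hx' (Set.mem_biUnion hK h)⟩
  exact measure_mono_null hsub ((measure_biUnion_null_iff M.cells.countable_toSet).2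
    fun K hK => (cell_convex hK).addHaar_frontier volume)

open Classical in
theorem volume_diff_region_le (A : Finset (Set (Euc p))) {S : Set (Euc p)} (hS : S ⊆ Ω) :
    volume (S \ M.region A) ≤ volume (S ∩ M.region (M.cells \ A)) := by
  have hsub : S \ M.region A ⊆ (S ∩ M.region (M.cells \ A)) ∪ (Ω \ M.region M.cells) := by
    rintro x ⟨hx, hxA⟩
    by_cases h : x ∈ M.region M.cells
    · left
      refine ⟨hx, ?_⟩
      simp only [region, Set.mem_iUnion] at h hxA ⊢
      obtain ⟨K, hK, hxK⟩ := h
      exact ⟨K, Finset.mem_sdiff.2 ⟨hK, fun hKA => hxA ⟨K, hKA, hxK⟩⟩, hxK⟩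
    · exact Or.inr ⟨hS hx, h⟩
  refine (measure_mono hsub).trans ((measure_union_le _ _).trans ?_)
  rw [volume_diff_region_cells, add_zero]

/-- Integral geometry: few pairs of nearby points can be separated by a boundary of small area. -/
theorem prod_volume_separated_le (hΩ : IsOpen Ω) {ΓD ΓN : Set (Euc p)}
    (hΓ : ΓD ∪ ΓN = frontier Ω) (hdisj : Disjoint ΓD ΓN) (hsplit : M.SplitsBoundary ΓD ΓN)
    {A : Finset (Set (Euc p))} (hA : A ⊆ M.cells) {ρ : ℝ} {G : Set (Euc p × Euc p)}
    (hG : MeasurableSet G)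
    (hsep : ∀ x z, (x, z) ∈ G → z ∈ M.region A ∧ (∃ L ∈ M.cells, L ∉ A ∧ x ∈ L) ∧
      segment ℝ x z ⊆ Ω ∧ ‖z - x‖ ≤ ρ) :
    ((volume : Measure (Euc p)).prod volume) G ≤
      ENNReal.ofReal (ρ * M.perimeter ΓD A) * volume (Metric.closedBall (0 : Euc p) ρ) := by
  set G' : Set (Euc p × Euc p) := (fun q : Euc p × Euc p => (q.1 - q.2, q.1)) ⁻¹' G with hG'
  have hG'm : MeasurableSet G' :=
    (show Measurable fun q : Euc p × Euc p => (q.1 - q.2, q.1) by fun_prop) hG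
  have h1 : ((volume : Measure (Euc p)).prod volume) G =
      ((volume : Measure (Euc p)).prod volume) G' := by
    rw [Measure.prod_apply_symm hG, Measure.prod_apply hG'm]
    refine lintegral_congr fun z => ?_
    have hm : MeasurableSet ((fun x => (x, z)) ⁻¹' G) := measurable_prodMk_right hG
    exact ((Measure.measurePreserving_sub_left (volume : Measure (Euc p)) z).measure_preimage
      hm.nullMeasurableSet).symm
  rw [h1, Measure.prod_apply_symm hG'm]
  have hbound : ∀ w : Euc p, volume ((fun z => (z, w)) ⁻¹' G') ≤
      (Metric.closedBall (0 : Euc p) ρ).indicator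
        (fun _ => ENNReal.ofReal (ρ * M.perimeter ΓD A)) w := by
    intro w
    by_cases hw : w ∈ Metric.closedBall (0 : Euc p) ρ
    · rw [Set.indicator_of_mem hw]
      have hw' : ‖w‖ ≤ ρ := by simpa using hw
      have hsub : (fun z => (z, w)) ⁻¹' G' ⊆ M.shadow ΓD A w := by
        intro z hz
        obtain ⟨hzA, ⟨L, hL, hLA, hxL⟩, hseg, -⟩ := hsep (z - w) z hz
        exact mem_shadow hΩ hΓ hdisj hsplit hA (t := 1) ⟨zero_le_one, le_rfl⟩ (by simp) hzA
          (fun y hy => Or.inr (hseg hy)) (Or.inr ⟨cell_subset hL hxL, L, hL, hLA,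
            subset_closure hxL⟩)
      refine (measure_mono hsub).trans ((volume_shadow_le ΓD hA w).trans ?_)
      exact ENNReal.ofReal_le_ofReal (mul_le_mul_of_nonneg_right hw' (perimeter_nonneg _ _))
    · rw [Set.indicator_of_notMem hw]
      have hempty : (fun z => (z, w)) ⁻¹' G' = ∅ := by
        rw [Set.eq_empty_iff_forall_notMem]
        intro z hz
        obtain ⟨-, -, -, hn⟩ := hsep (z - w) z hz
        apply hw
        simpa using hn
      rw [hempty, measure_empty]
  refine (lintegral_mono hbound).trans (le_of_eq ?_)
  rw [lintegral_indicator measurableSet_closedBall, setLIntegral_const]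

/-- Relative isoperimetric inequality in a convex set. -/
theorem volume_mul_volume_diff_le (hΩ : IsOpen Ω) {ΓD ΓN : Set (Euc p)}
    (hΓ : ΓD ∪ ΓN = frontier Ω) (hdisj : Disjoint ΓD ΓN) (hsplit : M.SplitsBoundary ΓD ΓN)
    {A : Finset (Set (Euc p))} (hA : A ⊆ M.cells) {C : Set (Euc p)} (hC : Convex ℝ C)
    (hCo : IsOpen C) (hCb : Bornology.IsBounded C) (hCΩ : C ⊆ Ω) :
    volume (C \ M.region A) * volume (M.region A ∩ C) ≤
      ENNReal.ofReal (Metric.diam C * M.perimeter ΓD A) *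
        volume (Metric.closedBall (0 : Euc p) (Metric.diam C)) := by
  classical
  have hA' : M.cells \ A ⊆ M.cells := Finset.sdiff_subset
  refine le_trans ?_ (prod_volume_separated_le hΩ hΓ hdisj hsplit hA (ρ := Metric.diam C)
    (G := (C ∩ M.region (M.cells \ A)) ×ˢ (M.region A ∩ C)) ?_ ?_)
  · rw [Measure.prod_prod]
    exact mul_le_mul_left (volume_diff_region_le A hCΩ) _
  · exact (hCo.inter (region_isOpen hA')).measurableSet.prod
      ((region_isOpen hA).inter hCo).measurableSet
  · rintro x z ⟨⟨hxC, hx⟩, hzA, hzC⟩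
    refine ⟨hzA, ?_, (hC.segment_subset hxC hzC).trans hCΩ, ?_⟩
    · simp only [region, Set.mem_iUnion] at hx
      obtain ⟨L, hL, hxL⟩ := hx
      rw [Finset.mem_sdiff] at hL
      exact ⟨L, hL.1, hL.2, hxL⟩
    · rw [← dist_eq_norm]
      exact Metric.dist_le_diam_of_mem hCb hzC hxC

end AdmissibleMesh

/-- The volume of the trace on `D` of a family of cells is controlled by its perimeter,
uniformly with respect to the mesh. -/
def PerimeterControls {p : ℕ} (Ω ΓD ΓN D : Set (Euc p)) : Prop :=
  ∃ C : ℝ, 0 ≤ C ∧ ∀ M : AdmissibleMesh Ω, M.SplitsBoundary ΓD ΓN → ∀ A ⊆ M.cells,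
    volume.real (M.region A ∩ D) ≤ C * M.perimeter ΓD A

namespace PerimeterControls

variable {p : ℕ} {Ω ΓD ΓN D D' C : Set (Euc p)}

theorem mono (h : PerimeterControls Ω ΓD ΓN D) (hD : D' ⊆ D) (hb : Bornology.IsBounded D) :
    PerimeterControls Ω ΓD ΓN D' := by
  obtain ⟨C, hC, h⟩ := h
  refine ⟨C, hC, fun M hM A hA => le_trans ?_ (h M hM A hA)⟩
  exact measureReal_mono (Set.inter_subset_inter_right _ hD)
    (hb.subset Set.inter_subset_right).measure_lt_top.ne

/-- Control spreads from a part of positive volume to a convex set. -/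
theorem convex (hΩ : IsOpen Ω) (hΓ : ΓD ∪ ΓN = frontier Ω) (hdisj : Disjoint ΓD ΓN)
    (h : PerimeterControls Ω ΓD ΓN D) (hDo : IsOpen D) (hDne : D.Nonempty) (hDC : D ⊆ C)
    (hC : Convex ℝ C) (hCo : IsOpen C) (hCb : Bornology.IsBounded C) (hCΩ : C ⊆ Ω) :
    PerimeterControls Ω ΓD ΓN C := by
  obtain ⟨c, hc, h⟩ := h
  have hDfin : volume D ≠ ⊤ := (hCb.subset hDC).measure_lt_top.ne
  have hCfin : volume C ≠ ⊤ := hCb.measure_lt_top.ne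
  have hd : 0 < volume.real D := ENNReal.toReal_pos (hDo.measure_pos volume hDne).ne' hDfin
  set V : ℝ := volume.real (Metric.closedBall (0 : Euc p) (Metric.diam C)) with hV
  set d : ℝ := volume.real D with hd'
  refine ⟨2 * Metric.diam C * V / d + 2 * c * volume.real C / d, ?_, fun M hM A hA => ?_⟩
  · have := Metric.diam_nonneg (s := C)
    positivity
  set P : ℝ := M.perimeter ΓD A with hP
  have hP0 : 0 ≤ P := AdmissibleMesh.perimeter_nonneg _ _
  have hdiam := Metric.diam_nonneg (s := C)
  have hsmall : volume.real (M.region A ∩ C) ≤ volume.real C :=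
    measureReal_mono Set.inter_subset_right hCfin
  by_cases hcase : volume.real (M.region A ∩ D) ≤ d / 2
  · have h1 := AdmissibleMesh.volume_mul_volume_diff_le hΩ hΓ hdisj hM hA hC hCo hCb hCΩ
    have h2 := ENNReal.toReal_mono (ENNReal.mul_ne_top ENNReal.ofReal_ne_top
      measure_closedBall_lt_top.ne) h1
    rw [ENNReal.toReal_mul, ENNReal.toReal_mul, ENNReal.toReal_ofReal (by positivity)] at h2
    have h3 : d / 2 ≤ (volume (C \ M.region A)).toReal := by
      have e1 : D \ M.region A ⊆ C \ M.region A := Set.sdiff_subset_sdiff_left hDC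
      have e2 : volume.real (D \ M.region A) ≤ volume.real (C \ M.region A) :=
        measureReal_mono e1 ((hCb.subset Set.sdiff_subset).measure_lt_top.ne)
      have e3 := measureReal_inter_add_sdiff (μ := volume) (s := D)
        (AdmissibleMesh.region_isOpen hA).measurableSet hDfin
      rw [Set.inter_comm] at e3
      change d / 2 ≤ volume.real (C \ M.region A)
      linarith
    have h4 : d / 2 * volume.real (M.region A ∩ C) ≤ Metric.diam C * P * V :=
      (mul_le_mul_of_nonneg_right h3 measureReal_nonneg).trans h2
    have h5 : volume.real (M.region A ∩ C) ≤ 2 * Metric.diam C * V / d * P := by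
      rw [div_mul_eq_mul_div, le_div_iff₀ hd]
      linarith
    have h6 : 0 ≤ 2 * c * volume.real C / d * P := by positivity
    rw [add_mul]
    linarith
  · push Not at hcase
    have h1 := h M hM A hA
    have h2 : volume.real C ≤ 2 * c * volume.real C / d * P := by
      rw [div_mul_eq_mul_div, le_div_iff₀ hd]
      have : d ≤ 2 * (c * P) := by linarith
      nlinarith [measureReal_nonneg (μ := volume) (s := C)]
    have h6 : 0 ≤ 2 * Metric.diam C * V / d * P := by positivity
    rw [add_mul]
    linarith

/-- Control spreads through a connected open set by chains of balls. -/
theorem exists_ball (hΩ : IsOpen Ω) (hconn : IsPreconnected Ω) (hΓ : ΓD ∪ ΓN = frontier Ω)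
    (hdisj : Disjoint ΓD ΓN) (h : PerimeterControls Ω ΓD ΓN D) (hDo : IsOpen D)
    (hDne : D.Nonempty) (hDb : Bornology.IsBounded D) (hDΩ : D ⊆ Ω) {x : Euc p} (hx : x ∈ Ω) :
    ∃ r > 0, Metric.ball x r ⊆ Ω ∧ PerimeterControls Ω ΓD ΓN (Metric.ball x r) := by
  set G : Set (Euc p) := {x | ∃ r > 0, Metric.ball x r ⊆ Ω ∧
    PerimeterControls Ω ΓD ΓN (Metric.ball x r)} with hG
  have hGo : IsOpen G := by
    rw [Metric.isOpen_iff]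
    rintro x ⟨r, hr, hrΩ, hrc⟩
    refine ⟨r, hr, fun y hy => ⟨r - dist y x, sub_pos.2 hy, ?_, ?_⟩⟩
    · exact (Metric.ball_subset_ball' (by linarith)).trans hrΩ
    · exact hrc.mono (Metric.ball_subset_ball' (by linarith)) Metric.isBounded_ball
  have hspread : ∀ x r, 0 < r → Metric.ball x r ⊆ Ω → ∀ y ∈ Metric.ball x r, y ∈ G →
      PerimeterControls Ω ΓD ΓN (Metric.ball x r) := by
    rintro x r hr hrΩ y hy ⟨s, hs, hsΩ, hsc⟩
    have hpos : 0 < min s (r - dist y x) := lt_min hs (sub_pos.2 hy)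
    refine convex hΩ hΓ hdisj (hsc.mono (Metric.ball_subset_ball (min_le_left s (r - dist y x)))
      Metric.isBounded_ball) Metric.isOpen_ball (Metric.nonempty_ball.2 hpos) ?_
      (convex_ball x r) Metric.isOpen_ball Metric.isBounded_ball hrΩ
    exact Metric.ball_subset_ball' (by linarith [min_le_right s (r - dist y x)])
  have hGc : IsOpen (Ω \ G) := by
    rw [Metric.isOpen_iff]
    rintro x ⟨hx, hxG⟩
    obtain ⟨r, hr, hrΩ⟩ := Metric.isOpen_iff.1 hΩ x hx
    refine ⟨r, hr, fun y hy => ⟨hrΩ hy, fun hyG => hxG ⟨r, hr, hrΩ, hspread x r hr hrΩ y hy hyG⟩⟩⟩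
  have hDG : ∃ y ∈ Ω, y ∈ G := by
    obtain ⟨y, hy⟩ := hDne
    obtain ⟨r, hr, hrD⟩ := Metric.isOpen_iff.1 hDo y hy
    exact ⟨y, hDΩ hy, r, hr, hrD.trans hDΩ, h.mono hrD hDb⟩
  by_contra hcon
  obtain ⟨y, hy, hyG⟩ := hDG
  obtain ⟨z, -, hzG, hzG'⟩ := hconn G (Ω \ G) hGo hGc
    (fun z hz => by
      by_cases hzG : z ∈ G
      · exact Or.inl hzG
      · exact Or.inr ⟨hz, hzG⟩) ⟨y, hy, hyG⟩ ⟨x, hx, hx, hcon⟩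
  exact hzG'.2 hzG

end PerimeterControls

/-! ### The isoperimetric inequality up to the Dirichlet boundary -/

namespace AdmissibleMesh

variable {p : ℕ} {Ω : Set (Euc p)} {M : AdmissibleMesh Ω} {K L σ : Set (Euc p)}

theorem exists_dirichlet_edge (hΩ : IsOpen Ω) {ΓD ΓN : Set (Euc p)}
    (hΓ : ΓD ∪ ΓN = frontier Ω) (hdisj : Disjoint ΓD ΓN) (hsplit : M.SplitsBoundary ΓD ΓN)
    (hΓD : 0 < surf p ΓD) : ∃ K ∈ M.cells, ∃ σ ∈ M.cellEdges K, σ ⊆ ΓD := by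
  have hZ : surf p M.skeleton = 0 :=
    (measure_biUnion_null_iff M.edges.countable_toSet).2 fun σ hσ => (M.edge_isEdge σ hσ).1.2.2
  have hnot : ¬ ΓD ⊆ M.skeleton := fun h => hΓD.ne' (measure_mono_null h hZ)
  obtain ⟨x, hxD, hxZ⟩ := Set.not_subset.1 hnot
  have hxfr : x ∈ frontier Ω := hΓ ▸ Or.inl hxD
  have hxΩ : x ∉ Ω := by
    rw [hΩ.frontier_eq] at hxfr
    exact hxfr.2
  have hxcl := frontier_subset_closure hxfr
  rw [closure_eq_iUnion_closure_cells (M := M)] at hxcl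
  simp only [Set.mem_iUnion] at hxcl
  obtain ⟨K, hK, hxK⟩ := hxcl
  obtain ⟨σ, hσ, hxσ⟩ := exists_edge_mem hK hxK (fun h => hxΩ (cell_subset hK h)) hxZ
  have hE := mem_edges hK hσ
  refine ⟨K, hK, σ, hσ, ?_⟩
  rcases M.interior_or_exterior σ hE with ⟨h, -⟩ | ⟨h, -⟩
  · exact absurd (h hxσ) hxΩ
  · rcases hsplit σ hE h with h' | h'
    · exact h'
    · exact absurd (h' hxσ) (Set.disjoint_left.1 hdisj hxD)

end AdmissibleMesh

namespace PerimeterControls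

variable {p : ℕ} {Ω ΓD ΓN D D' C : Set (Euc p)}

/-- Next to a flat piece of the Dirichlet boundary, a family of cells is controlled by its
perimeter: lines entering from the Dirichlet boundary have to cross the boundary of the family. -/
theorem near_dirichlet (hΩ : IsOpen Ω) (hΓ : ΓD ∪ ΓN = frontier Ω) (hdisj : Disjoint ΓD ΓN)
    {K σ : Set (Euc p)} {n : Euc p} (hK : Convex ℝ K) (hKo : IsOpen K) (hKne : K.Nonempty)
    (hKΩ : K ⊆ Ω) (hn : IsFlatPiece σ n) (hne : σ.Nonempty) (hσK : σ ⊆ closure K)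
    (hneg : ∀ a ∈ σ, ∀ z ∈ K, inner ℝ (z - a) n < 0) (hσD : σ ⊆ ΓD) :
    ∃ D, IsOpen D ∧ D.Nonempty ∧ D ⊆ K ∧ PerimeterControls Ω ΓD ΓN D := by
  obtain ⟨a, ha⟩ := hne
  obtain ⟨z₀, hz₀⟩ := hKne
  obtain ⟨r, hr, hrK⟩ := Metric.isOpen_iff.1 hKo z₀ hz₀
  obtain ⟨-, O, hO, hσO⟩ := hn
  set w : Euc p := z₀ - a with hw
  set w₀ : ℝ := inner ℝ w n with hw₀
  have hw₀neg : w₀ < 0 := hneg a ha z₀ hz₀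
  set τ : Euc p → ℝ := fun z => inner ℝ (z - a) n / w₀ with hτ
  have hτc : Continuous τ := by
    rw [hτ]
    fun_prop
  set D : Set (Euc p) := τ ⁻¹' Set.Ioo 0 1 ∩ (fun z => z - τ z • w) ⁻¹' (O ∩ Metric.ball a r)
    with hD
  have hfoot : ∀ z ∈ D, z - τ z • w ∈ σ := by
    rintro z ⟨-, hzO, -⟩
    refine (hσO a ha _).2 ⟨hzO, ?_⟩
    rw [show z - τ z • w - a = (z - a) - τ z • w by abel, inner_sub_left, inner_smul_left, ← hw₀]
    simp only [hτ, conj_trivial]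
    rw [div_mul_cancel₀ _ hw₀neg.ne, sub_self]
  have hline : ∀ z ∈ D, ∀ t ∈ Set.Ioo (0 : ℝ) 1, z - τ z • w + t • w ∈ K := by
    intro z hz t ht
    have h1 := hσK (hfoot z hz)
    have h2 : z - τ z • w + w ∈ K := by
      apply hrK
      have h3 : dist (z - τ z • w) a < r := hz.2.2
      rw [Metric.mem_ball, dist_eq_norm] at *
      rwa [show z - τ z • w + w - z₀ = z - τ z • w - a by rw [hw]; abel]
    have hseg := hK.openSegment_interior_closure_subset_interior
      (by rwa [hKo.interior_eq]) h1
    rw [hKo.interior_eq] at hseg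
    exact hseg ⟨t, 1 - t, ht.1, by linarith [ht.2], by ring, by module⟩
  have hDK : D ⊆ K := by
    intro z hz
    have := hline z hz (τ z) hz.1
    rwa [sub_add_cancel] at this
  refine ⟨D, ?_, ?_, hDK, ‖w‖, norm_nonneg _, fun M hM A hA => ?_⟩
  · exact (isOpen_Ioo.preimage hτc).inter
      ((hO.inter Metric.isOpen_ball).preimage (by fun_prop))
  · refine ⟨a + (1 / 2 : ℝ) • w, ?_⟩
    have h1 : τ (a + (1 / 2 : ℝ) • w) = 1 / 2 := by
      simp only [hτ]
      rw [add_sub_cancel_left, inner_smul_left, ← hw₀, conj_trivial,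
        mul_div_cancel_right₀ _ hw₀neg.ne]
    refine ⟨?_, ?_⟩
    · rw [Set.mem_preimage, h1]
      norm_num
    · rw [Set.mem_preimage, h1, add_sub_cancel_right]
      exact ⟨((hσO a ha a).1 ha).1, Metric.mem_ball_self hr⟩
  · have hsub : M.region A ∩ D ⊆ M.shadow ΓD A w := by
      rintro z ⟨hzA, hz⟩
      refine AdmissibleMesh.mem_shadow hΩ hΓ hdisj hM hA (x := z - τ z • w) (t := τ z)
        ⟨hz.1.1.le, hz.1.2.le⟩ (by abel) hzA ?_ (Or.inl (hσD (hfoot z hz)))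
      rintro y ⟨α, β, hα, hβ, hαβ, rfl⟩
      have hα' : α = 1 - β := by linarith
      have e : α • (z - τ z • w) + β • z = z - τ z • w + (β * τ z) • w := by
        rw [hα']
        module
      rw [e]
      rcases hβ.eq_or_lt with h0 | h0
      · left
        rw [← h0]
        simp
      · right
        refine hKΩ (hline z hz _ ⟨mul_pos h0 hz.1.1, ?_⟩)
        nlinarith [hz.1.1, hz.1.2]
    have h1 := (measure_mono hsub).trans (AdmissibleMesh.volume_shadow_le ΓD hA w)
    exact ENNReal.toReal_le_of_le_ofReal
      (mul_nonneg (norm_nonneg _) (AdmissibleMesh.perimeter_nonneg _ _)) h1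

end PerimeterControls

namespace AdmissibleMesh

variable {p : ℕ} {Ω : Set (Euc p)} {M : AdmissibleMesh Ω} {K L σ : Set (Euc p)}

/-- A subset of `Ω` is covered, up to a negligible set, by the cells of any mesh. -/
theorem volume_le_sum_inter (N : AdmissibleMesh Ω) {S : Set (Euc p)} (hS : S ⊆ Ω)
    (hb : Bornology.IsBounded Ω) :
    volume.real S ≤ ∑ K ∈ N.cells, volume.real (S ∩ K) := by
  have hsub : S ⊆ (Ω \ N.region N.cells) ∪ ⋃ K ∈ N.cells, S ∩ K := by
    intro x hx
    by_cases h : x ∈ N.region N.cells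
    · right
      simp only [region, Set.mem_iUnion] at h ⊢
      obtain ⟨K, hK, hxK⟩ := h
      exact ⟨K, hK, hx, hxK⟩
    · exact Or.inl ⟨hS hx, h⟩
  have hfin : volume (⋃ K ∈ N.cells, S ∩ K) ≠ ⊤ := by
    refine (hb.subset (Set.iUnion₂_subset fun K _ => ?_)).measure_lt_top.ne
    exact Set.inter_subset_left.trans hS
  have h1 : volume S ≤ volume (⋃ K ∈ N.cells, S ∩ K) := by
    refine (measure_mono hsub).trans ((measure_union_le _ _).trans ?_)
    rw [volume_diff_region_cells, zero_add]
  exact (ENNReal.toReal_mono hfin h1).trans (measureReal_biUnion_finset_le _ _)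

/-- The Poincaré inequality on families of cells. -/
theorem perimeterControls_domain (N : AdmissibleMesh Ω) (hΩ : IsOpen Ω)
    (hconn : IsPreconnected Ω) (hb : Bornology.IsBounded Ω) {ΓD ΓN : Set (Euc p)}
    (hΓ : ΓD ∪ ΓN = frontier Ω) (hdisj : Disjoint ΓD ΓN) (hsplit : N.SplitsBoundary ΓD ΓN)
    (hΓD : 0 < surf p ΓD) : PerimeterControls Ω ΓD ΓN Ω := by
  obtain ⟨K₀, hK₀, σ₀, hσ₀, hσD⟩ := exists_dirichlet_edge hΩ hΓ hdisj hsplit hΓD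
  obtain ⟨n, hn, hneg⟩ := exists_edge_normal hK₀ hσ₀
  obtain ⟨D, hDo, hDne, hDK, hD⟩ := PerimeterControls.near_dirichlet hΩ hΓ hdisj
    (cell_convex hK₀) (cell_isOpen hK₀) (cell_nonempty hK₀) (cell_subset hK₀) hn
    (edge_nonempty (mem_edges hK₀ hσ₀))
    ((edge_subset_frontier hK₀ hσ₀).trans frontier_subset_closure) hneg hσD
  have hcell : ∀ K ∈ N.cells, PerimeterControls Ω ΓD ΓN K := by
    intro K hK
    obtain ⟨x, hx⟩ := cell_nonempty hK
    obtain ⟨r, hr, -, hrc⟩ := hD.exists_ball hΩ hconn hΓ hdisj hDo hDne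
      ((cell_isBounded hK₀).subset hDK) (hDK.trans (cell_subset hK₀)) (cell_subset hK hx)
    obtain ⟨s, hs, hsK⟩ := Metric.isOpen_iff.1 (cell_isOpen hK) x hx
    refine PerimeterControls.convex hΩ hΓ hdisj
      (hrc.mono (Metric.ball_subset_ball (min_le_left r s)) Metric.isBounded_ball)
      Metric.isOpen_ball (Metric.nonempty_ball.2 (lt_min hr hs)) ?_ (cell_convex hK)
      (cell_isOpen hK) (cell_isBounded hK) (cell_subset hK)
    exact (Metric.ball_subset_ball (min_le_right r s)).trans hsK
  choose! c hc hcK using hcell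
  refine ⟨∑ K ∈ N.cells, c K, Finset.sum_nonneg hc, fun M hM A hA => ?_⟩
  have hsub : M.region A ∩ Ω ⊆ Ω := Set.inter_subset_right
  refine (volume_le_sum_inter N hsub hb).trans ?_
  rw [Finset.sum_mul]
  refine Finset.sum_le_sum fun K hK => le_trans ?_ (hcK K hK M hM A hA)
  refine measureReal_mono ?_ ((cell_isBounded hK).subset Set.inter_subset_right).measure_lt_top.ne
  exact Set.inter_subset_inter_left _ Set.inter_subset_left

open Classical in
/-- At scale `r`, a family of cells of small volume cannot fill the homothetic copies of a convex
set of size `r` centred at its points, hence has a large perimeter. -/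
theorem small_scale_cell (hΩ : IsOpen Ω) {ΓD ΓN : Set (Euc p)}
    (hΓ : ΓD ∪ ΓN = frontier Ω) (hdisj : Disjoint ΓD ΓN) (hsplit : M.SplitsBoundary ΓD ΓN)
    {A : Finset (Set (Euc p))} (hA : A ⊆ M.cells) {C : Set (Euc p)} (hC : Convex ℝ C)
    (hCo : IsOpen C) (hCb : Bornology.IsBounded C) (hCΩ : C ⊆ Ω) {r κ : ℝ} (hr : 0 < r)
    (hr1 : r ≤ 1) (hκ : 0 ≤ κ) (hκC : κ ≤ volume.real C)
    (hAr : volume (M.region A) ≤ ENNReal.ofReal (κ * r ^ p / 2)) :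
    ENNReal.ofReal (κ * r ^ p / 2) * volume (M.region A ∩ C) ≤
      ENNReal.ofReal (r * Metric.diam C * M.perimeter ΓD A) *
        volume (Metric.closedBall (0 : Euc p) (r * Metric.diam C)) := by
  have hA' : M.cells \ A ⊆ M.cells := Finset.sdiff_subset
  set G : Set (Euc p × Euc p) := {q | q.2 ∈ M.region A ∩ C ∧ q.1 ∈ M.region (M.cells \ A) ∧
    q.2 + r⁻¹ • (q.1 - q.2) ∈ C} with hG
  have hhom : ∀ z x : Euc p, z + r⁻¹ • (x - z) ∈ C ↔ x ∈ AffineMap.homothety z r '' C := by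
    intro z x
    constructor
    · intro h
      refine ⟨_, h, ?_⟩
      simp [AffineMap.homothety_apply, smul_smul, mul_inv_cancel₀ hr.ne']
    · rintro ⟨y, hy, rfl⟩
      simpa [AffineMap.homothety_apply, smul_smul, inv_mul_cancel₀ hr.ne'] using hy
  have hhomC : ∀ z ∈ C, ∀ x, z + r⁻¹ • (x - z) ∈ C → x ∈ C := by
    intro z hz x hx
    have := hC.add_smul_sub_mem hz hx ⟨hr.le, hr1⟩
    simpa [smul_smul, mul_inv_cancel₀ hr.ne'] using this
  have hGm : MeasurableSet G := by
    refine ((region_isOpen hA).inter hCo).measurableSet.preimage measurable_snd |>.inter ?_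
    refine ((region_isOpen hA').measurableSet.preimage measurable_fst).inter ?_
    exact hCo.measurableSet.preimage
      (show Measurable fun q : Euc p × Euc p => q.2 + r⁻¹ • (q.1 - q.2) by fun_prop)
  have hmain := prod_volume_separated_le hΩ hΓ hdisj hsplit hA (ρ := r * Metric.diam C) hGm (by
    rintro x z ⟨⟨hzA, hzC⟩, hx, hxC⟩
    refine ⟨hzA, ?_, (hC.segment_subset (hhomC z hzC x hxC) hzC).trans hCΩ, ?_⟩
    · simp only [region, Set.mem_iUnion] at hx
      obtain ⟨L, hL, hxL⟩ := hx
      rw [Finset.mem_sdiff] at hL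
      exact ⟨L, hL.1, hL.2, hxL⟩
    · have h1 := Metric.dist_le_diam_of_mem hCb hxC hzC
      rw [dist_eq_norm, add_sub_cancel_left, norm_smul, norm_inv, Real.norm_of_nonneg hr.le,
        inv_mul_le_iff₀ hr] at h1
      rwa [norm_sub_rev])
  refine le_trans ?_ hmain
  rw [Measure.prod_apply_symm hGm]
  have hslice : ∀ z : Euc p, (M.region A ∩ C).indicator
      (fun _ => ENNReal.ofReal (κ * r ^ p / 2)) z ≤ volume ((fun x => (x, z)) ⁻¹' G) := by
    intro z
    by_cases hz : z ∈ M.region A ∩ C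
    · rw [Set.indicator_of_mem hz]
      have hpre : (fun x => (x, z)) ⁻¹' G =
          (AffineMap.homothety z r '' C) ∩ M.region (M.cells \ A) := by
        ext x
        simp only [Set.mem_preimage, Set.mem_inter_iff, ← hhom]
        constructor
        · rintro ⟨-, h1, h2⟩
          exact ⟨h2, h1⟩
        · rintro ⟨h1, h2⟩
          exact ⟨hz, h2, h1⟩
      have hsubΩ : AffineMap.homothety z r '' C ⊆ Ω := fun x hx =>
        hCΩ (hhomC z hz.2 x ((hhom z x).2 hx))
      have hvol : ENNReal.ofReal (κ * r ^ p) ≤ volume (AffineMap.homothety z r '' C) := by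
        have hfin : Module.finrank ℝ (Euc p) = p := by simp
        rw [Measure.addHaar_image_homothety, hfin, abs_of_nonneg (by positivity), mul_comm κ,
          ENNReal.ofReal_mul (by positivity)]
        gcongr
        exact ENNReal.ofReal_le_of_le_toReal hκC
      rw [hpre]
      refine le_trans ?_ (volume_diff_region_le A hsubΩ)
      refine le_trans ?_ (le_measure_sdiff (μ := volume))
      refine ENNReal.le_sub_of_add_le_right (ne_top_of_le_ne_top ENNReal.ofReal_ne_top hAr) ?_
      refine le_trans (add_le_add_right hAr _) (le_trans (le_of_eq ?_) hvol)
      rw [← ENNReal.ofReal_add (by positivity) (by positivity), add_halves]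
    · rw [Set.indicator_of_notMem hz]
      exact zero_le
  refine le_trans (le_of_eq ?_) (lintegral_mono hslice)
  rw [lintegral_indicator ((region_isOpen hA).inter hCo).measurableSet, setLIntegral_const]

/-- The isoperimetric inequality at small scales. -/
theorem small_scale (N : AdmissibleMesh Ω) (hΩ : IsOpen Ω) (hb : Bornology.IsBounded Ω)
    {ΓD ΓN : Set (Euc p)} (hΓ : ΓD ∪ ΓN = frontier Ω) (hdisj : Disjoint ΓD ΓN) :
    ∃ C κ : ℝ, 0 ≤ C ∧ 0 < κ ∧ ∀ M : AdmissibleMesh Ω, M.SplitsBoundary ΓD ΓN →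
      ∀ A ⊆ M.cells, ∀ r : ℝ, 0 < r → r ≤ 1 → volume.real (M.region A) ≤ κ * r ^ p / 2 →
        volume.real (M.region A) ≤ C * r * M.perimeter ΓD A := by
  obtain ⟨κ, hκ, hκN⟩ : ∃ κ : ℝ, 0 < κ ∧ ∀ K ∈ N.cells, κ ≤ volume.real K := by
    rcases N.cells.eq_empty_or_nonempty with h | h
    · exact ⟨1, one_pos, by simp [h]⟩
    · obtain ⟨K, hK, hmin⟩ := N.cells.exists_min_image (fun K => volume.real K) h
      exact ⟨volume.real K, volume_cell_pos hK, hmin⟩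
  set V : ℝ := volume.real (Metric.closedBall (0 : Euc p) 1) with hV
  have hV0 : 0 ≤ V := measureReal_nonneg
  refine ⟨∑ K ∈ N.cells, 2 * Metric.diam K ^ (p + 1) * V / κ, κ, ?_, hκ,
    fun M hM A hA r hr hr1 hAr => ?_⟩
  · exact Finset.sum_nonneg fun K _ => by
      have := Metric.diam_nonneg (s := K)
      positivity
  refine (volume_le_sum_inter N (region_subset hA) hb).trans ?_
  rw [Finset.sum_mul, Finset.sum_mul]
  refine Finset.sum_le_sum fun K hK => ?_
  set P : ℝ := M.perimeter ΓD A with hP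
  have hP0 : 0 ≤ P := perimeter_nonneg _ _
  set D : ℝ := Metric.diam K with hD
  have hD0 : 0 ≤ D := Metric.diam_nonneg
  have hAfin : volume (M.region A) ≠ ⊤ := (hb.subset (region_subset hA)).measure_lt_top.ne
  have h1 := small_scale_cell hΩ hΓ hdisj hM hA (cell_convex hK) (cell_isOpen hK)
    (cell_isBounded hK) (cell_subset hK) hr hr1 hκ.le (hκN K hK)
    ((ENNReal.le_ofReal_iff_toReal_le hAfin (by positivity)).2 hAr)
  have hfin : Module.finrank ℝ (Euc p) = p := by simp
  rw [Measure.addHaar_closedBall _ _ (by positivity : 0 ≤ r * Metric.diam K), hfin] at h1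
  have hball : volume (Metric.ball (0 : Euc p) 1) ≤ volume (Metric.closedBall (0 : Euc p) 1) :=
    measure_mono Metric.ball_subset_closedBall
  have h2 := ENNReal.toReal_mono (ENNReal.mul_ne_top ENNReal.ofReal_ne_top
    (ENNReal.mul_ne_top ENNReal.ofReal_ne_top measure_closedBall_lt_top.ne))
    (h1.trans (mul_le_mul_right (mul_le_mul_right hball _) _))
  rw [ENNReal.toReal_mul, ENNReal.toReal_mul, ENNReal.toReal_mul,
    ENNReal.toReal_ofReal (by positivity), ENNReal.toReal_ofReal (by positivity),
    ENNReal.toReal_ofReal (by positivity)] at h2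
  have h3 : κ * r ^ p / 2 * volume.real (M.region A ∩ K) ≤
      r * D * P * ((r * D) ^ p * V) := h2
  have hrp : 0 < r ^ p := pow_pos hr p
  have h4 : r ^ p * (κ / 2 * volume.real (M.region A ∩ K)) ≤ r ^ p * (r * D ^ (p + 1) * V * P) := by
    calc r ^ p * (κ / 2 * volume.real (M.region A ∩ K))
        = κ * r ^ p / 2 * volume.real (M.region A ∩ K) := by ring
      _ ≤ r * D * P * ((r * D) ^ p * V) := h3
      _ = r ^ p * (r * D ^ (p + 1) * V * P) := by ring
  have h5 := le_of_mul_le_mul_left h4 hrp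
  rw [div_mul_eq_mul_div, div_mul_eq_mul_div, le_div_iff₀ hκ]
  linarith

/-- The isoperimetric inequality relative to `Ω ∪ ΓD`, uniformly with respect to the mesh. -/
theorem isoperimetric (N : AdmissibleMesh Ω) (hp : 2 ≤ p) (hΩ : IsOpen Ω)
    (hconn : IsPreconnected Ω) (hb : Bornology.IsBounded Ω) {ΓD ΓN : Set (Euc p)}
    (hΓ : ΓD ∪ ΓN = frontier Ω) (hdisj : Disjoint ΓD ΓN) (hsplit : N.SplitsBoundary ΓD ΓN)
    (hΓD : 0 < surf p ΓD) :
    ∃ C : ℝ, 0 < C ∧ ∀ M : AdmissibleMesh Ω, M.SplitsBoundary ΓD ΓN → ∀ A ⊆ M.cells,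
      volume.real (M.region A) ≤ C * M.perimeter ΓD A ∧
      volume.real (M.region A) ^ (p - 1) ≤ C * M.perimeter ΓD A ^ p := by
  obtain ⟨c₁, hc₁, h1⟩ := perimeterControls_domain N hΩ hconn hb hΓ hdisj hsplit hΓD
  obtain ⟨c₂, κ, hc₂, hκ, h2⟩ := small_scale N hΩ hb hΓ hdisj
  set c : ℝ := max c₁ c₂ with hc
  have hc0 : 0 ≤ c := hc₁.trans (le_max_left _ _)
  refine ⟨c + 2 / κ * c ^ p + 1, by positivity, fun M hM A hA => ?_⟩
  set a : ℝ := volume.real (M.region A) with ha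
  set P : ℝ := M.perimeter ΓD A with hP
  have hP0 : 0 ≤ P := perimeter_nonneg _ _
  have ha0 : 0 ≤ a := measureReal_nonneg
  have h3 : a ≤ c * P := by
    have := h1 M hM A hA
    rw [Set.inter_eq_left.2 (region_subset hA)] at this
    exact this.trans (mul_le_mul_of_nonneg_right (le_max_left _ _) hP0)
  have hcp : 0 ≤ 2 / κ * c ^ p := by positivity
  refine ⟨h3.trans (mul_le_mul_of_nonneg_right (by linarith) hP0), ?_⟩
  have hPp : 0 ≤ P ^ p := by positivity
  suffices h : a ^ (p - 1) ≤ 2 / κ * c ^ p * P ^ p from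
    h.trans (mul_le_mul_of_nonneg_right (by linarith) hPp)
  rcases ha0.eq_or_lt with h0 | hpos
  · rw [← h0, zero_pow (by omega)]
    positivity
  have hpow : a ^ p = a ^ (p - 1) * a := by
    rw [← pow_succ, Nat.sub_add_cancel (by omega)]
  rcases le_or_gt (2 * a / κ) 1 with hcase | hcase
  · -- the scale `r` at which the family fills at most half of the homothetic copies
    set r : ℝ := (2 * a / κ) ^ ((p : ℝ)⁻¹) with hr
    have hbase : 0 < 2 * a / κ := by positivity
    have hr0 : 0 < r := Real.rpow_pos_of_pos hbase _
    have hr1 : r ≤ 1 := Real.rpow_le_one hbase.le hcase (by positivity)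
    have hrp : r ^ p = 2 * a / κ := Real.rpow_inv_natCast_pow hbase.le (by omega)
    have h4 := h2 M hM A hA r hr0 hr1 (by rw [hrp]; field_simp; exact le_rfl)
    have h5 : a ≤ c * r * P := h4.trans (by gcongr; exact le_max_right _ _)
    have h6 : a ^ (p - 1) * a ≤ 2 / κ * c ^ p * P ^ p * a := by
      rw [← hpow]
      calc a ^ p ≤ (c * r * P) ^ p := pow_le_pow_left₀ ha0 h5 p
        _ = c ^ p * (2 * a / κ) * P ^ p := by rw [mul_pow, mul_pow, hrp]
        _ = 2 / κ * c ^ p * P ^ p * a := by ring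
    exact le_of_mul_le_mul_right h6 hpos
  · have h6 : a ^ (p - 1) * a ≤ 2 / κ * c ^ p * P ^ p * a := by
      rw [← hpow]
      calc a ^ p ≤ (c * P) ^ p := pow_le_pow_left₀ ha0 h3 p
        _ = 1 * (c ^ p * P ^ p) := by rw [mul_pow, one_mul]
        _ ≤ (2 * a / κ) * (c ^ p * P ^ p) := by gcongr
        _ = 2 / κ * c ^ p * P ^ p * a := by ring
    exact le_of_mul_le_mul_right h6 hpos

end AdmissibleMesh

/-! ### Test functions and the flux through one edge -/

/-- Discrete integration by parts, with each pair of opposite terms attributed to the side where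
the value is larger. -/
theorem sum_mul_eq_sum_oriented {ι : Type*} (S : Finset ι) (inv : ι → ι)
    (hmem : ∀ i ∈ S, inv i ∈ S) (hinv : ∀ i ∈ S, inv (inv i) = i) (F x : ι → ℝ)
    (hF : ∀ i ∈ S, F (inv i) = -F i) :
    ∑ i ∈ S, F i * x i = ∑ i ∈ S, F i * max 0 (x i - x (inv i)) := by
  have hre : ∀ h : ι → ℝ, ∑ i ∈ S, h (inv i) = ∑ i ∈ S, h i := fun h =>
    Finset.sum_nbij' inv inv hmem hmem hinv hinv (fun i _ => rfl)
  have h1 : ∑ i ∈ S, F i * max 0 (x i - x (inv i)) =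
      ∑ i ∈ S, F (inv i) * max 0 (x (inv i) - x (inv (inv i))) :=
    (hre fun i => F i * max 0 (x i - x (inv i))).symm
  have h2 : ∑ i ∈ S, F i * x i = ∑ i ∈ S, F (inv i) * x (inv i) :=
    (hre fun i => F i * x i).symm
  have h3 : ∑ i ∈ S, F i * max 0 (x i - x (inv i)) +
      ∑ i ∈ S, F (inv i) * max 0 (x (inv i) - x (inv (inv i))) =
      ∑ i ∈ S, F i * x i + ∑ i ∈ S, F (inv i) * x (inv i) := by
    rw [← Finset.sum_add_distrib, ← Finset.sum_add_distrib]
    refine Finset.sum_congr rfl fun i hi => ?_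
    rw [hinv i hi, hF i hi]
    rcases le_total (x i) (x (inv i)) with h | h
    · rw [max_eq_left (by linarith), max_eq_right (by linarith)]
      ring
    · rw [max_eq_right (by linarith), max_eq_left (by linarith)]
      ring
  linarith

/-- The properties that make `Φ` a suitable test function above the level `k`: it controls the
function `G` through the diffusion (second inequality below) and is controlled by it in the
convection term, with constant `H`. -/
structure IsTestPair (k H : ℝ) (Φ G : ℝ → ℝ) : Prop where
  left_zero : Φ k = 0
  right_zero : G k = 0
  left_mono : ∀ c a, k ≤ c → c ≤ a → Φ c ≤ Φ a
  right_mono : ∀ c a, k ≤ c → c ≤ a → G c ≤ G a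
  sq_le : ∀ c a, k ≤ c → c ≤ a → (G a - G c) ^ 2 ≤ (a - c) * (Φ a - Φ c)
  mul_le : ∀ c a, k ≤ c → c ≤ a → c * (Φ a - Φ c) ≤ H * (G a - G c)

/-- Truncations are test functions. -/
theorem isTestPair_truncation {k h : ℝ} (hkh : k ≤ h) :
    IsTestPair k h (fun x => min x h - k) (fun x => min x h - k) := by
  have hmono : ∀ c a : ℝ, c ≤ a → min c h - k ≤ min a h - k := fun c a hca =>
    sub_le_sub_right (min_le_min_right h hca) k
  have hlip : ∀ c a : ℝ, c ≤ a → min a h - min c h ≤ a - c := by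
    intro c a hca
    rcases le_total a h with h1 | h1 <;> rcases le_total c h with h2 | h2 <;>
      simp [h1, h2] <;> linarith
  refine ⟨by simp [hkh], by simp [hkh], fun c a _ h => hmono c a h, fun c a _ h => hmono c a h,
    fun c a _ hca => ?_, fun c a hkc hca => ?_⟩
  · have h1 := hlip c a hca
    have h2 := hmono c a hca
    nlinarith
  · rcases le_total c h with h1 | h1
    · have h2 := hmono c a hca
      nlinarith
    · simp [h1, h1.trans hca]

/-- The test function behind the logarithmic estimate. -/
theorem isTestPair_log {k : ℝ} (hk : 0 < k) :
    IsTestPair k 1 (fun x => 1 / k - 1 / x) (fun x => Real.log (x / k)) := by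
  refine ⟨by simp, by simp [hk.ne'], fun c a hc hca => ?_, fun c a hc hca => ?_,
    fun c a hc hca => ?_, fun c a hc hca => ?_⟩
  · have hc0 : 0 < c := hk.trans_le hc
    have := one_div_le_one_div_of_le hc0 hca
    linarith
  · have hc0 : 0 < c := hk.trans_le hc
    exact Real.log_le_log (by positivity) (by gcongr)
  · have hc0 : 0 < c := hk.trans_le hc
    have ha0 : 0 < a := hc0.trans_le hca
    set x : ℝ := Real.log a - Real.log c with hx
    have hx0 : 0 ≤ x := sub_nonneg.2 (Real.log_le_log hc0 hca)
    have e1 : Real.log (a / k) - Real.log (c / k) = x := by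
      rw [Real.log_div ha0.ne' hk.ne', Real.log_div hc0.ne' hk.ne']
      ring
    have e2 : a / c = Real.exp (x / 2) ^ 2 := by
      rw [← Real.exp_nat_mul, hx]
      push_cast
      rw [mul_div_cancel₀ _ (two_ne_zero), Real.exp_sub, Real.exp_log ha0, Real.exp_log hc0]
    have hsinh : x / 2 ≤ Real.sinh (x / 2) := Real.self_le_sinh_iff.2 (by positivity)
    rw [Real.sinh_eq] at hsinh
    set y : ℝ := Real.exp (x / 2) with hy
    have hy0 : 0 < y := Real.exp_pos _
    have e3 : Real.exp (-(x / 2)) = y⁻¹ := by rw [Real.exp_neg]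
    rw [e3] at hsinh
    have e4 : (a - c) * (1 / k - 1 / a - (1 / k - 1 / c)) = (y - y⁻¹) ^ 2 := by
      have : a = y ^ 2 * c := by
        rw [← e2]
        field_simp
      rw [this]
      field_simp
      ring
    simp only [e1]
    rw [e4]
    have h1 : x ≤ y - y⁻¹ := by linarith
    exact pow_le_pow_left₀ hx0 h1 2
  · have hc0 : 0 < c := hk.trans_le hc
    have ha0 : 0 < a := hc0.trans_le hca
    have e1 : Real.log (a / k) - Real.log (c / k) = -Real.log (c / a) := by
      rw [Real.log_div ha0.ne' hk.ne', Real.log_div hc0.ne' hk.ne', Real.log_div hc0.ne' ha0.ne']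
      ring
    have h1 := Real.log_le_sub_one_of_pos (show 0 < c / a by positivity)
    have e2 : c * (1 / k - 1 / a - (1 / k - 1 / c)) = 1 - c / a := by
      field_simp
      ring
    rw [one_mul]
    simp only [e1]
    rw [e2]
    linarith

/-- The lower bound on the flux between two values, tested with `Φ`. The identity
`B (-s) - B s = s` isolates the convection; values below `k` are replaced by `k`. -/
theorem flux_mul_test_ge {B : ℝ → ℝ} (hBpos : ∀ s, 0 < B s) (hB : ∀ s, B s - B (-s) = -s)
    {k H β s : ℝ} {Φ G : ℝ → ℝ} (hT : IsTestPair k H Φ G) (hk : 0 < k)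
    (hβ : β ≤ B (-s)) {a c : ℝ} :
    β * (max 0 (G (max k a) - G (max k c))) ^ 2 - |s| * (H * max 0 (G (max k a) - G (max k c))) ≤
      (B (-s) * a - B s * c) * max 0 (Φ (max k a) - Φ (max k c)) := by
  set a' : ℝ := max k a with ha'
  set c' : ℝ := max k c with hc'
  have hkc : k ≤ c' := le_max_left _ _
  have hka : k ≤ a' := le_max_left _ _
  rcases le_or_gt a' c' with hac | hac
  · rw [max_eq_left (sub_nonpos.2 (hT.right_mono _ _ hka hac)),
      max_eq_left (sub_nonpos.2 (hT.left_mono _ _ hka hac))]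
    simp
  · have haeq : a' = a := by
      rw [ha']
      refine max_eq_right ?_
      by_contra hcon
      push Not at hcon
      rw [ha', max_eq_left hcon.le] at hac
      exact absurd hac (not_lt.2 hkc)
    have h1 := hT.left_mono _ _ hkc hac.le
    have h2 := hT.right_mono _ _ hkc hac.le
    have h3 := hT.sq_le _ _ hkc hac.le
    have h4 := hT.mul_le _ _ hkc hac.le
    rw [max_eq_right (sub_nonneg.2 h1), max_eq_right (sub_nonneg.2 h2), ← haeq]
    set j : ℝ := Φ a' - Φ c' with hj
    have hj0 : 0 ≤ j := sub_nonneg.2 h1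
    have hc0 : 0 < c' := hk.trans_le hkc
    have hβ0 : 0 < B (-s) := hBpos _
    have hbs := hB s
    have hflux : B (-s) * (a' - c') - |s| * c' ≤ B (-s) * a' - B s * c := by
      have h5 : B s * c ≤ B s * c' := mul_le_mul_of_nonneg_left (le_max_right _ _) (hBpos s).le
      have h6 : -|s| * c' ≤ s * c' := mul_le_mul_of_nonneg_right (neg_abs_le s) hc0.le
      have h7 : s * c' = (B (-s) - B s) * c' := by
        rw [show B (-s) - B s = s by linarith]
      nlinarith
    calc β * (G a' - G c') ^ 2 - |s| * (H * (G a' - G c'))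
        ≤ B (-s) * ((a' - c') * j) - |s| * (c' * j) := by
          have h8 : β * (G a' - G c') ^ 2 ≤ B (-s) * ((a' - c') * j) := by
            calc β * (G a' - G c') ^ 2 ≤ B (-s) * (G a' - G c') ^ 2 := by gcongr
              _ ≤ B (-s) * ((a' - c') * j) := by gcongr
          have h9 : |s| * (c' * j) ≤ |s| * (H * (G a' - G c')) := by gcongr
          linarith
      _ = (B (-s) * (a' - c') - |s| * c') * j := by ring
      _ ≤ (B (-s) * a' - B s * c) * j := mul_le_mul_of_nonneg_right hflux hj0

/-! ### The energy estimate and the coarea formula -/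

namespace AdmissibleMesh

variable {p : ℕ} {Ω : Set (Euc p)} {M : AdmissibleMesh Ω} {K L σ ΓD ΓN : Set (Euc p)}

open Classical in
variable (M) in
/-- The value of a cell function `g` on the other side of an edge `σ` of `K`; the value on the
Dirichlet boundary is `0`. -/
noncomputable def outer (ΓD : Set (Euc p)) (g : Set (Euc p) → ℝ) (K σ : Set (Euc p)) : ℝ :=
  if σ ⊆ ΓD then 0 else g (M.across K σ)

variable (M) in
/-- The downward jump of a cell function across an edge. -/
noncomputable def jump (ΓD : Set (Euc p)) (g : Set (Euc p) → ℝ) (K σ : Set (Euc p)) : ℝ :=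
  max 0 (g K - M.outer ΓD g K σ)

open Classical in
variable (M) in
/-- The edges of `K` that carry a flux. -/
noncomputable def activeEdges (ΓN : Set (Euc p)) (K : Set (Euc p)) : Finset (Set (Euc p)) :=
  (M.cellEdges K).filter fun σ => ¬ σ ⊆ ΓN

variable (M) in
/-- The total variation on `Ω ∪ ΓD` of a cell function that vanishes on the Dirichlet boundary. -/
noncomputable def variation (ΓD ΓN : Set (Euc p)) (g : Set (Euc p) → ℝ) : ℝ :=
  ∑ K ∈ M.cells, ∑ σ ∈ M.activeEdges ΓN K, (surf p).real σ * M.jump ΓD g K σ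

theorem jump_nonneg (g : Set (Euc p) → ℝ) : 0 ≤ M.jump ΓD g K σ := le_max_left _ _

theorem mem_activeEdges : σ ∈ M.activeEdges ΓN K ↔ σ ∈ M.cellEdges K ∧ ¬ σ ⊆ ΓN := by
  classical
  rw [activeEdges, Finset.mem_filter]

theorem not_subset_of_not_subset_frontier (hΓ : ΓD ∪ ΓN = frontier Ω)
    (h : ¬ σ ⊆ frontier Ω) : ¬ σ ⊆ ΓD ∧ ¬ σ ⊆ ΓN :=
  ⟨fun h' => h (h'.trans (hΓ ▸ Set.subset_union_left)),
    fun h' => h (h'.trans (hΓ ▸ Set.subset_union_right))⟩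

theorem not_subset_frontier_of_active (hsplit : M.SplitsBoundary ΓD ΓN) (hK : K ∈ M.cells)
    (hσ : σ ∈ M.activeEdges ΓN K) (hσD : ¬ σ ⊆ ΓD) : ¬ σ ⊆ frontier Ω := fun h => by
  rw [mem_activeEdges] at hσ
  exact (hsplit σ (mem_edges hK hσ.1) h).elim hσD hσ.2

/-- The fluxes are conservative. -/
theorem flux_across (hΓ : ΓD ∪ ΓN = frontier Ω) (B : ℝ → ℝ) (U : Euc p → Euc p)
    (vD : Euc p → ℝ) (v : Set (Euc p) → ℝ) (hK : K ∈ M.cells) (hσ : σ ∈ M.cellEdges K)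
    (hint : ¬ σ ⊆ frontier Ω) :
    M.flux ΓD ΓN B U vD v (M.across K σ) σ = -M.flux ΓD ΓN B U vD v K σ := by
  obtain ⟨hD, hN⟩ := not_subset_of_not_subset_frontier hΓ hint
  obtain ⟨-, -, -, -, hback, -⟩ := across_spec hK hσ hint
  rw [flux, flux, if_neg hN, if_neg hN, outerValue, outerValue, if_neg hD, if_neg hD, hback,
    meanNormalVelocity_across U hK hσ hint, edgeDist_across hK hσ hint,
    transmissibility_across hK hσ hint, neg_mul, neg_neg]
  ring

/-- Testing the scheme with `φ`: by conservativity each interior edge is counted once, from the side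
where `φ` is larger. -/
theorem sum_flux_mul (hΓ : ΓD ∪ ΓN = frontier Ω) (hsplit : M.SplitsBoundary ΓD ΓN)
    (B : ℝ → ℝ) (U : Euc p → Euc p) (vD : Euc p → ℝ) (v φ : Set (Euc p) → ℝ)
    (hφ : ∀ K, 0 ≤ φ K) :
    ∑ K ∈ M.cells, ∑ σ ∈ M.cellEdges K, M.flux ΓD ΓN B U vD v K σ * φ K =
      ∑ K ∈ M.cells, ∑ σ ∈ M.activeEdges ΓN K,
        M.flux ΓD ΓN B U vD v K σ * M.jump ΓD φ K σ := by
  classical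
  have hactive : ∀ K ∈ M.cells, ∑ σ ∈ M.cellEdges K, M.flux ΓD ΓN B U vD v K σ * φ K =
      ∑ σ ∈ M.activeEdges ΓN K, M.flux ΓD ΓN B U vD v K σ * φ K := by
    intro K hK
    rw [activeEdges, Finset.sum_filter_of_ne]
    intro σ hσ hne hN
    apply hne
    rw [flux, if_pos hN, zero_mul]
  rw [Finset.sum_congr rfl hactive, Finset.sum_sigma', Finset.sum_sigma']
  set S := M.cells.sigma fun K => M.activeEdges ΓN K with hS
  rw [← Finset.sum_filter_add_sum_filter_not S (fun i => i.2 ⊆ ΓD) (fun i =>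
      M.flux ΓD ΓN B U vD v i.1 i.2 * φ i.1),
    ← Finset.sum_filter_add_sum_filter_not S (fun i => i.2 ⊆ ΓD) (fun i =>
      M.flux ΓD ΓN B U vD v i.1 i.2 * M.jump ΓD φ i.1 i.2)]
  congr 1
  · refine Finset.sum_congr rfl fun i hi => ?_
    rw [Finset.mem_filter] at hi
    rw [jump, outer, if_pos hi.2, sub_zero, max_eq_right (hφ _)]
  · have hS' : ∀ i ∈ S.filter (fun i => ¬ i.2 ⊆ ΓD), i.1 ∈ M.cells ∧ i.2 ∈ M.cellEdges i.1 ∧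
        ¬ i.2 ⊆ frontier Ω := by
      intro i hi
      rw [Finset.mem_filter, hS, Finset.mem_sigma] at hi
      exact ⟨hi.1.1, (mem_activeEdges.1 hi.1.2).1,
        not_subset_frontier_of_active hsplit hi.1.1 hi.1.2 hi.2⟩
    have key := sum_mul_eq_sum_oriented (S.filter (fun i => ¬ i.2 ⊆ ΓD))
      (fun i => ⟨M.across i.1 i.2, i.2⟩) ?_ ?_
      (fun i => M.flux ΓD ΓN B U vD v i.1 i.2) (fun i => φ i.1) ?_
    · rw [key]
      refine Finset.sum_congr rfl fun i hi => ?_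
      rw [Finset.mem_filter] at hi
      rw [jump, outer, if_neg hi.2]
    · intro i hi
      obtain ⟨hK, hσ, hint⟩ := hS' i hi
      obtain ⟨hL, -, hσL, -⟩ := across_spec hK hσ hint
      obtain ⟨hD, hN⟩ := not_subset_of_not_subset_frontier hΓ hint
      rw [Finset.mem_filter, hS, Finset.mem_sigma]
      exact ⟨⟨hL, mem_activeEdges.2 ⟨hσL, hN⟩⟩, hD⟩
    · rintro ⟨K, σ⟩ hi
      obtain ⟨hK, hσ, hint⟩ := hS' _ hi
      obtain ⟨-, -, -, -, hback, -⟩ := across_spec hK hσ hint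
      simp only [hback]
    · intro i hi
      obtain ⟨hK, hσ, hint⟩ := hS' i hi
      exact flux_across hΓ B U vD v hK hσ hint

open Classical in
variable (M) in
/-- The cells where `v` exceeds the level `k`. -/
noncomputable def superlevel (v : Set (Euc p) → ℝ) (k : ℝ) : Finset (Set (Euc p)) :=
  M.cells.filter fun K => k < v K

theorem mem_superlevel {v : Set (Euc p) → ℝ} {k : ℝ} :
    K ∈ M.superlevel v k ↔ K ∈ M.cells ∧ k < v K := by
  classical
  rw [superlevel, Finset.mem_filter]

theorem superlevel_subset (v : Set (Euc p) → ℝ) (k : ℝ) : M.superlevel v k ⊆ M.cells := by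
  intro K hK
  exact (mem_superlevel.1 hK).1

theorem volume_region {A : Finset (Set (Euc p))} (hA : A ⊆ M.cells) :
    volume.real (M.region A) = ∑ K ∈ A, volume.real K := by
  refine measureReal_biUnion_finset (fun K hK L hL hKL => ?_)
    (fun K hK => (cell_isOpen (hA hK)).measurableSet) fun K hK => (volume_cell_lt_top (hA hK)).ne
  exact cells_disjoint (hA hK) (hA hL) hKL

/-- The energy estimate: the total variation of `G ∘ v` above the level `k` is controlled by the
volume of the superlevel set. -/
theorem variation_le (hΓ : ΓD ∪ ΓN = frontier Ω)
    (hsplit : M.SplitsBoundary ΓD ΓN) {B : ℝ → ℝ} (hBpos : ∀ s, 0 < B s)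
    (hB : ∀ s, B s - B (-s) = -s) {U : Euc p → Euc p} {b f vD : Euc p → ℝ}
    {v : Set (Euc p) → ℝ} (hv : M.IsSolution ΓD ΓN B U b f vD v) {R β c F k H : ℝ}
    (hβ : 0 < β) (hc : 0 ≤ c) (hH : 0 < H) (hk : 0 < k)
    (hU : ∀ K ∈ M.cells, ∀ σ ∈ M.cellEdges K, |meanNormalVelocity U K σ| ≤ R)
    (hβB : ∀ K ∈ M.cells, ∀ σ ∈ M.cellEdges K,
      β ≤ B (-(meanNormalVelocity U K σ * M.edgeDist K σ)))
    (hreg : ∀ K ∈ M.cells, ∑ σ ∈ M.cellEdges K, (surf p).real σ * M.edgeDist K σ ≤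
      c * volume.real K)
    (hb : ∀ K ∈ M.cells, 0 ≤ ⨍ x in K, b x) (hf : ∀ K ∈ M.cells, ⨍ x in K, f x ≤ F)
    (hvD : ∀ K ∈ M.cells, ∀ σ ∈ M.cellEdges K, σ ⊆ ΓD → ⨍ x in σ, vD x ∂(surf p) ≤ k)
    {Φ G : ℝ → ℝ} (hT : IsTestPair k H Φ G) (hΦ : ∀ a, k ≤ a → F * Φ a ≤ H ^ 2) :
    M.variation ΓD ΓN (fun K => G (max k (v K))) ≤
      max 1 (c * (R + 1) / β) * H * volume.real (M.region (M.superlevel v k)) := by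
  classical
  set φ : Set (Euc p) → ℝ := fun K => Φ (max k (v K)) with hφdef
  set g : Set (Euc p) → ℝ := fun K => G (max k (v K)) with hgdef
  set a : ℝ := volume.real (M.region (M.superlevel v k)) with ha
  have haval : a = ∑ K ∈ M.superlevel v k, volume.real K := volume_region (superlevel_subset v k)
  have hφ0 : ∀ K, 0 ≤ φ K := fun K => by
    have := hT.left_mono k (max k (v K)) le_rfl (le_max_left _ _)
    rwa [hT.left_zero] at this
  have hg0 : ∀ K, 0 ≤ g K := fun K => by
    have := hT.right_mono k (max k (v K)) le_rfl (le_max_left _ _)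
    rwa [hT.right_zero] at this
  -- testing the scheme
  have htest : ∑ K ∈ M.cells, ∑ σ ∈ M.cellEdges K, M.flux ΓD ΓN B U vD v K σ * φ K ≤
      H ^ 2 * a := by
    rw [haval, Finset.mul_sum, superlevel, Finset.sum_filter]
    refine Finset.sum_le_sum fun K hK => ?_
    have heq := hv K hK
    rw [← Finset.sum_mul]
    have hvol := (volume_cell_pos hK).le
    split_ifs with hKk
    · have h1 : ∑ σ ∈ M.cellEdges K, M.flux ΓD ΓN B U vD v K σ ≤ volume.real K * F := by
        have h2 : 0 ≤ volume.real K * (⨍ x in K, b x) * v K :=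
          mul_nonneg (mul_nonneg hvol (hb K hK)) (hk.trans hKk).le
        have h3 := mul_le_mul_of_nonneg_left (hf K hK) hvol
        linarith
      calc _ ≤ volume.real K * F * φ K := mul_le_mul_of_nonneg_right h1 (hφ0 K)
        _ = volume.real K * (F * φ K) := by ring
        _ ≤ volume.real K * H ^ 2 := mul_le_mul_of_nonneg_left (hΦ _ (le_max_left _ _)) hvol
        _ = H ^ 2 * volume.real K := by ring
    · have h0 : φ K = 0 := by
        simp only [hφdef]
        rw [max_eq_left (not_lt.1 hKk), hT.left_zero]
      rw [h0, mul_zero]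
  rw [sum_flux_mul hΓ hsplit B U vD v φ hφ0] at htest
  -- the contribution of each edge
  have hedge : ∀ K ∈ M.cells, ∀ σ ∈ M.activeEdges ΓN K,
      β * (M.transmissibility K σ * M.jump ΓD g K σ ^ 2) -
        R * H * ((surf p).real σ * M.jump ΓD g K σ) ≤
      M.flux ΓD ΓN B U vD v K σ * M.jump ΓD φ K σ := by
    intro K hK σ hσ
    have hσ' := mem_activeEdges.1 hσ
    have hτ := transmissibility_pos hK hσ'.1
    have hd := edgeDist_pos hK hσ'.1
    set s : ℝ := meanNormalVelocity U K σ * M.edgeDist K σ with hs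
    set c₀ : ℝ := M.outerValue ΓD vD v K σ with hc₀
    have hout : ∀ {Ψ : ℝ → ℝ}, Ψ k = 0 →
        M.outer ΓD (fun K => Ψ (max k (v K))) K σ = Ψ (max k c₀) := by
      intro Ψ hΨ
      rw [outer, hc₀, outerValue]
      split_ifs with hD
      · rw [max_eq_left (hvD K hK σ hσ'.1 hD), hΨ]
      · rfl
    have hmain := flux_mul_test_ge hBpos hB hT hk (hβB K hK σ hσ'.1) (a := v K) (c := c₀)
    have hjφ : M.jump ΓD φ K σ = max 0 (Φ (max k (v K)) - Φ (max k c₀)) := by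
      rw [jump, hφdef, hout hT.left_zero]
    have hjg : M.jump ΓD g K σ = max 0 (G (max k (v K)) - G (max k c₀)) := by
      rw [jump, hgdef, hout hT.right_zero]
    rw [← hjφ, ← hjg] at hmain
    have hj0 : 0 ≤ M.jump ΓD g K σ := jump_nonneg g
    have hsτ : M.transmissibility K σ * |s| ≤ R * (surf p).real σ := by
      rw [hs, abs_mul, abs_of_pos hd, transmissibility, div_mul_eq_mul_div, div_le_iff₀ hd]
      have h1 := hU K hK σ hσ'.1
      have h2 : 0 ≤ (surf p).real σ * M.edgeDist K σ := mul_nonneg measureReal_nonneg hd.le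
      nlinarith
    rw [flux, if_neg hσ'.2]
    calc β * (M.transmissibility K σ * M.jump ΓD g K σ ^ 2) -
          R * H * ((surf p).real σ * M.jump ΓD g K σ)
        ≤ M.transmissibility K σ *
          (β * M.jump ΓD g K σ ^ 2 - |s| * (H * M.jump ΓD g K σ)) := by
          have h1 := mul_le_mul_of_nonneg_right hsτ (mul_nonneg hH.le hj0)
          linarith
      _ ≤ M.transmissibility K σ * ((B (-s) * v K - B s * c₀) * M.jump ΓD φ K σ) :=
          mul_le_mul_of_nonneg_left hmain hτ.le
      _ = _ := by ring
  set X : ℝ := M.variation ΓD ΓN g with hX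
  set E : ℝ := ∑ K ∈ M.cells, ∑ σ ∈ M.activeEdges ΓN K,
    M.transmissibility K σ * M.jump ΓD g K σ ^ 2 with hE
  have hX0 : 0 ≤ X := Finset.sum_nonneg fun K _ => Finset.sum_nonneg fun σ _ =>
    mul_nonneg measureReal_nonneg (jump_nonneg g)
  have henergy : β * E ≤ R * H * X + H ^ 2 * a := by
    have h1 : β * E - R * H * X ≤ H ^ 2 * a := by
      refine le_trans (le_of_eq ?_) ((Finset.sum_le_sum fun K hK =>
        Finset.sum_le_sum fun σ hσ => hedge K hK σ hσ).trans htest)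
      simp only [Finset.sum_sub_distrib, ← Finset.mul_sum, hE, hX, variation]
    linarith
  -- only the edges of the superlevel set contribute
  have hjump0 : ∀ K ∈ M.cells, K ∉ M.superlevel v k → ∀ σ ∈ M.activeEdges ΓN K,
      M.jump ΓD g K σ = 0 := by
    intro K hK hKk σ hσ
    have h1 : v K ≤ k := by
      by_contra hcon
      exact hKk (mem_superlevel.2 ⟨hK, not_le.1 hcon⟩)
    have h2 : g K = 0 := by
      simp only [hgdef]
      rw [max_eq_left h1, hT.right_zero]
    have h3 : 0 ≤ M.outer ΓD g K σ := by
      rw [outer]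
      split_ifs
      · exact le_rfl
      · exact hg0 _
    rw [jump, h2]
    exact max_eq_left (by linarith)
  have hcs : X ^ 2 ≤ E * (c * a) := by
    set T := (M.superlevel v k).sigma fun K => M.activeEdges ΓN K with hT'
    have hXT : X = ∑ i ∈ T, (surf p).real i.2 * M.jump ΓD g i.1 i.2 := by
      rw [hX, variation, Finset.sum_sigma]
      refine (Finset.sum_subset (superlevel_subset v k) fun K hK hKk => ?_).symm
      exact Finset.sum_eq_zero fun σ hσ => by rw [hjump0 K hK hKk σ hσ, mul_zero]
    have hET : E = ∑ i ∈ T, M.transmissibility i.1 i.2 * M.jump ΓD g i.1 i.2 ^ 2 := by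
      rw [hE, Finset.sum_sigma]
      refine (Finset.sum_subset (superlevel_subset v k) fun K hK hKk => ?_).symm
      exact Finset.sum_eq_zero fun σ hσ => by rw [hjump0 K hK hKk σ hσ]; simp
    have hTmem : ∀ i ∈ T, i.1 ∈ M.cells ∧ i.2 ∈ M.cellEdges i.1 := by
      intro i hi
      rw [hT', Finset.mem_sigma] at hi
      exact ⟨superlevel_subset v k hi.1, (mem_activeEdges.1 hi.2).1⟩
    have h1 := Finset.sum_sq_le_sum_mul_sum_of_sq_le_mul T
      (r := fun i => (surf p).real i.2 * M.jump ΓD g i.1 i.2)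
      (f := fun i => M.transmissibility i.1 i.2 * M.jump ΓD g i.1 i.2 ^ 2)
      (g := fun i => (surf p).real i.2 * M.edgeDist i.1 i.2)
      (fun i hi => mul_nonneg (transmissibility_pos (hTmem i hi).1 (hTmem i hi).2).le
        (sq_nonneg _))
      (fun i hi => mul_nonneg measureReal_nonneg (edgeDist_pos (hTmem i hi).1 (hTmem i hi).2).le)
      (fun i hi => by
        have hd := edgeDist_pos (hTmem i hi).1 (hTmem i hi).2
        refine le_of_eq ?_
        rw [transmissibility]
        field_simp)
    rw [← hXT, ← hET] at h1
    refine h1.trans (mul_le_mul_of_nonneg_left ?_ ?_)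
    · rw [Finset.sum_sigma, haval, Finset.mul_sum]
      refine Finset.sum_le_sum fun K hK => ?_
      have hKc := superlevel_subset v k hK
      refine le_trans (Finset.sum_le_sum_of_subset_of_nonneg ?_ fun σ hσ _ => ?_) (hreg K hKc)
      · exact fun σ hσ => (mem_activeEdges.1 hσ).1
      · exact mul_nonneg measureReal_nonneg (edgeDist_pos hKc hσ).le
    · rw [hET]
      exact Finset.sum_nonneg fun i hi =>
        mul_nonneg (transmissibility_pos (hTmem i hi).1 (hTmem i hi).2).le (sq_nonneg _)
  -- conclusion: a quadratic inequality for `X / (H * a)`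
  have ha0 : 0 ≤ a := measureReal_nonneg
  have hquad : β * X ^ 2 ≤ c * a * (R * H * X + H ^ 2 * a) := by
    calc β * X ^ 2 ≤ β * (E * (c * a)) := mul_le_mul_of_nonneg_left hcs hβ.le
      _ = c * a * (β * E) := by ring
      _ ≤ _ := mul_le_mul_of_nonneg_left henergy (mul_nonneg hc ha0)
  by_cases hsmall : X ≤ H * a
  · calc X ≤ 1 * (H * a) := by rw [one_mul]; exact hsmall
      _ ≤ max 1 (c * (R + 1) / β) * (H * a) :=
          mul_le_mul_of_nonneg_right (le_max_left _ _) (by positivity)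
      _ = _ := by ring
  · push Not at hsmall
    have hXpos : 0 < X := lt_of_le_of_lt (by positivity) hsmall
    have h1 : β * X * X ≤ c * (R + 1) * (H * a) * X := by
      have h2 : c * a * (H * (H * a)) ≤ c * a * (H * X) := by gcongr
      nlinarith
    have h3 := le_of_mul_le_mul_right h1 hXpos
    calc X ≤ c * (R + 1) / β * (H * a) := by
          rw [div_mul_eq_mul_div, le_div_iff₀ hβ]
          linarith
      _ ≤ max 1 (c * (R + 1) / β) * (H * a) :=
          mul_le_mul_of_nonneg_right (le_max_right _ _) (by positivity)
      _ = _ := by ring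

/-- A lower bound from the coarea formula: if all superlevel sets of `g` between `0` and `H` have
perimeter at least `q`, then the total variation of `g` is at least `q * H`. -/
theorem mul_le_variation (hΓ : ΓD ∪ ΓN = frontier Ω) (hdisj : Disjoint ΓD ΓN)
    {g : Set (Euc p) → ℝ} {q H : ℝ} (hH : 0 ≤ H)
    (hq : ∀ t, 0 ≤ t → t < H → q ≤ M.perimeter ΓD (M.superlevel g t)) :
    q * H ≤ M.variation ΓD ΓN g := by
  classical
  set I : Set ℝ := Set.Ico 0 H with hI
  have hIfin : volume I ≠ ⊤ := by
    rw [hI, Real.volume_Ico]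
    exact ENNReal.ofReal_ne_top
  set J : Set (Euc p) → Set (Euc p) → Set ℝ := fun K σ => Set.Ico (M.outer ΓD g K σ) (g K) with hJ
  have hper : ∀ t ∈ I, q ≤ ∑ K ∈ M.cells, ∑ σ ∈ M.activeEdges ΓN K,
      (J K σ).indicator (fun _ => (surf p).real σ) t := by
    intro t ht
    refine (hq t ht.1 ht.2).trans ?_
    rw [perimeter]
    have hnn : ∀ K σ, 0 ≤ (J K σ).indicator (fun _ => (surf p).real σ) t := fun K σ =>
      Set.indicator_nonneg (fun _ _ => measureReal_nonneg) t
    refine le_trans (Finset.sum_le_sum fun K hK => ?_)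
      (Finset.sum_le_sum_of_subset_of_nonneg (superlevel_subset g t)
        fun K _ _ => Finset.sum_nonneg fun σ _ => hnn K σ)
    have hKc := mem_superlevel.1 hK
    have hsub : M.boundaryEdges ΓD (M.superlevel g t) K ⊆ M.activeEdges ΓN K := by
      intro σ hσ
      rw [boundaryEdges, Finset.mem_filter] at hσ
      refine mem_activeEdges.2 ⟨hσ.1, ?_⟩
      rcases hσ.2 with h | ⟨h, -⟩
      · intro hN
        obtain ⟨y, hy⟩ := edge_nonempty (mem_edges hKc.1 hσ.1)
        exact Set.disjoint_left.1 hdisj (h hy) (hN hy)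
      · exact (not_subset_of_not_subset_frontier hΓ h).2
    refine le_trans (Finset.sum_le_sum fun σ hσ => ?_)
      (Finset.sum_le_sum_of_subset_of_nonneg hsub fun σ _ _ => hnn K σ)
    rw [boundaryEdges, Finset.mem_filter] at hσ
    have htJ : t ∈ J K σ := by
      refine ⟨?_, hKc.2⟩
      rw [outer]
      rcases hσ.2 with h | ⟨h, hA⟩
      · rw [if_pos h]
        exact ht.1
      · rw [if_neg (not_subset_of_not_subset_frontier hΓ h).1]
        obtain ⟨hL, -⟩ := across_spec hKc.1 hσ.1 h
        by_contra hcon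
        exact hA (mem_superlevel.2 ⟨hL, not_le.1 hcon⟩)
    rw [Set.indicator_of_mem htJ]
  have hint : ∀ K σ, IntegrableOn ((J K σ).indicator fun _ => (surf p).real σ) I := fun K σ =>
    (integrableOn_const hIfin).indicator measurableSet_Ico
  have h1 : ∫ t in I, q ≤ ∫ t in I, ∑ K ∈ M.cells, ∑ σ ∈ M.activeEdges ΓN K,
      (J K σ).indicator (fun _ => (surf p).real σ) t :=
    setIntegral_mono_on (integrableOn_const hIfin)
      (integrable_finsetSum _ fun K _ => integrable_finsetSum _ fun σ _ => hint K σ)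
      measurableSet_Ico hper
  rw [setIntegral_const, integral_finsetSum _ fun K _ =>
    integrable_finsetSum _ fun σ _ => hint K σ] at h1
  have h2 : volume.real I = H := by
    rw [hI, Real.volume_real_Ico_of_le hH, sub_zero]
  rw [h2, smul_eq_mul, mul_comm] at h1
  refine h1.trans (Finset.sum_le_sum fun K hK => ?_)
  rw [integral_finsetSum _ fun σ _ => hint K σ]
  refine Finset.sum_le_sum fun σ hσ => ?_
  rw [setIntegral_indicator measurableSet_Ico, setIntegral_const, smul_eq_mul, mul_comm]
  refine mul_le_mul_of_nonneg_left ?_ measureReal_nonneg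
  have hJfin : volume (J K σ) ≠ ⊤ := by
    rw [Real.volume_Ico]
    exact ENNReal.ofReal_ne_top
  calc volume.real (I ∩ J K σ) ≤ volume.real (J K σ) :=
        measureReal_mono Set.inter_subset_right hJfin
    _ = M.jump ΓD g K σ := by
        rw [Real.volume_real_Ico, jump, max_comm]

end AdmissibleMesh

/-! ### Uniform upper bound by De Giorgi iteration -/

/-- De Giorgi's iteration: a quantity that decays superlinearly between levels vanishes at twice
the initial level, provided that it is small at the initial level. -/
theorem nonpos_of_superlinear_decay {p : ℕ} (hp : 2 ≤ p) {a : ℝ → ℝ} (ha : ∀ t, 0 ≤ a t)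
    (hanti : Antitone a) {C c m : ℝ} (hC : 0 < C) (hc : 0 < c) (hm : 0 < m)
    (hdecay : ∀ k h, m ≤ k → k < h → (h - k) ^ p * a h ^ (p - 1) ≤ C * (c * h * a k) ^ p)
    (hsmall : a m ≤ ((1 / 2 : ℝ) ^ p) ^ (p - 1) / (C * (4 * c) ^ p)) : a (2 * m) ≤ 0 := by
  set θ : ℝ := (1 / 2 : ℝ) ^ p with hθ
  have hθ0 : 0 < θ := by positivity
  set ε : ℝ := θ ^ (p - 1) / (C * (4 * c) ^ p) with hε
  have hε0 : 0 < ε := by positivity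
  have hCε : C * (4 * c) ^ p * ε = θ ^ (p - 1) := by
    rw [hε]
    field_simp
  set lev : ℕ → ℝ := fun n => m * (2 - (1 / 2) ^ n) with hlev
  have hp1 : p - 1 + 1 = p := by omega
  have hiter : ∀ n, a (lev n) ≤ ε * θ ^ n := by
    intro n
    induction n with
    | zero =>
      have : lev 0 = m := by
        simp only [hlev, pow_zero]
        ring
      rw [this, pow_zero, mul_one]
      exact hsmall
    | succ n ih =>
      set y : ℝ := (1 / 2 : ℝ) ^ n with hy
      have hy0 : 0 < y := by positivity
      have hy1 : y ≤ 1 := pow_le_one₀ (by norm_num) (by norm_num)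
      have hl1 : lev n = m * (2 - y) := rfl
      have hl2 : lev (n + 1) = m * (2 - y / 2) := by
        simp only [hlev, pow_succ, ← hy]
        ring
      have h1 := hdecay (lev n) (lev (n + 1)) (by rw [hl1]; nlinarith) (by rw [hl1, hl2]; nlinarith)
      have hdiff : lev (n + 1) - lev n = m * (y / 2) := by
        rw [hl1, hl2]
        ring
      have hlle : lev (n + 1) ≤ 2 * m := by
        rw [hl2]
        nlinarith
      have hl0 : 0 ≤ lev (n + 1) := by
        rw [hl2]
        nlinarith
      rw [hdiff] at h1
      have h2 : (c * lev (n + 1) * a (lev n)) ^ p ≤ (c * (2 * m) * (ε * θ ^ n)) ^ p := by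
        have := ha (lev n)
        gcongr
      have hyθ : y ^ p = θ ^ n := by
        rw [hy, hθ, ← pow_mul, ← pow_mul, mul_comm]
      -- with `b = ε * θ ^ n`, the bound for the next level is `C * (4 * c) ^ p * ε * b ^ (p - 1)`
      have h3 : (m * (y / 2)) ^ p * a (lev (n + 1)) ^ (p - 1) ≤
          (m * (y / 2)) ^ p * (ε * θ ^ (n + 1)) ^ (p - 1) := by
        refine h1.trans ((mul_le_mul_of_nonneg_left h2 hC.le).trans (le_of_eq ?_))
        calc C * (c * (2 * m) * (ε * θ ^ n)) ^ p
            = C * (4 * c) ^ p * m ^ p * (1 / 2) ^ p * (ε * θ ^ n) ^ (p - 1 + 1) := by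
              rw [hp1, show c * (2 * m) * (ε * θ ^ n) = 4 * c * m * (1 / 2) * (ε * θ ^ n) by ring,
                mul_pow (4 * c * m * (1 / 2)), mul_pow (4 * c * m), mul_pow (4 * c)]
              ring
          _ = (C * (4 * c) ^ p * ε) * (m ^ p * (1 / 2) ^ p * θ ^ n) * (ε * θ ^ n) ^ (p - 1) := by
              rw [pow_succ]
              ring
          _ = (m * (y / 2)) ^ p * (ε * θ ^ (n + 1)) ^ (p - 1) := by
              rw [hCε, ← hyθ, show m * (y / 2) = m * (1 / 2) * y by ring, mul_pow (m * (1 / 2)),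
                mul_pow m, pow_succ θ n, ← mul_assoc ε, mul_pow (ε * θ ^ n) θ]
              ring
      have h4 := le_of_mul_le_mul_left h3 (by positivity)
      exact (pow_le_pow_iff_left₀ (ha _) (by positivity) (by omega)).1 h4
  have hle : ∀ n, a (2 * m) ≤ ε * θ ^ n := by
    intro n
    refine (hanti ?_).trans (hiter n)
    simp only [hlev]
    have : (0 : ℝ) < (1 / 2) ^ n := by positivity
    nlinarith
  have hθ1 : θ < 1 := pow_lt_one₀ (by norm_num) (by norm_num) (by omega)
  have hlim : Filter.Tendsto (fun n : ℕ => ε * θ ^ n) Filter.atTop (nhds 0) := by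
    have := (tendsto_pow_atTop_nhds_zero_of_lt_one hθ0.le hθ1).const_mul ε
    simpa using this
  exact ge_of_tendsto' hlim hle

namespace AdmissibleMesh

variable {p : ℕ} {Ω : Set (Euc p)} {M : AdmissibleMesh Ω} {K L σ ΓD ΓN : Set (Euc p)}

theorem volume_region_mono {A A' : Finset (Set (Euc p))} (hA' : A' ⊆ M.cells) (h : A ⊆ A') :
    volume.real (M.region A) ≤ volume.real (M.region A') := by
  rw [volume_region hA', volume_region (h.trans hA')]
  exact Finset.sum_le_sum_of_subset_of_nonneg h fun _ _ _ => measureReal_nonneg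

/-- The decay of superlevel sets, from the variation of truncations. -/
theorem superlevel_decay (hp : p ≠ 0) (hΓ : ΓD ∪ ΓN = frontier Ω) (hdisj : Disjoint ΓD ΓN) {C c : ℝ}
    (hC : 0 < C)
    (hiso : ∀ A ⊆ M.cells, volume.real (M.region A) ^ (p - 1) ≤ C * M.perimeter ΓD A ^ p)
    {v : Set (Euc p) → ℝ} {k h : ℝ} (hkh : k < h)
    (hvar : M.variation ΓD ΓN (fun K => min (max k (v K)) h - k) ≤
      c * h * volume.real (M.region (M.superlevel v k))) :
    (h - k) ^ p * volume.real (M.region (M.superlevel v h)) ^ (p - 1) ≤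
      C * (c * h * volume.real (M.region (M.superlevel v k))) ^ p := by
  set a : ℝ := volume.real (M.region (M.superlevel v h)) with ha
  have ha0 : 0 ≤ a := measureReal_nonneg
  set q : ℝ := (a ^ (p - 1) / C) ^ ((p : ℝ)⁻¹) with hq
  have hq0 : 0 ≤ q := by positivity
  have hqp : q ^ p = a ^ (p - 1) / C := Real.rpow_inv_natCast_pow (by positivity) hp
  have hlow := mul_le_variation (M := M) hΓ hdisj (q := q) (H := h - k)
    (g := fun K => min (max k (v K)) h - k) (by linarith) (by
    intro t ht0 ht
    have hsub : M.superlevel v h ⊆ M.superlevel (fun K => min (max k (v K)) h - k) t := by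
      intro K hK
      rw [mem_superlevel] at hK ⊢
      refine ⟨hK.1, ?_⟩
      rw [min_eq_right (hK.2.le.trans (le_max_right _ _))]
      exact ht
    have h1 := hiso _ (superlevel_subset (M := M) (fun K => min (max k (v K)) h - k) t)
    have h2 := pow_le_pow_left₀ ha0
      (volume_region_mono (superlevel_subset (M := M) _ t) hsub) (p - 1)
    refine (pow_le_pow_iff_left₀ hq0 (perimeter_nonneg _ _) hp).1 ?_
    rw [hqp, div_le_iff₀ hC]
    linarith)
  have h3 := pow_le_pow_left₀ (mul_nonneg hq0 (by linarith)) (hlow.trans hvar) p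
  rw [mul_pow, hqp, div_mul_eq_mul_div, div_le_iff₀ hC] at h3
  linarith

/-- The logarithmic decay of superlevel sets. -/
theorem superlevel_log (hΓ : ΓD ∪ ΓN = frontier Ω) (hdisj : Disjoint ΓD ΓN) {C c : ℝ} (hC : 0 < C)
    (hiso : ∀ A ⊆ M.cells, volume.real (M.region A) ≤ C * M.perimeter ΓD A)
    {v : Set (Euc p) → ℝ} {k h : ℝ} (hk : 0 < k) (hkh : k ≤ h)
    (hvar : M.variation ΓD ΓN (fun K => Real.log (max k (v K) / k)) ≤ c) :
    volume.real (M.region (M.superlevel v h)) * Real.log (h / k) ≤ C * c := by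
  set a : ℝ := volume.real (M.region (M.superlevel v h)) with ha
  have hlog : 0 ≤ Real.log (h / k) := Real.log_nonneg ((one_le_div hk).2 hkh)
  have hlow := mul_le_variation (M := M) hΓ hdisj (q := a / C) (H := Real.log (h / k))
    (g := fun K => Real.log (max k (v K) / k)) hlog (by
    intro t ht0 ht
    have hsub : M.superlevel v h ⊆ M.superlevel (fun K => Real.log (max k (v K) / k)) t := by
      intro K hK
      rw [mem_superlevel] at hK ⊢
      refine ⟨hK.1, ht.trans_le (Real.log_le_log (div_pos (hk.trans_le hkh) hk) ?_)⟩
      gcongr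
      exact hK.2.le.trans (le_max_right _ _)
    rw [div_le_iff₀ hC, mul_comm]
    exact (volume_region_mono (superlevel_subset (M := M) _ t) hsub).trans
      (hiso _ (superlevel_subset (M := M) (fun K => Real.log (max k (v K) / k)) t)))
  have h3 := hlow.trans hvar
  rw [div_mul_eq_mul_div, div_le_iff₀ hC] at h3
  linarith

/-- The a priori upper bound on solutions, uniform with respect to the mesh. -/
theorem exists_upper_bound (N : AdmissibleMesh Ω) (hp : 2 ≤ p) (hΩ : IsPolygonalDomain Ω)
    (hΓ : ΓD ∪ ΓN = frontier Ω) (hdisj : Disjoint ΓD ΓN) (hsplit : N.SplitsBoundary ΓD ΓN)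
    (hΓD : 0 < surf p ΓD) {ξ : ℝ} (hξ : 0 < ξ) {B : ℝ → ℝ} (hB : IsBFunction B) (R : ℝ) :
    ∃ Λ : ℝ, 0 ≤ Λ ∧ ∀ M : AdmissibleMesh Ω, M.SplitsBoundary ΓD ΓN → M.IsRegular ξ →
      ∀ (U : Euc p → Euc p) (b f vD : Euc p → ℝ) (v : Set (Euc p) → ℝ) (F G : ℝ),
        0 ≤ F → 0 ≤ G → M.IsSolution ΓD ΓN B U b f vD v →
        (∀ K ∈ M.cells, ∀ σ ∈ M.cellEdges K, |meanNormalVelocity U K σ| ≤ R) →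
        (∀ K ∈ M.cells, 0 ≤ ⨍ x in K, b x) → (∀ K ∈ M.cells, ⨍ x in K, f x ≤ F) →
        (∀ K ∈ M.cells, ∀ σ ∈ M.cellEdges K, σ ⊆ ΓD → ⨍ x in σ, vD x ∂(surf p) ≤ G) →
        ∀ K ∈ M.cells, v K ≤ Λ * (1 + F + G) := by
  obtain ⟨⟨lip, hlip⟩, -, hBpos, hBid⟩ := hB
  obtain ⟨C, hC, hiso⟩ := isoperimetric N hp hΩ.isOpen hΩ.2.isPreconnected hΩ.isBounded hΓ hdisj
    hsplit hΓD
  set D : ℝ := Metric.diam (closure Ω) with hD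
  have hD0 : 0 ≤ D := Metric.diam_nonneg
  -- `β` bounds `B` from below on the range of its arguments, as `d_σ ≤ diam Ω`
  obtain ⟨s₀, -, hs₀⟩ := (isCompact_Icc (a := -(|R| * D)) (b := |R| * D)).exists_isMinOn
    ⟨0, by constructor <;> nlinarith [abs_nonneg R]⟩ hlip.continuous.continuousOn
  set β : ℝ := B s₀ with hβ
  have hβ0 : 0 < β := hBpos s₀
  set c : ℝ := max 1 (2 ^ p / ξ * (|R| + 1) / β) with hc
  have hc0 : 0 < c := lt_of_lt_of_le one_pos (le_max_left _ _)
  set V : ℝ := volume.real Ω with hV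
  have hV0 : 0 ≤ V := measureReal_nonneg
  -- `ε` is the smallness threshold of the iteration, and `l` the logarithm of the ratio of levels
  -- after which the logarithmic estimate brings the superlevel sets below it
  set ε : ℝ := ((1 / 2 : ℝ) ^ p) ^ (p - 1) / (C * (4 * c) ^ p) with hε
  have hε0 : 0 < ε := by positivity
  set l : ℝ := C * (c * V) / ε + 1 with hl
  have hl0 : 0 < l := by positivity
  refine ⟨2 * Real.exp l, by positivity, fun M hM hreg U b f vD v F G hF hG hv hU hb hf hvD => ?_⟩
  have hvar : ∀ {k H : ℝ} {Φ Ψ : ℝ → ℝ}, 0 < k → G ≤ k → 0 < H → IsTestPair k H Φ Ψ →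
      (∀ a, k ≤ a → F * Φ a ≤ H ^ 2) → M.variation ΓD ΓN (fun K => Ψ (max k (v K))) ≤
        c * H * volume.real (M.region (M.superlevel v k)) := by
    intro k H Φ Ψ hk hGk hH hT hΦ
    refine variation_le hΓ hM hBpos hBid hv hβ0 (by positivity) hH hk
      (fun K hK σ hσ => (hU K hK σ hσ).trans (le_abs_self R)) (fun K hK σ hσ => hs₀ ?_)
      (fun K hK => sum_surf_mul_edgeDist_le hξ hreg hK) hb hf
      (fun K hK σ hσ hσD => (hvD K hK σ hσ hσD).trans hGk) hT hΦ
    have h1 : |meanNormalVelocity U K σ * M.edgeDist K σ| ≤ |R| * D := by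
      rw [abs_mul, abs_of_pos (edgeDist_pos hK hσ)]
      exact mul_le_mul ((hU K hK σ hσ).trans (le_abs_self R))
        (edgeDist_le_diam hΩ.isBounded hK hσ) (edgeDist_pos hK hσ).le (abs_nonneg R)
    rw [abs_le] at h1
    exact ⟨by linarith [h1.2], by linarith [h1.1]⟩
  set k₀ : ℝ := 1 + F + G with hk₀
  have hk₀pos : 0 < k₀ := by positivity
  set m : ℝ := k₀ * Real.exp l with hm
  have hkm : k₀ ≤ m := le_mul_of_one_le_right hk₀pos.le (Real.one_le_exp hl0.le)
  have hm0 : 0 < m := hk₀pos.trans_le hkm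
  set a : ℝ → ℝ := fun t => volume.real (M.region (M.superlevel v t)) with ha
  have ha0 : ∀ t, 0 ≤ a t := fun t => measureReal_nonneg
  have haV : ∀ t, a t ≤ V := fun t => measureReal_mono (region_subset (superlevel_subset v t))
    hΩ.isBounded.measure_lt_top.ne
  have hanti : Antitone a := by
    intro s t hst
    refine volume_region_mono (superlevel_subset v s) fun K hK => ?_
    rw [mem_superlevel] at hK ⊢
    exact ⟨hK.1, hst.trans_lt hK.2⟩
  have hsmall : a m ≤ ε := by
    have h1 := hvar hk₀pos (by linarith) one_pos (isTestPair_log hk₀pos) (fun x hx => by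
      have hx0 : 0 < x := hk₀pos.trans_le hx
      calc F * (1 / k₀ - 1 / x) ≤ F * (1 / k₀) := by
            gcongr
            linarith [one_div_pos.2 hx0]
        _ ≤ 1 ^ 2 := by
            rw [mul_one_div, one_pow, div_le_one hk₀pos]
            linarith)
    have h2 : M.variation ΓD ΓN (fun K => Real.log (max k₀ (v K) / k₀)) ≤ c * V := by
      refine h1.trans ?_
      rw [mul_one]
      exact mul_le_mul_of_nonneg_left (haV k₀) hc0.le
    have h3 := superlevel_log hΓ hdisj hC (fun A hA => (hiso M hM A hA).1) hk₀pos hkm h2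
    rw [hm, mul_div_cancel_left₀ _ hk₀pos.ne', Real.log_exp] at h3
    have h4 : C * (c * V) ≤ ε * l := by
      rw [hl, mul_add, mul_div_cancel₀ _ hε0.ne']
      linarith
    exact le_of_mul_le_mul_right (h3.trans h4) hl0
  have hzero : a (2 * m) ≤ 0 := by
    refine nonpos_of_superlinear_decay hp ha0 hanti hC hc0 hm0 (fun k h hk hkh => ?_) hsmall
    have hk0 : 0 < k := hm0.trans_le hk
    have hFh : F ≤ h := by linarith
    have htrunc : ∀ x, k ≤ x → F * (min x h - k) ≤ h ^ 2 := by
      intro x hx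
      have h1 : min x h - k ≤ h := by linarith [min_le_right x h]
      have h2 : 0 ≤ min x h - k := sub_nonneg.2 (le_min hx hkh.le)
      calc F * (min x h - k) ≤ h * h := mul_le_mul hFh h1 h2 (hF.trans hFh)
        _ = h ^ 2 := by ring
    have h3 := hvar (H := h) (Φ := fun x => min x h - k) (Ψ := fun x => min x h - k) hk0
      (by linarith) (hk0.trans hkh) (isTestPair_truncation hkh.le) htrunc
    exact superlevel_decay (by omega) hΓ hdisj hC (fun A hA => (hiso M hM A hA).2) hkh h3
  intro K hK
  by_contra hcon
  push Not at hcon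
  have hKmem : K ∈ M.superlevel v (2 * m) := by
    refine mem_superlevel.2 ⟨hK, ?_⟩
    calc 2 * m = 2 * Real.exp l * k₀ := by rw [hm]; ring
      _ < v K := hcon
  have h1 : volume.real K ≤ a (2 * m) := by
    simp only [ha]
    rw [volume_region (superlevel_subset v _)]
    exact Finset.single_le_sum (f := fun K => volume.real K) (fun _ _ => measureReal_nonneg) hKmem
  linarith [volume_cell_pos hK]

end AdmissibleMesh

/-! ### The data of the scheme -/

theorem setAverage_le {α : Type*} [MeasurableSpace α] {μ : Measure α} {s : Set α} {g : α → ℝ}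
    {c : ℝ} (hs : μ s ≠ ⊤) (hc : 0 ≤ c) (h : ∀ᵐ x ∂(μ.restrict s), g x ≤ c) :
    ⨍ x in s, g x ∂μ ≤ c := by
  rw [setAverage_eq, smul_eq_mul]
  by_cases hg : Integrable g (μ.restrict s)
  · have h1 : ∫ x in s, g x ∂μ ≤ μ.real s * c := by
      have h2 := integral_mono_ae hg (integrableOn_const hs) h
      rwa [setIntegral_const, smul_eq_mul] at h2
    rcases (measureReal_nonneg (μ := μ) (s := s)).eq_or_lt with h0 | h0
    · rw [← h0, inv_zero, zero_mul]
      exact hc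
    · rwa [inv_mul_le_iff₀ h0]
  · rw [integral_undef hg, mul_zero]
    exact hc

theorem linftyNorm_nonneg {α F : Type*} [MeasurableSpace α] [NormedAddCommGroup F]
    (μ : Measure α) (g : α → F) : 0 ≤ linftyNorm μ g := ENNReal.toReal_nonneg

theorem ae_norm_le_linftyNorm {α F : Type*} [MeasurableSpace α] [NormedAddCommGroup F]
    {μ : Measure α} {g : α → F} (hg : eLpNorm g ⊤ μ ≠ ⊤) : ∀ᵐ x ∂μ, ‖g x‖ ≤ linftyNorm μ g := by
  rw [eLpNorm_exponent_top] at hg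
  filter_upwards [ae_le_eLpNormEssSup (f := g) (μ := μ)] with x hx
  rw [linftyNorm, eLpNorm_exponent_top, ← toReal_enorm]
  exact ENNReal.toReal_mono hg hx

theorem ae_le_linftyNorm_posPart {α : Type*} [MeasurableSpace α] {μ : Measure α} {g : α → ℝ}
    (hg : MemLp g ⊤ μ) : ∀ᵐ x ∂μ, g x ≤ linftyNorm μ fun x => max (g x) 0 := by
  have hfin : eLpNorm (fun x => max (g x) 0) ⊤ μ ≠ ⊤ := by
    refine ((eLpNorm_mono fun x => ?_).trans_lt hg.2).ne
    rw [Real.norm_of_nonneg (le_max_right _ _), Real.norm_eq_abs]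
    exact max_le (le_abs_self _) (abs_nonneg _)
  filter_upwards [ae_norm_le_linftyNorm hfin] with x hx
  exact (le_max_left _ _).trans ((le_abs_self _).trans hx)

/-- A continuous field is bounded by its essential supremum everywhere. -/
theorem norm_le_linftyNorm_of_continuousOn {p : ℕ} {Ω : Set (Euc p)} (hΩ : IsOpen Ω)
    (hb : Bornology.IsBounded Ω) {U : Euc p → Euc p} (hU : ContinuousOn U (closure Ω)) :
    ∀ x ∈ closure Ω, ‖U x‖ ≤ linftyNorm (volume.restrict Ω) U := by
  obtain ⟨c, hc⟩ := (hb.isCompact_closure).exists_bound_of_continuousOn hU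
  have hfin : eLpNorm U ⊤ (volume.restrict Ω) ≠ ⊤ := by
    have h1 : ∀ᵐ x ∂(volume.restrict Ω), ‖U x‖ ≤ c := by
      filter_upwards [ae_restrict_mem hΩ.measurableSet] with x hx
      exact hc x (subset_closure hx)
    rw [eLpNorm_exponent_top]
    exact (eLpNormEssSup_lt_top_of_ae_bound h1).ne
  have hae := ae_norm_le_linftyNorm hfin
  set R : ℝ := linftyNorm (volume.restrict Ω) U with hR
  have hin : ∀ x ∈ Ω, ‖U x‖ ≤ R := by
    intro x hx
    by_contra hcon
    have hopen : IsOpen (Ω ∩ (fun x => ‖U x‖) ⁻¹' Set.Ioi R) :=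
      (hU.mono subset_closure).norm.isOpen_inter_preimage hΩ isOpen_Ioi
    refine (hopen.measure_pos volume ⟨x, hx, not_le.1 hcon⟩).ne' ?_
    rw [ae_restrict_iff' hΩ.measurableSet, ae_iff] at hae
    refine measure_mono_null ?_ hae
    rintro y ⟨hy, hyR⟩ h
    exact not_le.2 hyR (h hy)
  intro x hx
  have hmaps : Set.MapsTo (fun x => ‖U x‖) Ω (Set.Iic R) := hin
  have := hmaps.closure_of_continuousOn hU.norm hx
  rwa [isClosed_Iic.closure_eq] at this

namespace AdmissibleMesh

variable {p : ℕ} {Ω : Set (Euc p)} {M : AdmissibleMesh Ω} {K σ ΓD ΓN : Set (Euc p)}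

theorem abs_meanNormalVelocity_le (hK : K ∈ M.cells) (hσ : σ ∈ M.cellEdges K) {U : Euc p → Euc p}
    {R : ℝ} (hU : ∀ x ∈ closure Ω, ‖U x‖ ≤ R) : |meanNormalVelocity U K σ| ≤ R := by
  have hE := mem_edges hK hσ
  have hn := (outwardNormal_spec hK hσ).1.1
  have hm := surf_edge_pos hK hσ
  rw [meanNormalVelocity, setAverage_eq, smul_eq_mul, abs_mul, abs_of_pos (inv_pos.2 hm),
    inv_mul_le_iff₀ hm, mul_comm, ← Real.norm_eq_abs]
  refine norm_setIntegral_le_of_norm_le_const (surf_edge_lt_top hK hσ) fun x hx => ?_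
  calc ‖(inner ℝ (U x) (outwardNormal K σ) : ℝ)‖ ≤ ‖U x‖ * ‖outwardNormal K σ‖ :=
        norm_inner_le_norm _ _
    _ = ‖U x‖ := by rw [hn, mul_one]
    _ ≤ R := hU x ((M.edge_isEdge σ hE).2 hx)

/-! ### Existence and uniqueness -/

theorem flux_add (B : ℝ → ℝ) (U : Euc p → Euc p) (vD : Euc p → ℝ) (v w : Set (Euc p) → ℝ) :
    M.flux ΓD ΓN B U vD (v + w) K σ =
      M.flux ΓD ΓN B U vD v K σ + M.flux ΓD ΓN B U 0 w K σ := by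
  simp only [flux, outerValue]
  split_ifs <;> simp <;> ring

theorem flux_smul (B : ℝ → ℝ) (U : Euc p → Euc p) (t : ℝ) (w : Set (Euc p) → ℝ) :
    M.flux ΓD ΓN B U 0 (t • w) K σ = t * M.flux ΓD ΓN B U 0 w K σ := by
  simp only [flux, outerValue]
  split_ifs <;> simp <;> ring

theorem flux_neg (B : ℝ → ℝ) (U : Euc p → Euc p) (vD : Euc p → ℝ) (v : Set (Euc p) → ℝ) :
    M.flux ΓD ΓN B U (fun x => -vD x) (-v) K σ = -M.flux ΓD ΓN B U vD v K σ := by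
  simp only [flux, outerValue]
  split_ifs
  · simp
  · simp only [Pi.neg_apply, average_eq, integral_neg, smul_neg]
    ring
  · simp only [Pi.neg_apply]
    ring

theorem IsSolution.neg {B : ℝ → ℝ} {U : Euc p → Euc p} {b f vD : Euc p → ℝ}
    {v : Set (Euc p) → ℝ} (hv : M.IsSolution ΓD ΓN B U b f vD v) :
    M.IsSolution ΓD ΓN B U b (fun x => -f x) (fun x => -vD x) (-v) := by
  intro K hK
  have h := hv K hK
  simp only [flux_neg, Finset.sum_neg_distrib, Pi.neg_apply]
  rw [show ⨍ x in K, -f x = -⨍ x in K, f x by simp only [average_eq, integral_neg, smul_neg]]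
  linarith

theorem IsSolution.sub {B : ℝ → ℝ} {U : Euc p → Euc p} {b f vD : Euc p → ℝ}
    {v v' : Set (Euc p) → ℝ} (hv : M.IsSolution ΓD ΓN B U b f vD v)
    (hv' : M.IsSolution ΓD ΓN B U b f vD v') :
    M.IsSolution ΓD ΓN B U b 0 0 (v' - v) := by
  intro K hK
  have h := hv K hK
  have h' := hv' K hK
  have e : ∀ σ, M.flux ΓD ΓN B U vD v' K σ =
      M.flux ΓD ΓN B U vD v K σ + M.flux ΓD ΓN B U 0 (v' - v) K σ := fun σ => by
    rw [← flux_add, add_sub_cancel]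
  simp only [e, Finset.sum_add_distrib] at h'
  simp only [Pi.sub_apply, Pi.zero_apply, average_zero, mul_zero]
  linarith

theorem IsSolution.smul {B : ℝ → ℝ} {U : Euc p → Euc p} {b : Euc p → ℝ}
    {v : Set (Euc p) → ℝ} (hv : M.IsSolution ΓD ΓN B U b 0 0 v) (t : ℝ) :
    M.IsSolution ΓD ΓN B U b 0 0 (t • v) := by
  intro K hK
  have h := hv K hK
  simp only [flux_smul, ← Finset.mul_sum, Pi.smul_apply, Pi.zero_apply, average_zero, mul_zero,
    smul_eq_mul] at h ⊢
  linear_combination t * h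

/-- A bound on the solutions of the homogeneous problem forces uniqueness, by scaling, hence
existence, the scheme being a square linear system. -/
theorem exists_isSolution {B : ℝ → ℝ} {U : Euc p → Euc p} {b : Euc p → ℝ} (f vD : Euc p → ℝ)
    {Λ : ℝ} (hΛ : ∀ v, M.IsSolution ΓD ΓN B U b 0 0 v → ∀ K ∈ M.cells, v K ≤ Λ) :
    ∃ v, M.IsSolution ΓD ΓN B U b f vD v ∧
      ∀ v', M.IsSolution ΓD ΓN B U b f vD v' → ∀ K ∈ M.cells, v' K = v K := by
  classical
  have hle : ∀ v, M.IsSolution ΓD ΓN B U b 0 0 v → ∀ K ∈ M.cells, v K ≤ 0 := by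
    intro v hv K hK
    by_contra hcon
    push Not at hcon
    have h1 := hΛ _ (hv.smul ((|Λ| + 1) / v K)) K hK
    rw [Pi.smul_apply, smul_eq_mul, div_mul_cancel₀ _ hcon.ne'] at h1
    linarith [le_abs_self Λ]
  have hzero : ∀ v, M.IsSolution ΓD ΓN B U b 0 0 v → ∀ K ∈ M.cells, v K = 0 := by
    intro v hv K hK
    refine le_antisymm (hle v hv K hK) ?_
    have h1 := hle _ (hv.smul (-1)) K hK
    simp only [Pi.smul_apply, smul_eq_mul] at h1
    linarith
  -- extension by zero of a vector indexed by the cells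
  set ext : (M.cells → ℝ) → Set (Euc p) → ℝ := fun u K =>
    if h : K ∈ M.cells then u ⟨K, h⟩ else 0 with hext
  have hext_add : ∀ u w, ext (u + w) = ext u + ext w := by
    intro u w
    funext K
    simp only [hext, Pi.add_apply]
    split_ifs <;> simp
  have hext_smul : ∀ (t : ℝ) u, ext (t • u) = t • ext u := by
    intro t u
    funext K
    simp only [hext, Pi.smul_apply]
    split_ifs <;> simp
  have hext_mem : ∀ u (K : M.cells), ext u K = u K := fun u K => by
    simp only [hext, K.2, dif_pos, Subtype.coe_eta]
  set T : (M.cells → ℝ) →ₗ[ℝ] (M.cells → ℝ) :=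
    { toFun := fun u K => ∑ σ ∈ M.cellEdges K, M.flux ΓD ΓN B U 0 (ext u) K σ +
        volume.real (K : Set (Euc p)) * (⨍ x in (K : Set (Euc p)), b x) * u K
      map_add' := fun u w => by
        funext K
        simp only [hext_add, flux_add, Finset.sum_add_distrib, Pi.add_apply]
        ring
      map_smul' := fun t u => by
        funext K
        simp only [hext_smul, flux_smul, ← Finset.mul_sum, Pi.smul_apply, smul_eq_mul,
          RingHom.id_apply]
        ring } with hT
  have hTapp : ∀ u (K : M.cells), T u K = ∑ σ ∈ M.cellEdges K, M.flux ΓD ΓN B U 0 (ext u) K σ +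
      volume.real (K : Set (Euc p)) * (⨍ x in (K : Set (Euc p)), b x) * u K := fun u K => rfl
  have hinj : Function.Injective T := by
    rw [← LinearMap.ker_eq_bot, LinearMap.ker_eq_bot']
    intro u hu
    have hsol : M.IsSolution ΓD ΓN B U b 0 0 (ext u) := by
      intro K hK
      have h1 := congrFun hu ⟨K, hK⟩
      rw [hTapp, ← hext_mem u ⟨K, hK⟩] at h1
      simpa using h1
    funext K
    rw [← hext_mem u K]
    exact hzero _ hsol K K.2
  obtain ⟨u, hu⟩ := LinearMap.injective_iff_surjective.1 hinj fun K =>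
    volume.real (K : Set (Euc p)) * (⨍ x in (K : Set (Euc p)), f x) -
      ∑ σ ∈ M.cellEdges K, M.flux ΓD ΓN B U vD 0 K σ
  have hsol : M.IsSolution ΓD ΓN B U b f vD (ext u) := by
    intro K hK
    have h1 := congrFun hu ⟨K, hK⟩
    rw [hTapp, ← hext_mem u ⟨K, hK⟩] at h1
    have e : ∀ σ, M.flux ΓD ΓN B U vD (ext u) K σ =
        M.flux ΓD ΓN B U vD 0 K σ + M.flux ΓD ΓN B U 0 (ext u) K σ := fun σ => by
      rw [← flux_add, zero_add]
    simp only [e, Finset.sum_add_distrib]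
    simp only at h1
    linarith
  refine ⟨ext u, hsol, fun v' hv' K hK => ?_⟩
  have h1 := hzero _ (hsol.sub hv') K hK
  rw [Pi.sub_apply] at h1
  linarith

end AdmissibleMesh

/-! ### The theorem -/

theorem theorem1 (p : ℕ) (hp : p = 2 ∨ p = 3)
    (Ω : Set (Euc p)) (hΩ : IsPolygonalDomain Ω)
    (ΓD ΓN : Set (Euc p)) (hΓ : ΓD ∪ ΓN = frontier Ω) (hdisj : Disjoint ΓD ΓN)
    (hΓDm : MeasurableSet ΓD) (hΓD : 0 < surf p ΓD)
    (ξ : ℝ) (hξ : 0 < ξ) (B : ℝ → ℝ) (hB : IsBFunction B) :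
    ∃ Mup Mlow : ℝ → ℝ → ℝ → ℝ,
      (∀ r s t : ℝ, 0 ≤ Mup r s t ∧ 0 ≤ Mlow r s t) ∧
      ∀ (M : AdmissibleMesh Ω), M.SplitsBoundary ΓD ΓN → M.IsRegular ξ →
      ∀ (U : Euc p → Euc p) (b f vD : Euc p → ℝ),
        ContinuousOn U (closure Ω) →
        MemLp b ⊤ (volume.restrict Ω) → (∀ᵐ x ∂(volume.restrict Ω), 0 ≤ b x) →
        MemLp f ⊤ (volume.restrict Ω) →
        MemLp vD ⊤ ((surf p).restrict ΓD) →
        ∃ v : Set (Euc p) → ℝ, M.IsSolution ΓD ΓN B U b f vD v ∧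
          (∀ v' : Set (Euc p) → ℝ, M.IsSolution ΓD ΓN B U b f vD v' →
            ∀ K ∈ M.cells, v' K = v K) ∧
          ∀ K ∈ M.cells,
            -Mlow (linftyNorm (volume.restrict Ω) U)
                (linftyNorm (volume.restrict Ω) fun x => max (-f x) 0)
                (linftyNorm ((surf p).restrict ΓD) fun x => max (-vD x) 0) ≤ v K ∧
            v K ≤ Mup (linftyNorm (volume.restrict Ω) U)
                (linftyNorm (volume.restrict Ω) fun x => max (f x) 0)
                (linftyNorm ((surf p).restrict ΓD) fun x => max (vD x) 0) := by
  -- Without any admissible mesh there is nothing to bound; otherwise the constants of the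
  -- isoperimetric inequality are obtained from one fixed mesh.
  by_cases hN : ∃ N : AdmissibleMesh Ω, N.SplitsBoundary ΓD ΓN
  swap
  · exact ⟨fun _ _ _ => 0, fun _ _ _ => 0, fun _ _ _ => ⟨le_rfl, le_rfl⟩,
      fun M hM => absurd ⟨M, hM⟩ hN⟩
  obtain ⟨N, hN⟩ := hN
  have hp2 : 2 ≤ p := by omega
  choose Λ hΛ0 hΛ using fun R => N.exists_upper_bound hp2 hΩ hΓ hdisj hN hΓD hξ hB R
  refine ⟨fun r s t => Λ r * (1 + |s| + |t|), fun r s t => Λ r * (1 + |s| + |t|), fun r s t => ?_,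
    fun M hM hreg U b f vD hU hbm hb hf hvD => ?_⟩
  · have := hΛ0 r
    constructor <;> positivity
  set R : ℝ := linftyNorm (volume.restrict Ω) U with hR
  have hUσ : ∀ K ∈ M.cells, ∀ σ ∈ M.cellEdges K, |meanNormalVelocity U K σ| ≤ R :=
    fun K hK σ hσ => AdmissibleMesh.abs_meanNormalVelocity_le hK hσ
      (norm_le_linftyNorm_of_continuousOn hΩ.isOpen hΩ.isBounded hU)
  have hbK : ∀ K ∈ M.cells, 0 ≤ ⨍ x in K, b x := by
    intro K hK
    rw [setAverage_eq]
    exact smul_nonneg (inv_nonneg.2 measureReal_nonneg) (integral_nonneg_of_ae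
      (ae_restrict_of_ae_restrict_of_subset (AdmissibleMesh.cell_subset hK) hb))
  have hcell : ∀ {g : Euc p → ℝ}, MemLp g ⊤ (volume.restrict Ω) → ∀ K ∈ M.cells,
      ⨍ x in K, g x ≤ linftyNorm (volume.restrict Ω) fun x => max (g x) 0 := fun hg K hK =>
    setAverage_le (AdmissibleMesh.volume_cell_lt_top hK).ne (linftyNorm_nonneg _ _)
      (ae_restrict_of_ae_restrict_of_subset (AdmissibleMesh.cell_subset hK)
        (ae_le_linftyNorm_posPart hg))
  have hedge : ∀ {g : Euc p → ℝ}, MemLp g ⊤ ((surf p).restrict ΓD) → ∀ K ∈ M.cells,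
      ∀ σ ∈ M.cellEdges K, σ ⊆ ΓD →
        ⨍ x in σ, g x ∂(surf p) ≤ linftyNorm ((surf p).restrict ΓD) fun x => max (g x) 0 :=
    fun hg K hK σ hσ hσD => setAverage_le (AdmissibleMesh.surf_edge_lt_top hK hσ).ne
      (linftyNorm_nonneg _ _)
      (ae_restrict_of_ae_restrict_of_subset hσD (ae_le_linftyNorm_posPart hg))
  obtain ⟨v, hv, huniq⟩ := M.exists_isSolution f vD (Λ := Λ R * (1 + 0 + 0))
    fun v hv => hΛ R M hM hreg U b 0 0 v 0 0 le_rfl le_rfl hv hUσ hbK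
      (fun K _ => by simp) (fun K _ σ _ _ => by simp)
  refine ⟨v, hv, huniq, fun K hK => ⟨?_, ?_⟩⟩
  · have h := hΛ R M hM hreg U b _ _ _ _ _ (linftyNorm_nonneg _ _) (linftyNorm_nonneg _ _) hv.neg
      hUσ hbK (hcell hf.neg) (hedge hvD.neg) K hK
    simp only [Pi.neg_apply] at h ⊢
    rw [abs_of_nonneg (linftyNorm_nonneg _ _), abs_of_nonneg (linftyNorm_nonneg _ _)]
    linarith
  · have h := hΛ R M hM hreg U b f vD v _ _ (linftyNorm_nonneg _ _) (linftyNorm_nonneg _ _) hv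
      hUσ hbK (hcell hf) (hedge hvD) K hK
    simp only
    rwa [abs_of_nonneg (linftyNorm_nonneg _ _), abs_of_nonneg (linftyNorm_nonneg _ _)]
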